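/- Consider a Hex board of size $4\times n$: its cells are the pairs $(i,j)$ with $1\le i\le 4$ (rows) and $1\le j\le n$ (columns), and two cells are adjacent if one is obtained from the other by adding one of $\pm(0,1)$, $\pm(1,0)$, $\pm(1,-1)$. Black owns the left and right edges (columns $1$ and $n$) and White owns the top and bottom edges (rows $1$ and $4$). Two players, Black and White, alternately place a stone of their own colour on an empty cell until the board is full; Black wins if there is a chain of pairwise consecutively adjacent black stones from column $1$ to column $n$, and White wins otherwise (equivalently, if a chain of white stones joins row $1$ to row $4$). A set of black stones placed on an otherwise empty board is called a virtual connection between Black's edges if Black wins the game from this position under optimal play even if White moves first. Theorem. For all $n\geq 4$, the minimal number of black stones in a virtual connection between Black's edges on a board of size $4\times n$ is exactly $\left\lceil \tfrac{2}{3}n-2\right\rceil$. -/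

import Mathlib

namespace HexBoard

/-- The two colours of stones; each player is identified with the colour of that player's stones. -/
inductive Stone where
  | black
  | white
  deriving DecidableEq

/-- The cells of a Hex board of size `k × n`, with `k` rows and `n` columns, as pairs
`(row, column)`, counted from `0`. Black owns the left and right edges (the first and the last
column), White owns the top and bottom edges (the first and the last row). -/
abbrev Cell (k n : ℕ) : Type := Fin k × Fin n

/-- Adjacency of hexagonal cells: the cell in row `i` and column `j` touches exactly those of the
six cells `(i, j ± 1)`, `(i ± 1, j)`, `(i + 1, j - 1)`, `(i - 1, j + 1)` that lie on the board. -/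
def hexGraph (k n : ℕ) : SimpleGraph (Cell k n) :=
  SimpleGraph.fromRel fun p q =>
    (q.1.val = p.1.val ∧ q.2.val = p.2.val + 1) ∨
    (q.1.val = p.1.val + 1 ∧ q.2.val = p.2.val) ∨
    (q.1.val = p.1.val + 1 ∧ q.2.val + 1 = p.2.val)

/-- A position: each cell is empty (`none`) or carries a stone. -/
abbrev Position (k n : ℕ) : Type := Cell k n → Option Stone

/-- The position in which the cells of `B` carry black stones and all other cells are empty. -/
def blackStones {k n : ℕ} (B : Finset (Cell k n)) : Position k n :=
  fun c => if c ∈ B then some Stone.black else none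

/-- The position after a stone of colour `s` is placed on the cell `c`. -/
def Position.play {k n : ℕ} (P : Position k n) (c : Cell k n) (s : Stone) : Position k n :=
  Function.update P c (some s)

/-- All cells carry a stone. -/
def Position.IsFull {k n : ℕ} (P : Position k n) : Prop :=
  ∀ c, P c ≠ none

/-- An unbroken chain of black stones joins the left edge to the right edge. -/
def Position.BlackConnected {k n : ℕ} (P : Position k n) : Prop :=
  ∃ p q : Cell k n, p.2.val = 0 ∧ q.2.val + 1 = n ∧
    ∃ w : (hexGraph k n).Walk p q, ∀ c ∈ w.support, P c = some Stone.black

/-- `BlackWins t P`: Black can force a win from the position `P` when the player `t` is to move.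
The players alternately place a stone of their colour on an empty cell until the board is full;
then Black has won if and only if Black's edges are connected by a chain of black stones. -/
inductive BlackWins {k n : ℕ} : Stone → Position k n → Prop where
  | full (t : Stone) (P : Position k n) (hfull : P.IsFull) (hconn : P.BlackConnected) :
      BlackWins t P
  | black_to_move (P : Position k n) (c : Cell k n) (hc : P c = none)
      (h : BlackWins Stone.white (P.play c Stone.black)) : BlackWins Stone.black P
  | white_to_move (P : Position k n) (hempty : ¬ P.IsFull)
      (h : ∀ c, P c = none → BlackWins Stone.black (P.play c Stone.white)) :
      BlackWins Stone.white P

/-- The black stones in `B`, on an otherwise empty board, form a virtual connection between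
Black's edges: Black wins even if White moves first. -/
def IsVirtualConnection {k n : ℕ} (B : Finset (Cell k n)) : Prop :=
  BlackWins Stone.white (blackStones B)

end HexBoard

namespace HexBoard

theorem Position.play_self {k n : ℕ} (P : Position k n) (c : Cell k n) (s : Stone) :
    P.play c s c = some s := by
  simp [Position.play]

theorem Position.play_of_ne {k n : ℕ} (P : Position k n) {c d : Cell k n} (s : Stone)
    (h : d ≠ c) : P.play c s d = P d := by
  simp [Position.play, h]

/-- The number of a cell of a board with four rows, column by column. -/
def code {n : ℕ} (c : Cell 4 n) : ℕ := 4 * c.2.val + c.1.val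

theorem code_injective {n : ℕ} : Function.Injective (code (n := n)) := by
  rintro ⟨a, b⟩ ⟨c, d⟩ h
  simp only [code] at h
  ext <;> simp only <;> omega

/-- The cells of the bit set `W`, moved `s` columns to the right, are white, and those of `C`
are not black. -/
def Holds {n : ℕ} (P : Position 4 n) (s W C : ℕ) : Prop :=
  (∀ i, W.testBit i → ∃ c, code c = i + 4 * s ∧ P c = some Stone.white) ∧
  ∀ i, C.testBit i → ∃ c, code c = i + 4 * s ∧ P c ≠ some Stone.black

/-- White wins as the second player as soon as the cells of `W` are white and none of those of
`C` is black, wherever these cells lie on the board. -/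
def Secured (W C : ℕ) : Prop :=
  ∀ (n : ℕ) (P : Position 4 n) (s : ℕ), Holds P s W C → ¬ BlackWins Stone.black P

/-- White wins as the first player as soon as the cells of `W` are white and none of those of
`C` is black, wherever these cells lie on the board. -/
def Attackable (W C : ℕ) : Prop :=
  ∀ (n : ℕ) (P : Position 4 n) (s : ℕ), Holds P s W C → ¬ BlackWins Stone.white P

theorem Holds.play_white {n : ℕ} {P : Position 4 n} {s W C : ℕ} (h : Holds P s W C)
    (c : Cell 4 n) : Holds (P.play c Stone.white) s W C := by
  constructor
  · intro i hi
    obtain ⟨d, hd, hP⟩ := h.1 i hi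
    refine ⟨d, hd, ?_⟩
    by_cases e : d = c
    · subst e; exact P.play_self _ _
    · rw [P.play_of_ne _ e, hP]
  · intro i hi
    obtain ⟨d, hd, hP⟩ := h.2 i hi
    refine ⟨d, hd, ?_⟩
    by_cases e : d = c
    · subst e; rw [P.play_self]; simp
    · rwa [P.play_of_ne _ e]

theorem Secured.attackable {W C : ℕ} (h : Secured W C) : Attackable W C := by
  intro n P s hP hw
  cases hw with
  | full _ _ hfull hconn => exact h n P s hP (.full _ _ hfull hconn)
  | white_to_move _ hempty hm =>
    simp only [Position.IsFull, not_forall, not_not] at hempty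
    obtain ⟨c, hc⟩ := hempty
    exact h n _ s (hP.play_white c) (hm c hc)

/-- White attacks by playing on the cell `m`. -/
theorem Secured.attackable_of_move {W C : ℕ} (h : Secured W C) (m : ℕ) {W' C' : ℕ}
    (hW : ∀ i, W.testBit i → i = m ∨ W'.testBit i) (hm : C'.testBit m)
    (hC : ∀ i, C.testBit i → C'.testBit i) : Attackable W' C' := by
  intro n P s hP hw
  obtain ⟨c, hc, hPc⟩ := hP.2 m hm
  have key : ∀ Q : Position 4 n, Holds Q s W' C' → Q c = some Stone.white → Holds Q s W C := by
    intro Q hQ hQc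
    refine ⟨fun i hi => ?_, fun i hi => hQ.2 i (hC i hi)⟩
    rcases hW i hi with rfl | h'
    · exact ⟨c, hc, hQc⟩
    · exact hQ.1 i h'
  cases hw with
  | full _ _ hfull hconn =>
    refine h n P s (key P hP ?_) (.full _ _ hfull hconn)
    match hx : P c with
    | none => exact absurd hx (hfull c)
    | some Stone.black => exact absurd hx hPc
    | some Stone.white => rfl
  | white_to_move _ hempty hmove =>
    by_cases hc0 : P c = none
    · exact h n _ s (key _ (hP.play_white c) (P.play_self _ _)) (hmove c hc0)
    · have hcw : P c = some Stone.white := by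
        match hx : P c with
        | none => exact absurd hx hc0
        | some Stone.black => exact absurd hx hPc
        | some Stone.white => rfl
      exact h.attackable n P s (key P hP hcw) (.white_to_move _ hempty hmove)

/-- If no cell lies in the carriers of all attacks, White wins as the second player. -/
theorem secured_of_attacks {W C : ℕ}
    (h : ∀ i, ¬ W.testBit i → ∃ W' C', Attackable W' C' ∧ (∀ j, W'.testBit j → W.testBit j) ∧
      (∀ j, C'.testBit j → W.testBit j ∨ C.testBit j) ∧ ¬ C'.testBit i)
    (hne : ∃ i, ¬ W.testBit i) : Secured W C := by
  intro n P s hP hb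
  have sub : ∀ W' C' : ℕ, (∀ j, W'.testBit j → W.testBit j) →
      (∀ j, C'.testBit j → W.testBit j ∨ C.testBit j) → Holds P s W' C' := by
    refine fun W' C' h1 h2 => ⟨fun i hi => hP.1 i (h1 i hi), fun i hi => ?_⟩
    rcases h2 i hi with h' | h'
    · obtain ⟨c, hc, hw⟩ := hP.1 i h'
      exact ⟨c, hc, by simp [hw]⟩
    · exact hP.2 i h'
  cases hb with
  | full _ _ hfull hconn =>
    obtain ⟨i, hi⟩ := hne
    obtain ⟨W', C', hA, h1, h2, -⟩ := h i hi
    exact hA n P s (sub W' C' h1 h2) (.full _ _ hfull hconn)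
  | black_to_move _ c hc hw =>
    have hcode : ∀ i, W.testBit i → code c ≠ i + 4 * s := by
      intro i hi e
      obtain ⟨d, hd, hPd⟩ := hP.1 i hi
      rw [code_injective (e.trans hd.symm), hPd] at hc
      cases hc
    have main : ∀ i, ¬ W.testBit i → (code c = i + 4 * s ∨ ∀ j, code c ≠ j + 4 * s) → False := by
      intro i hi hci
      obtain ⟨W', C', hA, h1, h2, h3⟩ := h i hi
      obtain ⟨hS1, hS2⟩ := sub W' C' h1 h2
      refine hA n _ s ⟨fun j hj => ?_, fun j hj => ?_⟩ hw
      · obtain ⟨d, hd, hPd⟩ := hS1 j hj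
        refine ⟨d, hd, ?_⟩
        rw [P.play_of_ne _ (by rintro rfl; exact hcode j (h1 j hj) hd), hPd]
      · obtain ⟨d, hd, hPd⟩ := hS2 j hj
        refine ⟨d, hd, ?_⟩
        rw [P.play_of_ne]
        · exact hPd
        · rintro rfl
          rcases hci with hci | hci
          · have : i = j := by omega
            exact h3 (this ▸ hj)
          · exact hci j hd
    by_cases hs : 4 * s ≤ code c
    · exact main (code c - 4 * s) (fun hi => hcode _ hi (by omega)) (Or.inl (by omega))
    · obtain ⟨i, hi⟩ := hne
      exact main i hi (Or.inr fun j => by omega)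

theorem Secured.shift {W C : ℕ} (h : Secured W C) (k : ℕ) :
    Secured (W <<< (4 * k)) (C <<< (4 * k)) := by
  intro n P s hP
  refine h n P (s + k) ⟨fun i hi => ?_, fun i hi => ?_⟩
  · obtain ⟨c, hc, h'⟩ := hP.1 (i + 4 * k) (by simpa [Nat.testBit_shiftLeft] using hi)
    exact ⟨c, by omega, h'⟩
  · obtain ⟨c, hc, h'⟩ := hP.2 (i + 4 * k) (by simpa [Nat.testBit_shiftLeft] using hi)
    exact ⟨c, by omega, h'⟩

/-- A barrier: `L` is a set of cells to the left of the white cells `W` such that no step leads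
out of `L`, or into the first column, other than to `L` or to `W`. -/
def isBarrier (W L : ℕ) : Bool :=
  (List.range 4).all (fun i => (L ||| W).testBit i) && Nat.blt L (2 ^ (4 * (W.log2 / 4))) &&
  (List.range 40).all fun i => !L.testBit i ||
    ((L ||| W).testBit (i + 4) &&
      (i < 4 || (L ||| W).testBit (i - 4)) &&
      (i % 4 == 0 || (L ||| W).testBit (i - 1) && (L ||| W).testBit (i + 3)) &&
      (i % 4 == 3 || (L ||| W).testBit (i + 1) && (i < 4 || (L ||| W).testBit (i - 3))))

theorem hexGraph_adj_code {n : ℕ} {c d : Cell 4 n} (h : (hexGraph 4 n).Adj c d) :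
    code d = code c + 4 ∨ code c = code d + 4 ∨
    (code c % 4 ≠ 3 ∧ (code d = code c + 1 ∨ code d + 3 = code c)) ∨
    (code c % 4 ≠ 0 ∧ (code d + 1 = code c ∨ code d = code c + 3)) := by
  obtain ⟨⟨a, ha⟩, ⟨b, hb⟩⟩ := c
  obtain ⟨⟨a', ha'⟩, ⟨b', hb'⟩⟩ := d
  simp only [hexGraph, SimpleGraph.fromRel_adj] at h
  simp only [code]
  omega

theorem isBarrier_step {W L : ℕ} (h : isBarrier W L = true) {i : ℕ} (hi : i < 40)
    (hL : L.testBit i = true) :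
    (L ||| W).testBit (i + 4) = true ∧ (4 ≤ i → (L ||| W).testBit (i - 4) = true) ∧
    (i % 4 ≠ 0 → (L ||| W).testBit (i - 1) = true ∧ (L ||| W).testBit (i + 3) = true) ∧
    (i % 4 ≠ 3 → (L ||| W).testBit (i + 1) = true ∧
      (4 ≤ i → (L ||| W).testBit (i - 3) = true)) := by
  simp only [isBarrier, Bool.and_eq_true, List.all_eq_true] at h
  have := h.2 i (List.mem_range.2 hi)
  simp only [hL, Bool.not_true, Bool.false_or, Bool.and_eq_true, Bool.or_eq_true, beq_iff_eq,
    decide_eq_true_eq] at this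
  obtain ⟨⟨⟨h1, h2⟩, h3⟩, h4⟩ := this
  refine ⟨h1, fun h' => h2.resolve_left (by omega), fun h' => h3.resolve_left h', fun h' => ?_⟩
  have := h4.resolve_left h'
  exact ⟨this.1, fun h'' => this.2.resolve_left (by omega)⟩

theorem secured_of_isBarrier {W L : ℕ} (h : isBarrier W L = true) (hlt : L < 2 ^ 40) :
    Secured W 0 := by
  have hstep := @isBarrier_step W L h
  simp only [isBarrier, Bool.and_eq_true, List.all_eq_true, List.mem_range,
    Nat.blt_eq] at h
  obtain ⟨⟨hcol, hlog⟩, -⟩ := h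
  have hL40 : ∀ i, L.testBit i = true → i < 40 := by
    intro i hi
    by_contra hc
    rw [Nat.testBit_lt_two_pow (hlt.trans_le (Nat.pow_le_pow_right (by norm_num) (by omega)))] at hi
    cases hi
  have hLlog : ∀ i, L.testBit i = true → i < 4 * (W.log2 / 4) := by
    intro i hi
    by_contra hc
    rw [Nat.testBit_lt_two_pow (hlog.trans_le
      (Nat.pow_le_pow_right (by norm_num) (by omega)))] at hi
    cases hi
  intro n P s hP hb
  generalize Stone.black = t at hb
  have key : ∀ Q : Position 4 n, Holds Q s W 0 → ¬ Q.BlackConnected := by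
    rintro Q hQ ⟨p, q, hp, hq, w, hw⟩
    have hor : ∀ i (d : Cell 4 n), (L ||| W).testBit i = true → code d = i + 4 * s →
        Q d = some Stone.black → L.testBit i = true := by
      intro i d hi hd hQd
      rw [Nat.testBit_or, Bool.or_eq_true] at hi
      refine hi.resolve_right fun hWi => ?_
      obtain ⟨e, he, hQe⟩ := hQ.1 i hWi
      rw [code_injective (he.trans hd.symm), hQd] at hQe
      cases hQe
    let Left : Cell 4 n → Prop := fun c =>
      code c < 4 * s ∨ ∃ i, L.testBit i = true ∧ code c = i + 4 * s
    have first : ∀ c : Cell 4 n, Q c = some Stone.black → code c < 4 * s + 4 → Left c := by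
      intro c hc hlt
      by_cases h' : code c < 4 * s
      · exact Or.inl h'
      · exact Or.inr ⟨code c - 4 * s, hor _ c (hcol _ (by omega)) (by omega) hc, by omega⟩
    have step : ∀ c d : Cell 4 n, (hexGraph 4 n).Adj c d → Q d = some Stone.black →
        Left c → Left d := by
      intro c d hcd hd hc
      by_cases h' : code d < 4 * s + 4
      · exact first d hd h'
      have hadj := hexGraph_adj_code hcd
      rcases hc with hc | ⟨i, hi, hci⟩
      · exact absurd hadj (by omega)
      · obtain ⟨h1, h2, h3, h4⟩ := hstep (hL40 i hi) hi
        refine Or.inr ⟨code d - 4 * s, hor _ d ?_ (by omega) hd, by omega⟩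
        rcases hadj with e | e | ⟨e0, e | e⟩ | ⟨e0, e | e⟩
        · rw [show code d - 4 * s = i + 4 by omega]; exact h1
        · rw [show code d - 4 * s = i - 4 by omega]; exact h2 (by omega)
        · rw [show code d - 4 * s = i + 1 by omega]; exact (h4 (by omega)).1
        · rw [show code d - 4 * s = i - 3 by omega]; exact (h4 (by omega)).2 (by omega)
        · rw [show code d - 4 * s = i - 1 by omega]; exact (h3 (by omega)).1
        · rw [show code d - 4 * s = i + 3 by omega]; exact (h3 (by omega)).2
    have walk : ∀ {p q : Cell 4 n} (w : (hexGraph 4 n).Walk p q),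
        (∀ c ∈ w.support, Q c = some Stone.black) → Left p → Left q := by
      intro p q w
      induction w with
      | nil => exact fun _ h => h
      | cons hadj w ih =>
        intro hw hp
        exact ih (fun c hc => hw c (by simp [hc]))
          (step _ _ hadj (hw _ (by simp)) hp)
    have hpl : Left p := first p (hw p (by simp)) (by simp only [code]; omega)
    have hW0 : W ≠ 0 := by
      rintro rfl
      have hL0 : L = 0 := by simpa using hlog
      have := hcol 0 (by norm_num)
      simp [hL0] at this
    obtain ⟨e, he, -⟩ := hQ.1 W.log2 (Nat.testBit_log2 hW0)
    have he2 := e.2.isLt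
    simp only [code] at he
    have hql := walk w hw hpl
    rcases hql with h' | ⟨i, hi, h'⟩
    · simp only [code] at h'
      omega
    · have := hLlog i hi
      simp only [code] at h'
      omega
  induction hb with
  | full t Q hfull hconn => exact key Q hP hconn
  | black_to_move Q c hc _ ih =>
    refine ih ⟨fun i hi => ?_, fun i hi => by simp at hi⟩
    obtain ⟨d, hd, hQd⟩ := hP.1 i hi
    refine ⟨d, hd, ?_⟩
    rw [Q.play_of_ne _ (by rintro rfl; rw [hc] at hQd; cases hQd), hQd]
  | white_to_move Q hempty _ ih =>
    simp only [Position.IsFull, not_forall, not_not] at hempty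
    obtain ⟨c, hc⟩ := hempty
    exact ih c hc (hP.play_white c)

/-- `f x`, with `x` evaluated first. -/
def force {α : Type} (x : ℕ) (f : ℕ → α) : α :=
  Nat.rec (f 0) (fun n _ => f (n + 1)) x

@[simp] theorem force_eq {α : Type} (x : ℕ) (f : ℕ → α) : force x f = f x := by
  cases x <;> rfl

/-- A table of pairs `(W, C)` of bit sets is kept as a number with digits `W + 2 ^ 40 * C` in base
`2 ^ 80`; this is the digit number `d`. -/
def entry (T d : ℕ) : ℕ := T / 2 ^ (80 * d) % 2 ^ 80

/-- All nonzero entries of the table are secured. -/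
def TableValid (T : ℕ) : Prop :=
  ∀ d, entry T d ≠ 0 → Secured (entry T d % 2 ^ 40) (entry T d / 2 ^ 40)

theorem tableValid_zero : TableValid 0 := by
  intro d hd
  simp [entry] at hd

theorem entry_push_succ {T x d : ℕ} (hx : x < 2 ^ 80) :
    entry (T * 2 ^ 80 + x) (d + 1) = entry T d := by
  have h : (T * 2 ^ 80 + x) / 2 ^ 80 = T := by omega
  unfold entry
  rw [Nat.mul_succ, Nat.add_comm (80 * d), Nat.pow_add, ← Nat.div_div_eq_div_mul, h]

theorem TableValid.push {T x : ℕ} (hT : TableValid T) (hx : x < 2 ^ 80)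
    (h : x ≠ 0 → Secured (x % 2 ^ 40) (x / 2 ^ 40)) : TableValid (T * 2 ^ 80 + x) := by
  intro d
  rcases d with _ | d
  · have : entry (T * 2 ^ 80 + x) 0 = x := by
      simp only [entry, Nat.mul_zero, pow_zero, Nat.div_one]
      omega
    rw [this]
    exact h
  · rw [entry_push_succ hx]
    exact hT d

/-- An attack `r` uses the entry number `r / 1024 - 1`, moved `r / 64 % 16` columns to the right,
after the move `r % 64` (no move, if this is 63). These are the cells that have to be white. -/
def attackWhite (x r : ℕ) : ℕ :=
  force ((x % 2 ^ 40) <<< (4 * (r / 64 % 16))) fun W =>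
    bif Nat.beq (r % 64) 63 then W else W ^^^ (W &&& 2 ^ (r % 64))

/-- The carrier of an attack. -/
def attackCarrier (x r : ℕ) : ℕ :=
  force ((x / 2 ^ 40) <<< (4 * (r / 64 % 16))) fun C =>
    bif Nat.beq (r % 64) 63 then C else C ||| 2 ^ (r % 64)

theorem attackable_attack {x : ℕ} (h : Secured (x % 2 ^ 40) (x / 2 ^ 40)) (r : ℕ) :
    Attackable (attackWhite x r) (attackCarrier x r) := by
  have hs := h.shift (r / 64 % 16)
  simp only [attackWhite, attackCarrier, force_eq]
  cases hm : Nat.beq (r % 64) 63 with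
  | true => exact hs.attackable
  | false =>
    refine hs.attackable_of_move (r % 64) (fun i hi => ?_) ?_ (fun i hi => ?_)
    · by_cases e : i = r % 64
      · exact Or.inl e
      · right
        simp only [cond_false, Nat.testBit_xor, Nat.testBit_and, hi, Nat.testBit_two_pow,
          Ne.symm e]
        simp
    · simp
    · simp only [cond_false, Nat.testBit_or, hi, Bool.true_or]

/-- The entry that follows from the attacks coded by `c` in base `2 ^ 24`; `K` is the intersection
and `U` the union of the carriers found before, and `W` the union of the white sets. The value is
0 if some cell lies in all carriers. -/
def combine (T : ℕ) : ℕ → ℕ → ℕ → ℕ → ℕ → ℕ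
  | 0, _, _, _, _ => 0
  | fuel + 1, c, K, W, U =>
    bif Nat.beq c 0 then
      bif Nat.beq (K &&& W) K && Nat.blt U (2 ^ 40) && Nat.blt W (2 ^ 40) then
        W + 2 ^ 40 * (U ^^^ (U &&& W))
      else 0
    else
      force (entry T (c % 2 ^ 24 / 1024 - 1)) fun x =>
        bif Nat.beq x 0 then 0
        else
          force (attackWhite x (c % 2 ^ 24)) fun W' =>
            force (attackCarrier x (c % 2 ^ 24)) fun C' =>
              force (c / 2 ^ 24) fun c' =>
                force (K &&& C') fun K' =>
                  force (W ||| W') fun W'' =>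
                    force (U ||| C') fun U' => combine T fuel c' K' W'' U'

theorem combine_spec {T : ℕ} (hT : TableValid T) (fuel c K W U : ℕ)
    (h : ∀ i < 64, ¬ K.testBit i → ∃ W' C', Attackable W' C' ∧
      (∀ j, W'.testBit j → W.testBit j) ∧ (∀ j, C'.testBit j → U.testBit j) ∧ ¬ C'.testBit i) :
    combine T fuel c K W U < 2 ^ 80 ∧ (combine T fuel c K W U ≠ 0 →
      Secured (combine T fuel c K W U % 2 ^ 40) (combine T fuel c K W U / 2 ^ 40)) := by
  induction fuel generalizing c K W U with
  | zero => simp [combine]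
  | succ fuel ih =>
    rw [combine]
    cases hc : Nat.beq c 0 with
    | true =>
      cases hK : (Nat.beq (K &&& W) K && Nat.blt U (2 ^ 40) && Nat.blt W (2 ^ 40)) with
      | false => simp
      | true =>
        simp only [Bool.and_eq_true, Nat.blt_eq] at hK
        obtain ⟨⟨hKW, hU⟩, hW⟩ := hK
        simp only [cond_true]
        set C := U ^^^ (U &&& W) with hC
        have hClt : C < 2 ^ 40 := Nat.xor_lt_two_pow hU (Nat.and_lt_two_pow _ hW)
        have e1 : (W + 2 ^ 40 * C) % 2 ^ 40 = W := by omega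
        have e2 : (W + 2 ^ 40 * C) / 2 ^ 40 = C := by omega
        rw [e1, e2]
        refine ⟨by omega, fun _ => ?_⟩
        have big : ∀ V : ℕ, V < 2 ^ 40 → ∀ i, 40 ≤ i → V.testBit i = false := fun V hV i hi =>
          Nat.testBit_lt_two_pow (hV.trans_le (Nat.pow_le_pow_right (by norm_num) hi))
        have notK : ∀ i, ¬ W.testBit i → ¬ K.testBit i := by
          intro i hi hk
          rw [← Nat.eq_of_beq_eq_true hKW, Nat.testBit_and, Bool.and_eq_true] at hk
          exact hi hk.2
        have CU : ∀ j, U.testBit j → W.testBit j ∨ C.testBit j := by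
          intro j hj
          by_cases hw : W.testBit j <;> simp [hC, hj, hw]
        refine secured_of_attacks (fun i hi => ?_) ⟨40, by simp [big W hW 40 le_rfl]⟩
        by_cases hi64 : i < 64
        · obtain ⟨W', C', h1, h2, h3, h4⟩ := h i hi64 (notK i hi)
          exact ⟨W', C', h1, h2, fun j hj => CU j (h3 j hj), h4⟩
        · obtain ⟨W', C', h1, h2, h3, h4⟩ := h 40 (by norm_num)
            (notK 40 (by simp [big W hW 40 le_rfl]))
          refine ⟨W', C', h1, h2, fun j hj => CU j (h3 j hj), fun hj => ?_⟩
          have := h3 i hj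
          rw [big U hU i (by omega)] at this
          cases this
    | false =>
      simp only [cond_false, force_eq]
      set x := entry T (c % 2 ^ 24 / 1024 - 1) with hx
      cases hx0 : Nat.beq x 0 with
      | true => simp
      | false =>
        simp only [cond_false]
        have hne : x ≠ 0 := by
          intro e
          rw [e] at hx0
          cases hx0
        have hA := attackable_attack (hT _ hne) (c % 2 ^ 24)
        rw [← hx] at hA
        refine ih _ _ _ _ fun i hi hk => ?_
        rw [Nat.testBit_and, Bool.and_eq_true, not_and_or] at hk
        by_cases hCi : (attackCarrier x (c % 2 ^ 24)).testBit i
        · obtain ⟨W', C', h1, h2, h3, h4⟩ := h i hi (hk.resolve_right (not_not.2 hCi))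
          exact ⟨W', C', h1, fun j hj => by simp [h2 j hj], fun j hj => by simp [h3 j hj], h4⟩
        · exact ⟨_, _, hA, fun j hj => by rw [Nat.testBit_or, hj, Bool.or_true],
            fun j hj => by rw [Nat.testBit_or, hj, Bool.or_true], hCi⟩

/-- The table of the barriers `(W, L)` coded as `W + 2 ^ 40 * L`. -/
def barrierTable : List ℕ → ℕ → ℕ
  | [], T => T
  | b :: l, T =>
    force (T * 2 ^ 80 + bif isBarrier (b % 2 ^ 40) (b / 2 ^ 40 % 2 ^ 40) then b % 2 ^ 40 else 0)
      fun T' => barrierTable l T'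

theorem TableValid.barrierTable (l : List ℕ) {T : ℕ} (hT : TableValid T) :
    TableValid (barrierTable l T) := by
  induction l generalizing T with
  | nil => exact hT
  | cons b l ih =>
    simp only [HexBoard.barrierTable, force_eq]
    apply ih
    cases hb : isBarrier (b % 2 ^ 40) (b / 2 ^ 40 % 2 ^ 40) with
    | false => exact hT.push (by norm_num) (by simp)
    | true =>
      refine hT.push (by simp only [cond_true]; omega) fun _ => ?_
      simp only [cond_true]
      rw [show b % 2 ^ 40 % 2 ^ 40 = b % 2 ^ 40 by omega,
        show b % 2 ^ 40 / 2 ^ 40 = 0 by omega]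
      exact secured_of_isBarrier hb (by omega)

/-- The table `T` extended by the entries that follow from the coded lists of attacks. -/
def extendTable : List ℕ → ℕ → ℕ
  | [], T => T
  | c :: l, T =>
    force (T * 2 ^ 80 + combine T 32 c (2 ^ 64 - 1) 0 0) fun T' => extendTable l T'

theorem TableValid.extendTable (l : List ℕ) {T : ℕ} (hT : TableValid T) :
    TableValid (extendTable l T) := by
  induction l generalizing T with
  | nil => exact hT
  | cons c l ih =>
    simp only [HexBoard.extendTable, force_eq]
    apply ih
    have := combine_spec hT 32 c (2 ^ 64 - 1) 0 0 (by
      intro i hi hk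
      rw [Nat.testBit_two_pow_sub_one] at hk
      simp [hi] at hk)
    exact hT.push this.1 this.2

/-- The half turn of the board. -/
def halfTurn {k n : ℕ} (c : Cell k n) : Cell k n := (c.1.rev, c.2.rev)

@[simp] theorem halfTurn_halfTurn {k n : ℕ} (c : Cell k n) : halfTurn (halfTurn c) = c := by
  simp [halfTurn]

theorem code_halfTurn {n : ℕ} (c : Cell 4 n) : code (halfTurn c) + code c + 1 = 4 * n := by
  have h1 := c.1.isLt
  have h2 := c.2.isLt
  simp only [code, halfTurn, Fin.val_rev]
  omega

/-- The half turn as a homomorphism of the hexagonal graph. -/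
def halfTurnHom (k n : ℕ) : hexGraph k n →g hexGraph k n where
  toFun := halfTurn
  map_rel' := by
    rintro ⟨⟨a, ha⟩, ⟨b, hb⟩⟩ ⟨⟨c, hc⟩, ⟨d, hd⟩⟩ h
    simp only [hexGraph, SimpleGraph.fromRel_adj, halfTurn, Fin.val_rev, ne_eq, Prod.mk.injEq,
      Fin.ext_iff] at h ⊢
    omega

theorem Position.BlackConnected.halfTurn {k n : ℕ} {P : Position k n} (h : P.BlackConnected) :
    Position.BlackConnected (fun c => P (halfTurn c)) := by
  obtain ⟨p, q, hp, hq, w, hw⟩ := h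
  refine ⟨halfTurnHom k n q, halfTurnHom k n p, ?_, ?_, (w.map (halfTurnHom k n)).reverse, ?_⟩
  · simp only [halfTurnHom, RelHom.coeFn_mk, HexBoard.halfTurn, Fin.val_rev]; omega
  · have := p.2.isLt
    simp only [halfTurnHom, RelHom.coeFn_mk, HexBoard.halfTurn, Fin.val_rev]; omega
  · intro c hc
    rw [SimpleGraph.Walk.support_reverse, List.mem_reverse, SimpleGraph.Walk.support_map,
      List.mem_map] at hc
    obtain ⟨d, hd, rfl⟩ := hc
    simpa [halfTurnHom] using hw d hd

theorem play_halfTurn {k n : ℕ} (P : Position k n) (c : Cell k n) (s : Stone) :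
    (fun d => P.play c s (halfTurn d)) =
      Position.play (fun d => P (halfTurn d)) (halfTurn c) s := by
  funext d
  by_cases h : halfTurn d = c
  · subst h
    rw [Position.play_self, halfTurn_halfTurn, Position.play_self]
  · rw [Position.play_of_ne _ _ h, Position.play_of_ne]
    rintro rfl
    simp at h

theorem BlackWins.halfTurn {k n : ℕ} {t : Stone} {P : Position k n} (h : BlackWins t P) :
    BlackWins t (fun c => P (halfTurn c)) := by
  induction h with
  | full t P hfull hconn => exact .full _ _ (fun c => hfull _) hconn.halfTurn
  | black_to_move P c hc _ ih =>
    rw [play_halfTurn] at ih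
    exact .black_to_move _ (HexBoard.halfTurn c) (by simpa using hc) ih
  | white_to_move P hempty _ ih =>
    refine .white_to_move _ (fun hf => hempty fun c => ?_) fun c hc => ?_
    · simpa using hf (HexBoard.halfTurn c)
    · have := ih (HexBoard.halfTurn c) hc
      rwa [play_halfTurn, halfTurn_halfTurn] at this

theorem IsVirtualConnection.halfTurn {k n : ℕ} {B : Finset (Cell k n)}
    (h : IsVirtualConnection B) : IsVirtualConnection (B.image halfTurn) := by
  have := BlackWins.halfTurn h
  have e : (fun c => blackStones B (HexBoard.halfTurn c)) =
      blackStones (B.image HexBoard.halfTurn) := by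
    funext c
    have : c ∈ B.image HexBoard.halfTurn ↔ HexBoard.halfTurn c ∈ B := by
      rw [Finset.mem_image]
      exact ⟨by rintro ⟨d, hd, rfl⟩; simpa using hd, fun h => ⟨_, h, by simp⟩⟩
    simp only [blackStones, this]
  rwa [e] at this

/-- White wins as the first player against any stones of Black that avoid some translate of the
set `M`. -/
def Template (M : ℕ) : Prop :=
  ∀ (n : ℕ) (B : Finset (Cell 4 n)) (s : ℕ),
    (∀ i, M.testBit i → ∃ c, code c = i + 4 * s ∧ c ∉ B) → ¬ IsVirtualConnection B

theorem Attackable.template {M C : ℕ} (h : Attackable 0 C)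
    (hC : ∀ i, C.testBit i → M.testBit i) : Template M := by
  intro n B s hM
  refine h n (blackStones B) s ⟨by simp, fun i hi => ?_⟩
  obtain ⟨c, hc, hcB⟩ := hM i (hC i hi)
  exact ⟨c, hc, by simp [blackStones, hcB]⟩

/-- The number with the binary digits `f (k - 1)`, …, `f 0`, after those of `acc`. -/
def bitsBelow (f : ℕ → Bool) : ℕ → ℕ → ℕ
  | 0, acc => acc
  | k + 1, acc => force (2 * acc + bif f k then 1 else 0) fun acc' => bitsBelow f k acc'

theorem testBit_bitsBelow (f : ℕ → Bool) (k acc i : ℕ) :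
    (bitsBelow f k acc).testBit i = if i < k then f i else acc.testBit (i - k) := by
  induction k generalizing acc with
  | zero => simp [bitsBelow]
  | succ k ih =>
    simp only [bitsBelow, force_eq]
    rw [ih]
    split_ifs with h1 h2 h2
    · rfl
    · omega
    · have : i = k := by omega
      subst this
      cases f i <;> simp
    · obtain ⟨j, rfl⟩ : ∃ j, i = k + 1 + j := ⟨i - (k + 1), by omega⟩
      rw [show k + 1 + j - k = j + 1 by omega, show k + 1 + j - (k + 1) = j by omega,
        Nat.testBit_succ]
      congr 1
      cases f k <;> simp; omega

/-- The half turn of a set of cells. -/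
def revMask (M : ℕ) : ℕ :=
  bitsBelow (fun i => M.testBit (4 * (M.log2 / 4) + 3 - i)) (4 * (M.log2 / 4) + 4) 0

theorem Template.revMask {M : ℕ} (h : Template M) (h0 : M % 16 ≠ 0) :
    Template (revMask M) := by
  intro n B s hM hB
  set w := M.log2 / 4 with hw
  have hrev : ∀ j, M.testBit j → ∃ c : Cell 4 n, code c = 4 * w + 3 - j + 4 * s ∧ c ∉ B ∧
      j ≤ 4 * w + 3 := by
    intro j hj
    have hjw : j ≤ 4 * w + 3 := by
      by_contra hc
      rw [Nat.testBit_lt_two_pow (Nat.lt_log2_self.trans_le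
        (Nat.pow_le_pow_right (by norm_num) (by omega)))] at hj
      cases hj
    obtain ⟨c, hc, hcB⟩ := hM (4 * w + 3 - j) (by
      rw [HexBoard.revMask, testBit_bitsBelow, if_pos (by omega),
        show 4 * (M.log2 / 4) + 3 - (4 * w + 3 - j) = j by omega]
      exact hj)
    exact ⟨c, hc, hcB, hjw⟩
  have hfit : w + 1 + s ≤ n := by
    obtain ⟨j, hj⟩ := Nat.exists_testBit_of_ne_zero h0
    have hj4 : j < 4 := by
      by_contra hc
      rw [Nat.testBit_lt_two_pow ((Nat.mod_lt M (by norm_num)).trans_le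
        (Nat.pow_le_pow_right (by norm_num : 0 < 2) (by omega : 4 ≤ j)))] at hj
      cases hj
    obtain ⟨c, hc, -, hjw⟩ := hrev j (by
      rw [show (16 : ℕ) = 2 ^ 4 by norm_num, Nat.testBit_mod_two_pow] at hj
      simp at hj
      exact hj.2)
    have := code_halfTurn c
    omega
  refine h n (B.image halfTurn) (n - (w + 1 + s)) (fun j hj => ?_) hB.halfTurn
  obtain ⟨c, hc, hcB, hjw⟩ := hrev j hj
  refine ⟨halfTurn c, by have := code_halfTurn c; omega, ?_⟩
  rw [Finset.mem_image]
  rintro ⟨d, hd, hdc⟩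
  apply hcB
  have := congrArg halfTurn hdc
  simp only [halfTurn_halfTurn] at this
  rwa [← this]

/-- `M` contains the carrier of the attack `r` on the empty board. -/
def isAttack (T M r : ℕ) : Bool :=
  force (entry T (r / 1024 - 1)) fun x =>
    !Nat.beq x 0 && Nat.beq (attackWhite x r) 0 &&
      Nat.beq (attackCarrier x r &&& M) (attackCarrier x r)

theorem template_of_isAttack {T M r : ℕ} (hT : TableValid T) (h : isAttack T M r = true) :
    Template M := by
  simp only [isAttack, force_eq, Bool.and_eq_true, Bool.not_eq_true'] at h
  obtain ⟨⟨h1, h2⟩, h3⟩ := h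
  have hx : entry T (r / 1024 - 1) ≠ 0 := by
    intro e
    rw [e] at h1
    cases h1
  have hA := attackable_attack (hT _ hx) r
  rw [Nat.eq_of_beq_eq_true h2] at hA
  refine hA.template fun i hi => ?_
  rw [← Nat.eq_of_beq_eq_true h3, Nat.testBit_and, Bool.and_eq_true] at hi
  exact hi.2

/-- The digit number `t` of `M` in base `2 ^ 40`. -/
def digit (M t : ℕ) : ℕ := M / 2 ^ (40 * t) % 2 ^ 40

/-- The number with the digits `l` in base `2 ^ 40`, the first one lowest. -/
def pack (l : List ℕ) : ℕ := l.foldr (fun M T => T * 2 ^ 40 + M) 0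

theorem digit_pack {l : List ℕ} (hl : ∀ M ∈ l, M < 2 ^ 40) {t : ℕ} (ht : t < l.length) :
    digit (pack l) t ∈ l := by
  induction l generalizing t with
  | nil => simp at ht
  | cons M l ih =>
    have hM : M < 2 ^ 40 := hl M (by simp)
    have e : pack (M :: l) = pack l * 2 ^ 40 + M := rfl
    rw [e]
    rcases t with _ | t
    · have : digit (pack l * 2 ^ 40 + M) 0 = M := by
        simp only [digit, Nat.mul_zero, pow_zero, Nat.div_one]
        omega
      rw [this]
      simp
    · have h : (pack l * 2 ^ 40 + M) / 2 ^ 40 = pack l := by omega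
      have : digit (pack l * 2 ^ 40 + M) (t + 1) = digit (pack l) t := by
        unfold digit
        rw [Nat.mul_succ, Nat.add_comm (40 * t), Nat.pow_add, ← Nat.div_div_eq_div_mul, h]
      rw [this]
      exact List.mem_cons_of_mem _ (ih (fun M hM => hl M (by simp [hM])) (by simpa using ht))

/-- Pending templates are recorded as a bit set: the bit `D * a + t` says that the first `a + 1`
columns of the template number `t`, placed such that column `a` of the template is the last column
seen, are free of stones. `rowMask M D r` consists of the bits for which the cell in row `r` of
column `a` does not belong to the template. -/
def rowMask (M D r : ℕ) : ℕ :=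
  bitsBelow (fun b => !(M / 2 ^ (40 * (b % D))).testBit (4 * (b / D) + r)) (10 * D) 0

/-- The bits of the templates that end with the last column seen. -/
def lastMask (M D : ℕ) : ℕ :=
  bitsBelow (fun b => Nat.blt (digit M (b % D)) (2 ^ (4 * (b / D) + 4))) (10 * D) 0

/-- The pending templates after a column whose stones are given by `b₀`, …, `b₃`. -/
def nextPending (D K₀ K₁ K₂ K₃ p : ℕ) (b₀ b₁ b₂ b₃ : Bool) : ℕ :=
  force (p <<< D ||| (2 ^ D - 1)) fun p =>
    force (bif b₀ then p &&& K₀ else p) fun p =>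
      force (bif b₁ then p &&& K₁ else p) fun p =>
        force (bif b₂ then p &&& K₂ else p) fun p => bif b₃ then p &&& K₃ else p

/-- `B` has a stone on the cell with number `i`. -/
def HasStone {n : ℕ} (B : Finset (Cell 4 n)) (i : ℕ) : Prop := ∃ c ∈ B, code c = i

/-- All bits of `p` record pending templates after `l` columns. -/
def Pending {n : ℕ} (B : Finset (Cell 4 n)) (M D l p : ℕ) : Prop :=
  ∀ b, p.testBit b → ∃ s, s + b / D + 1 = l ∧
    ∀ i < 4 * (b / D) + 4, (digit M (b % D)).testBit i → ¬ HasStone B (i + 4 * s)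

theorem testBit_digit {M t i : ℕ} :
    (digit M t).testBit i = (decide (i < 40) && (M / 2 ^ (40 * t)).testBit i) := by
  rw [digit, Nat.testBit_mod_two_pow]

theorem testBit_nextPending {D K₀ K₁ K₂ K₃ p : ℕ} {b₀ b₁ b₂ b₃ : Bool} {b : ℕ}
    (h : (nextPending D K₀ K₁ K₂ K₃ p b₀ b₁ b₂ b₃).testBit b) :
    (b < D ∨ D ≤ b ∧ p.testBit (b - D)) ∧ (b₀ → K₀.testBit b) ∧ (b₁ → K₁.testBit b) ∧
      (b₂ → K₂.testBit b) ∧ (b₃ → K₃.testBit b) := by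
  simp only [nextPending, force_eq] at h
  cases b₀ <;> cases b₁ <;> cases b₂ <;> cases b₃ <;>
    simp [Nat.testBit_or, Nat.testBit_shiftLeft, Nat.testBit_two_pow_sub_one] at h ⊢ <;> tauto

theorem testBit_rowMask {M D r b : ℕ} (h : (rowMask M D r).testBit b) :
    ¬ (digit M (b % D)).testBit (4 * (b / D) + r) := by
  rw [rowMask, testBit_bitsBelow] at h
  split_ifs at h with hb
  · rw [testBit_digit]
    simp only [Bool.not_eq_true'] at h
    simp [h]
  · simp at h

theorem Pending.next {n : ℕ} {B : Finset (Cell 4 n)} {M D l p : ℕ} (hp : Pending B M D l p)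
    (hD : 0 < D) {b₀ b₁ b₂ b₃ : Bool} (h₀ : b₀ = true ↔ HasStone B (4 * l))
    (h₁ : b₁ = true ↔ HasStone B (4 * l + 1)) (h₂ : b₂ = true ↔ HasStone B (4 * l + 2))
    (h₃ : b₃ = true ↔ HasStone B (4 * l + 3)) :
    Pending B M D (l + 1) (nextPending D (rowMask M D 0) (rowMask M D 1) (rowMask M D 2)
      (rowMask M D 3) p b₀ b₁ b₂ b₃) := by
  intro b hb
  obtain ⟨hprev, k₀, k₁, k₂, k₃⟩ := testBit_nextPending hb
  have last : ∀ r < 4, (digit M (b % D)).testBit (4 * (b / D) + r) →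
      ¬ HasStone B (4 * l + r) := by
    intro r hr hbit hs
    have : r = 0 ∨ r = 1 ∨ r = 2 ∨ r = 3 := by omega
    rcases this with rfl | rfl | rfl | rfl
    · exact testBit_rowMask (k₀ (h₀.2 hs)) hbit
    · exact testBit_rowMask (k₁ (h₁.2 hs)) hbit
    · exact testBit_rowMask (k₂ (h₂.2 hs)) hbit
    · exact testBit_rowMask (k₃ (h₃.2 hs)) hbit
  have lastcol : ∀ s, s + b / D = l → ∀ i, 4 * (b / D) ≤ i → i < 4 * (b / D) + 4 →
      (digit M (b % D)).testBit i → ¬ HasStone B (i + 4 * s) := by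
    intro s hs i h1 h2 hbit
    have := last (i - 4 * (b / D)) (by omega)
      (by rwa [show 4 * (b / D) + (i - 4 * (b / D)) = i by omega])
    rwa [show i + 4 * s = 4 * l + (i - 4 * (b / D)) by omega]
  rcases hprev with hlt | ⟨hle, hbit⟩
  · have e : b / D = 0 := Nat.div_eq_of_lt hlt
    refine ⟨l, by omega, fun i hi => lastcol l (by omega) i (by omega) hi⟩
  · obtain ⟨s, hs, hfree⟩ := hp _ hbit
    have e1 : (b - D) % D = b % D := (Nat.mod_eq_sub_mod hle).symm
    have e2 : b / D = (b - D) / D + 1 := by rw [Nat.div_eq_sub_div hD hle]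
    refine ⟨s, by omega, fun i hi hM => ?_⟩
    by_cases h : i < 4 * (b / D)
    · exact hfree i (by omega) (by rwa [e1])
    · exact lastcol s (by omega) i (by omega) hi hM

theorem Pending.mono {n : ℕ} {B : Finset (Cell 4 n)} {M D l p q : ℕ} (hp : Pending B M D l p)
    (hq : q &&& p = q) : Pending B M D l q := by
  intro b hb
  rw [← hq, Nat.testBit_and, Bool.and_eq_true] at hb
  exact hp b hb.2

theorem Pending.not_isVirtualConnection {n : ℕ} {B : Finset (Cell 4 n)} {M D l p : ℕ}
    (hp : Pending B M D l p) (hl : l ≤ n) (h : p &&& lastMask M D ≠ 0)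
    (hM : ∀ t < D, Template (digit M t)) (hD : 0 < D) : ¬ IsVirtualConnection B := by
  obtain ⟨b, hb⟩ := Nat.exists_testBit_of_ne_zero h
  rw [Nat.testBit_and, Bool.and_eq_true] at hb
  obtain ⟨s, hs, hfree⟩ := hp b hb.1
  have hlast := hb.2
  rw [lastMask, testBit_bitsBelow] at hlast
  split_ifs at hlast with h10
  · rw [Nat.blt_eq] at hlast
    refine hM _ (Nat.mod_lt b hD) n B s fun i hi => ?_
    have hi4 : i < 4 * (b / D) + 4 := by
      by_contra hc
      rw [Nat.testBit_lt_two_pow (hlast.trans_le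
        (Nat.pow_le_pow_right (by norm_num) (by omega)))] at hi
      cases hi
    let c : Cell 4 n := (⟨i % 4, by omega⟩, ⟨s + i / 4, by omega⟩)
    have hc : code c = i + 4 * s := by simp only [code, c]; omega
    exact ⟨c, hc, fun hcB => hfree i hi4 hi ⟨c, hcB, hc⟩⟩
  · simp at hlast

/-- The number of stones in the first `l` columns. -/
def stones {n : ℕ} (B : Finset (Cell 4 n)) (l : ℕ) : ℕ := (B.filter fun c => c.2.val < l).card

theorem stones_succ {n : ℕ} (B : Finset (Cell 4 n)) (l : ℕ) {b₀ b₁ b₂ b₃ : Bool}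
    (h₀ : b₀ = true ↔ HasStone B (4 * l))
    (h₁ : b₁ = true ↔ HasStone B (4 * l + 1)) (h₂ : b₂ = true ↔ HasStone B (4 * l + 2))
    (h₃ : b₃ = true ↔ HasStone B (4 * l + 3)) :
    stones B l + (b₀.toNat + b₁.toNat + b₂.toNat + b₃.toNat) ≤ stones B (l + 1) := by
  have row : ∀ (r : Fin 4) (b : Bool), (b = true ↔ HasStone B (4 * l + r)) →
      b.toNat ≤ (B.filter fun c => c.2.val = l ∧ c.1 = r).card := by
    intro r b hb
    cases b with
    | false => simp
    | true =>
      obtain ⟨c, hc, hcode⟩ := hb.1 rfl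
      have h1 := c.1.isLt
      have h2 := r.isLt
      simp only [code] at hcode
      exact Finset.card_pos.2 ⟨c, Finset.mem_filter.2 ⟨hc, by omega, Fin.ext (by omega)⟩⟩
  have hsum : stones B l + ∑ r : Fin 4, (B.filter fun c => c.2.val = l ∧ c.1 = r).card =
      stones B (l + 1) := by
    rw [← Finset.card_biUnion, stones, stones, ← Finset.card_union_of_disjoint]
    · congr 1
      ext c
      simp only [Finset.mem_union, Finset.mem_filter, Finset.mem_biUnion, Finset.mem_univ,
        true_and]
      constructor
      · rintro (⟨h, h'⟩ | ⟨r, h, h', -⟩)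
        · exact ⟨h, by omega⟩
        · exact ⟨h, by omega⟩
      · rintro ⟨h, h'⟩
        by_cases e : c.2.val < l
        · exact Or.inl ⟨h, e⟩
        · exact Or.inr ⟨c.1, h, by omega, rfl⟩
    · rw [Finset.disjoint_left]
      intro c hc hc'
      simp only [Finset.mem_filter, Finset.mem_biUnion, Finset.mem_univ, true_and] at hc hc'
      obtain ⟨r, h, h', -⟩ := hc'
      omega
    · intro r _ r' _ hne
      rw [Function.onFun, Finset.disjoint_left]
      intro c hc hc'
      simp only [Finset.mem_filter] at hc hc'
      exact hne (hc.2.2.symm.trans hc'.2.2)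
  rw [Fin.sum_univ_four] at hsum
  have r0 := row 0 b₀ h₀
  have r1 := row 1 b₁ h₁
  have r2 := row 2 b₂ h₂
  have r3 := row 3 b₃ h₃
  omega

/-- `Q` holds for both Boolean values. -/
def bothBool (Q : Bool → Bool) : Bool := Q false && Q true

theorem bothBool_spec {Q : Bool → Bool} (h : bothBool Q = true) (b : Bool) : Q b = true := by
  rw [bothBool, Bool.and_eq_true] at h
  cases b
  · exact h.1
  · exact h.2

/-- A state `(p, u)` says that at least the templates of `p` are pending, and that the number of
stones up to here, times 3, is at least twice the number of columns plus `u`, minus 6. The list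
`S` of states is closed, up to domination, under adding a column to the state `(p, u)`, unless a
template is completed; the code `h` contains the places of the dominating states in the list. -/
def stateClosed (D K₀ K₁ K₂ K₃ L : ℕ) (S : List (ℕ × ℕ)) (p u h : ℕ) : Bool :=
  bothBool fun b₀ => bothBool fun b₁ => bothBool fun b₂ => bothBool fun b₃ =>
    force (u + 3 * (b₀.toNat + b₁.toNat + b₂.toNat + b₃.toNat)) fun v =>
      Nat.ble 8 v ||
        force (nextPending D K₀ K₁ K₂ K₃ p b₀ b₁ b₂ b₃) fun q =>
          !Nat.beq (q &&& L) 0 ||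
            match S[h / 2 ^ (10 * (b₀.toNat + 2 * b₁.toNat + 4 * b₂.toNat + 8 * b₃.toNat)) %
              2 ^ 10]? with
            | none => false
            | some (p', u') => Nat.ble (u' + 2) v && Nat.beq (p' &&& q) p'

/-- All states are closed. -/
def allClosed (D K₀ K₁ K₂ K₃ L : ℕ) (S : List (ℕ × ℕ)) : List (ℕ × ℕ) → List ℕ → Bool
  | [], _ => true
  | (p, u) :: l, hs => stateClosed D K₀ K₁ K₂ K₃ L S p u (hs.headD 0) &&
      allClosed D K₀ K₁ K₂ K₃ L S l hs.tail

theorem allClosed_spec {D K₀ K₁ K₂ K₃ L : ℕ} {S l : List (ℕ × ℕ)} {hs : List ℕ}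
    (h : allClosed D K₀ K₁ K₂ K₃ L S l hs = true) {p u : ℕ} (hp : (p, u) ∈ l) :
    ∃ c, stateClosed D K₀ K₁ K₂ K₃ L S p u c = true := by
  induction l generalizing hs with
  | nil => cases hp
  | cons x l ih =>
    obtain ⟨p', u'⟩ := x
    rw [allClosed, Bool.and_eq_true] at h
    rcases List.mem_cons.1 hp with e | hp
    · cases e
      exact ⟨_, h.1⟩
    · exact ih h.2 hp

theorem stateClosed_spec {D K₀ K₁ K₂ K₃ L : ℕ} {S : List (ℕ × ℕ)} {p u c : ℕ}
    (h : stateClosed D K₀ K₁ K₂ K₃ L S p u c = true) (b₀ b₁ b₂ b₃ : Bool) :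
    8 ≤ u + 3 * (b₀.toNat + b₁.toNat + b₂.toNat + b₃.toNat) ∨
    nextPending D K₀ K₁ K₂ K₃ p b₀ b₁ b₂ b₃ &&& L ≠ 0 ∨
    ∃ p' u', (p', u') ∈ S ∧ u' + 2 ≤ u + 3 * (b₀.toNat + b₁.toNat + b₂.toNat + b₃.toNat) ∧
      p' &&& nextPending D K₀ K₁ K₂ K₃ p b₀ b₁ b₂ b₃ = p' := by
  have := bothBool_spec (bothBool_spec (bothBool_spec (bothBool_spec h b₀) b₁) b₂) b₃
  simp only [force_eq, Bool.or_eq_true, Nat.ble_eq, Bool.not_eq_true'] at this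
  rcases this with h1 | h2 | h3
  · exact Or.inl h1
  · refine Or.inr (Or.inl fun e => ?_)
    rw [e] at h2
    cases h2
  · right; right
    split at h3
    · cases h3
    · rename_i p' u' hS
      rw [Bool.and_eq_true, Nat.ble_eq] at h3
      exact ⟨p', u', List.mem_of_getElem? hS, h3.1, Nat.eq_of_beq_eq_true h3.2⟩

/-- A closed list of states bounds the number of stones of a virtual connection. -/
theorem two_mul_le_of_allClosed {M D : ℕ} {S : List (ℕ × ℕ)} {hs : List ℕ} (hD : 0 < D)
    (hM : ∀ t < D, Template (digit M t)) (h0 : (0, 6) ∈ S)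
    (h : allClosed D (rowMask M D 0) (rowMask M D 1) (rowMask M D 2) (rowMask M D 3)
      (lastMask M D) S S hs = true)
    {n : ℕ} {B : Finset (Cell 4 n)} (hB : IsVirtualConnection B) : 2 * n ≤ 3 * B.card + 6 := by
  have pend0 : ∀ l, Pending B M D l 0 := fun l b hb => by simp at hb
  have key : ∀ l ≤ n, ∃ p u, (p, u) ∈ S ∧ Pending B M D l p ∧ u + 2 * l ≤ 3 * stones B l + 6 := by
    intro l
    induction l with
    | zero => exact fun _ => ⟨0, 6, h0, pend0 0, by omega⟩
    | succ l ih =>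
      intro hl
      obtain ⟨p, u, hS, hp, hu⟩ := ih (by omega)
      classical
      have e : ∀ i, (decide (HasStone B i) = true ↔ HasStone B i) := fun i => decide_eq_true_iff
      have hst := stones_succ B l (e _) (e _) (e _) (e _)
      have hnext := hp.next hD (e _) (e _) (e _) (e _)
      obtain ⟨c, hc⟩ := allClosed_spec h hS
      rcases stateClosed_spec hc (decide (HasStone B (4 * l))) (decide (HasStone B (4 * l + 1)))
        (decide (HasStone B (4 * l + 2))) (decide (HasStone B (4 * l + 3))) with h1 | h2 | h3
      · exact ⟨0, 6, h0, pend0 _, by omega⟩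
      · exact absurd hB (hnext.not_isVirtualConnection hl h2 hM hD)
      · obtain ⟨p', u', hS', hu', hp'⟩ := h3
        exact ⟨p', u', hS', hnext.mono hp', by omega⟩
  obtain ⟨p, u, -, -, hu⟩ := key n le_rfl
  have : stones B n ≤ B.card := Finset.card_filter_le _ _
  omega

/-- The pending templates after the columns coded by `w` in base 16, the first one lowest, with a
final digit 1. -/
def pendingAfter (D K₀ K₁ K₂ K₃ : ℕ) : ℕ → ℕ → ℕ → ℕ
  | 0, _, p => p
  | fuel + 1, w, p =>
    bif Nat.ble w 1 then p
    else
      force (nextPending D K₀ K₁ K₂ K₃ p (w.testBit 0) (w.testBit 1) (w.testBit 2) (w.testBit 3))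
        fun p' => force (w / 16) fun w' => pendingAfter D K₀ K₁ K₂ K₃ fuel w' p'

/-- The list of states `(p, u)` coded by a column word `w` and `u` as `7 * w + u` is handed to
`f`. -/
def decodeStates (D K₀ K₁ K₂ K₃ : ℕ) : List ℕ → (List (ℕ × ℕ) → Bool) → Bool
  | [], f => f []
  | x :: l, f =>
    force (pendingAfter D K₀ K₁ K₂ K₃ 10 (x / 7) 0) fun p =>
      force (x % 7) fun u => decodeStates D K₀ K₁ K₂ K₃ l fun S => f ((p, u) :: S)

theorem decodeStates_spec {D K₀ K₁ K₂ K₃ : ℕ} {l : List ℕ} {f : List (ℕ × ℕ) → Bool}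
    (h : decodeStates D K₀ K₁ K₂ K₃ l f = true) : ∃ S, f S = true := by
  induction l generalizing f with
  | nil => exact ⟨_, h⟩
  | cons x l ih =>
    simp only [decodeStates, force_eq] at h
    obtain ⟨S, hS⟩ := ih h
    exact ⟨_, hS⟩

/-- The coded states, with the initial state, are closed. -/
def isClosedAutomaton (M D : ℕ) (codes hs : List ℕ) : Bool :=
  force M fun M => force D fun D =>
    force (rowMask M D 0) fun K₀ => force (rowMask M D 1) fun K₁ =>
      force (rowMask M D 2) fun K₂ => force (rowMask M D 3) fun K₃ =>
        force (lastMask M D) fun L => Nat.blt 0 D &&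
          decodeStates D K₀ K₁ K₂ K₃ codes fun S =>
            allClosed D K₀ K₁ K₂ K₃ L ((0, 6) :: S) ((0, 6) :: S) hs

theorem two_mul_le_of_isClosedAutomaton {M D : ℕ} {codes hs : List ℕ}
    (h : isClosedAutomaton M D codes hs = true) (hM : ∀ t < D, Template (digit M t))
    {n : ℕ} {B : Finset (Cell 4 n)} (hB : IsVirtualConnection B) : 2 * n ≤ 3 * B.card + 6 := by
  simp only [isClosedAutomaton, force_eq, Bool.and_eq_true, Nat.blt_eq] at h
  obtain ⟨hD, h⟩ := h
  obtain ⟨S, hS⟩ := decodeStates_spec h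
  exact two_mul_le_of_allClosed hD hM (by simp) hS hB

set_option maxRecDepth 20000 in
/-- Barriers `(W, L)`, coded as `W + 2 ^ 40 * L`. -/
def barriers : List ℕ := [
  0x13000000012c, 0x1370000001248, 0x3000000003c, 0x370000000348, 0xf, 0x900000000d6,
  0xc00000000e3, 0x800000000c7, 0x70000000078, 0x1000000001e, 0x4000000006b, 0x170000000168,
  0x113000000122c, 0x3370000003448, 0x13370000012448, 0x11370000012248, 0x33370000034448,
  0x880000000c47, 0x890000000c56, 0xcc0000000e23, 0x8c0000000c63, 0x4c00000006a3,
  0x11113000012222c, 0x1113000001222c, 0x111370000122248, 0x889000000c456, 0x88c000000c463,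
  0x888000000c447, 0x113370000122448, 0x133370000124448, 0x1333370001244448, 0x1133370001224448,
  0x333370000344448, 0x13113000012462c, 0x3113000003462c, 0x1111370001222248, 0x1311370001246248,
  0x311370000346248, 0xc89000000e256, 0xccc000000e223, 0xc88000000e247, 0x4890000006a56,
  0x4cc0000006a23, 0x4880000006a47, 0x8cc000000c623, 0x1113370001222448, 0x4ccc000006a223,
  0x4889000006a456, 0x4888000006a447, 0x488c000006a463, 0x4c89000006a256, 0x4c88000006a247,
  0x111113000122222c, 0x113113000122462c, 0x133113000124462c, 0x131113000124622c, 0x888900000c4456,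
  0x888c00000c4463, 0x888800000c4447, 0x3333370003444448, 0x888890000c44456, 0x8888c0000c44463,
  0x888880000c44447, 0x33113000034462c, 0x13333370012444448, 0x11333370012244448,
  0x13311370012446248, 0x11311370012246248, 0x3311370003446248, 0xcc8900000e2256, 0x8c8900000c6256,
  0xcccc00000e2223, 0x8ccc00000c6223, 0xcc8800000e2247, 0x8c8800000c6247, 0x31113000034622c,
  0x11111370012222248, 0x13111370012462248, 0x3111370003462248, 0x11133370012224448,
  0xc88c00000e2463, 0xc88cc0000e24623, 0x488cc00006a4623, 0x1311113001246222c, 0x1111113001222222c,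
  0x311113000346222c, 0x33333370034444448, 0x1333113001244462c, 0x1133113001224462c,
  0x333113000344462c, 0x133333370124444448, 0x113333370122444448, 0x133311370124446248,
  0x113311370122446248, 0x33311370034446248, 0x88cc00000c4623, 0x1113113001222462c,
  0x111333370122244448, 0x111311370122246248, 0x4cc8900006a2256, 0x4cccc00006a2223,
  0x4cc8800006a2247, 0x88c890000c46256, 0x88ccc0000c46223, 0x88c880000c46247, 0x111133370122224448,
  0x131133370124624448, 0x31133370034624448, 0xc88900000e2456, 0xc88800000e2447, 0xc888c0000e24463,
  0x4888c00006a4463, 0x8888cc000c444623, 0xc888cc000e244623, 0x4888cc0006a44623,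
  0x111113370122222448, 0x11113370012222448, 0x1111133371222224448, 0x1111333371222244448]

set_option maxRecDepth 20000 in
/-- For each further entry of the table, the attacks that secure it. -/
def attackLists : List ℕ := [
  0x1dc4701d803, 0x1e00801d804, 0x1e00c01d808, 0x1e04701dc03, 0x408000c4700100c000803,
  0x1e04501dc02, 0x1e44401dc00, 0x1e00501dc02, 0x1e00001e804, 0x402000800001004000c05, 0x401002449,
  0x1e80501e402, 0x1ec0401e400, 0x2000201e805, 0x1f004020400, 0xc05000402001004000800, 0x401003809,
  0x21047020003, 0x20003021007, 0x2003000805003807000402, 0x21407020403, 0x3c07000400001004002403,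
  0x22403021807, 0x4007002803000402000c05, 0x2803001804004007000800,
  0x2803001804004007000402000800001005, 0x4007002803000401005809, 0x23401023845, 0x24403023c46,
  0x22c03023c06, 0x23001024c05, 0x1006000c05000801000403, 0x25009023005, 0x23c47023403,
  0xc4b007c09000803000405, 0x5401023805, 0x402026806, 0x40300488e, 0x24003026847, 0x7801026c4a,
  0x640102480a, 0x403004001000807000c0a, 0x40600648e, 0x8801028849, 0x7401028809,
  0x500100040300080700b409, 0x100d00240900040600304a, 0x2980802680c, 0x26c05029806, 0x2a005029406,
  0x408000c0500c00600080c, 0x9401000409, 0x2a80902780a, 0x2740902780a, 0x27c1002800c,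
  0x27c1002b40c, 0x100c00040900080a000c10, 0x2a004029408, 0x40500080d, 0x2c447029003,
  0x41000580c00180300e847, 0x2940302a047, 0xf80c000410001c03003c47, 0x80900280300100a003c47,
  0x680a010009003003003c47, 0x40c002403000c0900081000140a003c47, 0xd04700840800c404002403,
  0x404700240300080d000405, 0xec0100484d, 0x340d00d801, 0x40300080700b40100140d, 0x984a02c805,
  0xdc4a02fc05, 0x1c4a00080c000408006805, 0x40900f001, 0xa88e02cc09, 0xec8e030809,
  0x40c000810002c8e005809, 0x40d005405, 0xb88e004809, 0xfc8e014009, 0x40c000810003c8e004c09,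
  0x204700100300040d004005, 0x284d012801, 0x1c0d011401, 0x40300080700100d00f001, 0x13401009c49,
  0x13801009c50, 0x13c01009c4c, 0x406000806000c06015c4a, 0x14401031449, 0x40603444a, 0x40700ec8e,
  0xc80603444a, 0x40701348e, 0xc1000040c00180700748e, 0x35047032806, 0x40a01408e,
  0x40d01004a00c809, 0x32803033447, 0x40a03608b, 0x40e0150d2, 0x41101108e009c0d, 0x3340b035c07,
  0x1850017c01, 0x3748b03400a, 0x40e0164d2, 0x800d00041100d80d, 0x410017401,
  0x1407000403001c10015001, 0x1980201b449, 0x1b409018402, 0x40300080701600201b009, 0x1c049038c02,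
  0x1c009038002, 0x1bc09000807000403018402, 0x48e01d006, 0x1d049039402, 0x1d00903a402,
  0x40300080701cc09018402, 0x48e01d406, 0x140c00248e00040801d406, 0x3780003ac44, 0x38400038004,
  0x3840203b045, 0x3800003b444, 0x38405039002, 0x400000c04001002000805, 0x40601fc8d, 0x3cc4b03b403,
  0x3940b03cc07, 0x1f40700040001b44400180b, 0x740200080501f40700180b, 0x3a80b03dc07,
  0x1c04500280b000402020407, 0x1fc0700800000080400300b, 0x240b00140500100001fc07000804000402,
  0x22049020801, 0x1f401022009, 0x807000403021c0901d001, 0x3e006040c02, 0x88e000403, 0x3c80903c406,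
  0x22044000400005409004806, 0x23c8d000405, 0x4080603cc09, 0x3d00003fc44,
  0x21844023406000800000409, 0x40502484d, 0x3e40b03dc07, 0x40900140700500600200b,
  0x80000740b001407020c44, 0x140702044400240b000800000409005406, 0x240b00140700040502544d,
  0x2648d003005, 0x2644d025006, 0x2684d002c05, 0x407000c0b02644d001c05, 0x44c02043406, 0x84e000403,
  0x804005008019c06027c02, 0x500800080400204e000403, 0x1a80d043808, 0x40c10041011, 0x414043c0c,
  0x648b041409, 0x208b044409, 0x1c8b00040c000810000c09, 0x40d047c08, 0x42011044410, 0x42406042c02,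
  0x42c02044c06, 0x48806045c02, 0x848b000809, 0x2b009028805, 0x2b409028800,
  0x806004005000406028802, 0x948b046406, 0x508b04a006, 0x810004c8b00040c01f006, 0x2c809048405,
  0x40604a002, 0x48b04a806, 0x408001c8b00100d02d406, 0x400502a801, 0x1d006000402000809006405,
  0x47c0104a845, 0x2944502800700d80100040b, 0x48845046802, 0x46800048c44, 0x46c05046802,
  0x47404046c00, 0x402001004000800000c05, 0x40102e489, 0x40a0304d1, 0x1100102d489, 0x40a030891,
  0x4a80b048c0f, 0x17c4501280b00280f000402, 0x4900f04a80b, 0x2c0f018444012c0b000400, 0x4940f04bc0b,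
  0x402000c0500300f01300b, 0x180400300f00080001400b, 0x80001340b00100500180400300f000402,
  0x300f00280b00040102d489, 0x280b00300f00040a032891, 0x5140305048a, 0x5008a051003,
  0x33c0300040803248a00080c, 0x4090344d1, 0x5048a052403, 0x52003051c8a, 0x31c8a00040800080c034c03,
  0x409035091, 0x3148a053403, 0x3088a053003, 0x40803048a00080c035c03, 0x200f00100b000409035891,
  0x5280305044a, 0x5280304e80a, 0x80500040203480300840a, 0x4040374d1, 0x53803053c4a, 0x5140a053803,
  0x1940a035803000805000402, 0x404038091, 0x1f04a054803, 0x7c0a054803, 0x7c0a000402000805036803,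
  0x100b00200f000404038891, 0x5500305100a, 0xac0a037003000400003404, 0x40503a0d1, 0x55c0305340a,
  0x1b80a000400003004037c03, 0x40503a891, 0x980a056803, 0x2c0400980a000400038803,
  0x180f000c0b00040503ac91, 0xc00a03bcd1, 0x1c80a03bc91, 0x80f00040b00980a03b891, 0x3c8d105400a,
  0x3c891055c0a, 0x40b03c49100080f00b80a, 0x40e058c03, 0xe40a03d8d1, 0x1e80a03d891,
  0x40b00080f03d49100bc0a, 0x3e4d105580a, 0x3e49105840a, 0x3e09100040b00080f00cc0a, 0x40e05c003,
  0x200500040200140e03c403, 0x3f8d105740a, 0x3f89105940a, 0x80f00040b03f49100f00a, 0x40e05c003,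
  0x1100a0408d1, 0x2240a040891, 0x80f00040b00e80a040491, 0x40e00240000100403e003,
  0x540e00040200840e00600e00240003e003, 0xe80e00b80e00040103e003, 0x5a41005d00c, 0x5a80505c806,
  0x410000805035006036c0c, 0x5d410059c14, 0x5b01405d410, 0x5a40a05b409, 0x36810000414000c0a000809,
  0x5ac0305e047, 0x35810000414036847001403, 0x5c84705c403, 0x1803035810002847000414,
  0x100a002847001803000809, 0x3581000080900180300100a000414002847, 0x80d04588e, 0x3600d04508e,
  0x410000814000c0d04508e, 0x26801039c91, 0x44401038851, 0x80b000407024c01036851,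
  0x40a005401001011040c01, 0x1f48b01dc0c01e010005009, 0x40d064c04, 0x45801000449,
  0x4000304084703fc05047409, 0x500d065408, 0x6040d065808, 0x403025ccf, 0x6300d066008,
  0x21ccf000403, 0xc140004100014030218cf, 0x540d026ccf, 0x3ac0d0228cf, 0x4100008140224cf00580d,
  0x3047000411001011049c08, 0x27ccf06280d, 0x238cf06500d, 0x4100234cf00081400800d, 0x411068808,
  0x409048001, 0x4407000403001809045c01, 0x69003068406, 0x4444a06a006, 0x4884a069c06,
  0x80c00040803c84a04c806, 0x63c14067010, 0x64003067c47, 0x40447035010000803000414, 0x80a06b88b,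
  0x80a00041403541004dc8b, 0x80e0464d2, 0x3581000041400080e03e4d2, 0x4ec8d068806, 0x4ec4d06b406,
  0x4e84d00040700080b035c06, 0x44e06b803, 0x6c80706940a, 0x4f00700404500040203140a, 0x6cc0706940a,
  0x40000484403180a04f407, 0x6d00706a80a, 0x402000c05031c0a04f807, 0x80004f807032c0a001804,
  0x100500180404f80700040203200a000800, 0x5091000401, 0x1080100040b00381104c001, 0x1040906fc04,
  0x449050801, 0x4f40104580a, 0x4f801046010, 0x4fc0104680c, 0x44a00084a000c4a001006045c4a,
  0x7140406c009, 0x449052001, 0x50c0106ec0a, 0x44a00080604784a, 0x40704ccd2, 0x72804070009,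
  0x449053401, 0x4bc4a000406048c4a, 0x51cd2000407, 0x410001414002807045cd2, 0x6ec1406e810,
  0x4e8d206f00d, 0x52cd206f00d, 0x410046cd2000814000c0d, 0x41107240c, 0x409075808, 0x75c8b072406,
  0x7588b072c06, 0x81005848b00040c04b006, 0x508d206f80d, 0x54cd207340d, 0x814048cd200041001640d,
  0x411059009, 0x7488b070806, 0x1700604e48b000414002010, 0x520d200080d, 0x280d0564d2,
  0x41000081404a4d2000c0d, 0x7880607688b, 0x7808b078406, 0x40805808b05b00600080c,
  0x101104948b002406000409, 0x4405058801, 0x4b00600040200080a034405, 0x4e405076809,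
  0x40304c40505404704d809, 0x5748e05c406, 0x1440304e00d05c808008047, 0x14809059c01,
  0x809000403008407057801, 0x1091000406, 0x4e8060598d2, 0x59c8e033803, 0x77c0007b888,
  0x7ac48077800, 0x40703a00000080b05b048, 0x7840007c048, 0x5e84803c400001009000406, 0x7b84807c400,
  0xc0b05bc4803fc00000407, 0x80600180903c40005dc48, 0x180900040705c04800080603b40000100b,
  0x7e80c07cc04, 0x7c00c07e804, 0x3a00400040203680c000806, 0x3c44e03a403, 0x380c00040400144e000803,
  0x8000807a409, 0x7a40d08000c, 0x1e40d000847000403062c0c, 0x60c01000c49, 0x5f801000c09,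
  0x40300080705d401000c09, 0x40605f116, 0x61c0107e44a, 0x6080107ac0a, 0x40305e40100080701700a,
  0x40608248b, 0x40e060516, 0x2c0907bc0a, 0x40308308b, 0x40e05604a017c0e003009, 0x4640105e88c,
  0x6400105e44c, 0x40700080b04480101e84c, 0x7d40a08448b, 0x40e07ec0d, 0x414084c0c, 0x409063c01,
  0x140a000403002014061801, 0x648d05cc06, 0x648d00341400040c004814000806, 0x5a80d065c04,
  0x5ac0d065c05, 0x5b00d065c00, 0x406000c06000806065c02, 0x5b80d085405, 0x406085402, 0x48b06a006,
  0x5c40d085805, 0x406087402, 0x6a00600048b, 0x100c000408001c8b06a006, 0x5ec09088001,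
  0x44705b40d002003067405, 0x3e8cf05bc06, 0x5f84d088802, 0x5e40d087c02, 0x40300080705c40d068002,
  0x48e06cc06, 0x140d00040900188e02504a, 0x6b00606cc4d, 0x40704d80b04b80606c84d, 0x4ec0606d88d,
  0x6cc0606d84d, 0x80b00040706d44d04cc06, 0x6e806000492, 0x4f40606e88d, 0x40b04840706e04d04e006,
  0x49206e806, 0x100c00040806e806002092, 0x4240908d805, 0x40806c801, 0x430cf08ac0a, 0x40d08e009,
  0x6280500040c, 0x140808dc00, 0x440cf067c0a, 0x40d001c47001003071809, 0x140c08d804,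
  0x40300080c00104706dc04, 0x405001803002447071409061c05, 0x2640006f00307080606b404, 0x6444a000401,
  0x8980e089c0d, 0x8d80d08d00e, 0x41002640e00081403080d, 0x411073409, 0x8a41208a011, 0x8a81808a014,
  0x8a81808b014, 0x8a81208b411, 0xc12000414001018000811, 0x415067c0d, 0x8c04708bc03, 0x8f84708b803,
  0x818001c03000414028c47, 0x8c40308d047, 0x2003033847000418029014, 0x811003c47002c03001412,
  0x2403003c47029811001412, 0x1412000c11002403000818000414003c47, 0x2403003c4700041506880d,
  0x240a09208b, 0x240a09288b, 0x81800240a00041406ac8b, 0x240a09288b, 0x41802ac1400240a06b08b,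
  0x141200081100240a06bc8b, 0x240a02b41100141206c48b, 0x41400240a001412000c1100081806b88b,
  0x6b00a094c8b, 0x7080a095c8b, 0x40c06b40a00081006c08b, 0x300a06c08b00101500040d, 0x9744a095c03,
  0x4340407904a00040806cc03, 0x6cc8e000405, 0x40b008c4b00100e06b005, 0x7b409097805, 0x406097802,
  0x78c01099c06, 0x6e405096c0a, 0x6c40500084700040306e00a, 0x4060010cf, 0x79c0107cc06,
  0x7000a06f405, 0x84700040306ec0a06d405, 0x7a80109b006, 0x70005098c0a, 0x84700040306e00507500a,
  0x4060518cf, 0x201000040c0530cf001406, 0x94c14094810, 0x9500a09d4cf, 0x9500a09d0cf,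
  0xc0a00041000081407fccf, 0xc0e09880d, 0xc0e09880d, 0x814000c0e00041002a40d, 0x41109bc0c,
  0x40909f008, 0x40509e400, 0x40108180507e401, 0x99c14097018, 0x97018096c14, 0xa051309740e,
  0x9740e0a0113, 0x818000c0e082d13000414, 0xc12098411, 0xc1209b411, 0x818000c12000414001c11,
  0x41509e010, 0x40d0a1c0c, 0x4090a0404, 0x84409076805000405, 0x9a00309d447,
  0x340302ec47040c14000418, 0x9a40309b047, 0x9b04709a403, 0x414003c03000818006c47, 0xc0e0a4113,
  0xc0e0a3d13, 0x818000c0e000414086913, 0x6c47000c12003c03002011, 0xc12006c47003c03042c11,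
  0x6c47000c12003c03000414000818002411, 0x415003c03006c47078810, 0x6c47003c0300040d08800c,
  0x409003c03006c47084004, 0x3c03006c47000405087809078005, 0xa1c4409cc00, 0x9cc0009d404,
  0xa440309d84a, 0x4060a2889, 0x9d84a0a5803, 0x40609e049, 0x144a00100807c003000804,
  0x1008000804000406001c49, 0x4050a70cc, 0x40d0a7d10, 0x41108b115, 0x9ec000a4044, 0x9f40409ec00,
  0xa700309f84a, 0x4060a4c89, 0x9f84a0a8403, 0x4060a0049, 0x80400100807ec0300144a,
  0x406001008000804001c49, 0x4050a8ccc, 0x40d0a98d0, 0x8d8d5000411, 0xa280f0a1c0b, 0xa280f0a1c0b,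
  0x40000340b06984400600f, 0xa2c0f0a200b, 0x380b00100400040000640f, 0x144a0aa803,
  0x641300040600380f06a889, 0x104a0abc03, 0x641300380f000406001c49, 0x100800144a000804082403,
  0x380f000406001008000804006413002049, 0x380f00641300040508c0cc, 0x380f00040d00641308d0d0,
  0x380f0908d5006413000411, 0x90050ae8cc, 0xa600d0a4c0a, 0xab0440a5000, 0x9c0d06f04400040a000800,
  0x8050af48c, 0x40a00080500140d091c8c, 0x4090930d1, 0x80050af48c, 0xacc0a0a700d,
  0x7580a00880d06fc44000400, 0x75c050afc8c, 0x80500040a00100d091c8c, 0x409094491,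
  0x640500340f00180b090c8c, 0xae40b0a800f, 0x40a00380f001c0b00700d, 0x7544400080007740b00380f,
  0x40a00380f00080007084400200b00740d, 0x380f00080500200b091c8c,
  0x380f00180d00080500040a00200b091c8c, 0x95c9100200b00380f000409, 0xb00010b3c88, 0xb00010b3c48,
  0x406000809074001096448, 0x40509788d, 0xb3c480b0801, 0xb3c480b4801, 0x809074401000406095c48,
  0x40509844d, 0x94c48073c0100100700200b, 0x1007094c4800200b078c01,
  0x200b000809074001094c48001007000406, 0x100700200b000405098c4d, 0x492091c06, 0xb70cc0ae405,
  0xb708c0ad405, 0x80d00040a008c0509988c, 0x40909acd1, 0xb708c0ae805, 0xb48050b708c,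
  0x80d00040a00800509908c, 0x9b891000409, 0x200f00100b00dc0509808c, 0x9808c00200f00100b007405,
  0x100b00080d09808c00200f00740500040a, 0x100b00200f00040909c091, 0x452099006,
  0x3808000404006c5208d006, 0xb70060ba045, 0xb70050b7806, 0x7fc0500040000080407f806, 0x4010ba08c,
  0xba0450bb406, 0xb78050bb006, 0x40009d40600080407ac05, 0x4010ba84c, 0x100707e80600200b09ac45,
  0x7ac0500200b086406001007, 0x80400040000100700200b07a80507e806, 0x100700040100200b09844c,
  0x9380309888e, 0x24803098c8e, 0x44c0309908e, 0x93405094410, 0x204e0bcc03, 0x204e0bdc03,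
  0x204e000404000808094003, 0x181000141000040500204e001c10001003, 0x4600609a88e, 0x9700c09f801,
  0x1c03092c05000447093810, 0x53c0609f40609e84a, 0x200600044909b806, 0x6680607ec0a09f006,
  0xa40d101200a, 0xa409108600a, 0x40b00080f00f00a0a3c91, 0x180400100000040e09fc06,
  0x34060014490a1006, 0x1c08000404003406000849095006, 0x3010000405003406088c50002806,
  0x998910bf406, 0x984510c2c06, 0x40700080b096451085406, 0x40a0c2403, 0x9a891088406, 0x994510a5406,
  0x80b000407097451085c06, 0x9b4910c1406, 0x9a0510c4006, 0x80b09805100040708e806, 0x40a0c5403,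
  0x40000200400140a0a5403, 0xa74000a8c49, 0x7d8030004070a38000a8409, 0xc04140bc018, 0xbc4030c1847,
  0x66c47000418000803066014, 0x80a09b08e, 0x6680a0aa88e, 0x818000414000c0a09b48e,
  0xc1103200e0ab0d2, 0x3200e000c110aa8d2, 0xc1100041400081803200e0aa8d2, 0xab8490c8005,
  0x4070ab00907f0030a7005, 0x48e0ab806, 0x9e80d0c8404, 0x394110c9c08, 0x380150c780c,
  0x8470004030360150a3c0c, 0x40a03401500108b03380c, 0xa988e0a440a, 0x2815001c4c00080e004cd200040c,
  0x7c4e0c9403, 0x644e0ca403, 0x80800744e0004040a0803, 0x40500644500100d09e805, 0x4588b0a6403,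
  0x3c0110cc809, 0x3ac150ca40d, 0x847000403038c150a680d, 0xc4a0ae001, 0xc0a0acc01,
  0x807000403000c0a0aa801, 0x5f4010a3095, 0xce0030cac0a, 0x9200a0770050ae403000402,
  0x8000ae40309300a079c04, 0x79c0400080000040209240a0ae403077405, 0x4010a4495,
  0x40b00180b0390150ac401, 0xa88060ce88b, 0x80600240600040d04988b, 0x40e0040090a800606b44a,
  0xaa8030d008a, 0x4090d08cd, 0x40c0a78d5, 0xab4030cfc8a, 0x4090d048d, 0x40c0a6c95, 0xac0030b088a,
  0x409000c0b00180f0b108d, 0xc0b00180f00040c0a5495, 0x930d20aa806, 0x930cf0ce40d, 0x8eccf0ce40d,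
  0x41000081408e8cf06000d, 0x4110d4808, 0xcec060cf405, 0x74c10000414074006060c05, 0x948cf00080d,
  0x904cf07540d, 0x410000814000c0d0900cf, 0x180506cc060004110ac008, 0x959130cb011, 0x915130cf811,
  0x81800041409111300f811, 0x4150d3c0c, 0x969130ce811, 0x925130d1811, 0x92113000818000414038011,
  0x4150d7c0c, 0xcf8090cd00a, 0x41801140a038c09077414, 0x98113000811, 0x93d13077c11,
  0x414000818093913000c11, 0x41500180900280a0aec0c, 0x99113037011, 0x77c11094d13,
  0x414000818037411094913, 0x5c47002403037c0901300a, 0x418005c4701300a002403037c09078014,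
  0x504d0bb001, 0x6700d0db408, 0x680d0758060004050b1808, 0x148110d880c, 0x3c4110dbc0c,
  0x80a000409003c110b180c, 0x76847014c11000c030b540c, 0x1847039c11000c030bf00c,
  0x184700040900080a000c030024110af40c, 0xd7c0d0dd408, 0xb3808077406008c0d000405, 0xda80c0d2811,
  0xd54110ddc0c, 0x60110b380c00040900080a, 0x17011000c030b740c078447, 0x18470c100c03c011000c03,
  0x40900080a000c030048110b140c001847, 0x40d09e913, 0xd9c0d0df808, 0x7900600040507f80d0b5c08,
  0xd90110dcc0c, 0xe000c0da411, 0x7f4110b5c0c00080a000409, 0xc0307f01107a0470b980c,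
  0x7ec110c340c001847000c03, 0x409000c0300080a00184707e8110b380c, 0x40d09c513,
  0x2818000414004c0d09c113, 0x880d0c0801, 0x4030074070008150be401, 0xe4110df80c, 0x4090e2c08,
  0xb4150df410, 0x40d0e300c, 0x10470008030094150b6810, 0x10490c3c01, 0xc0300080d0014470c640c,
  0x10090c2c01, 0xc070004030008090c0801, 0xa28050e204c, 0xc50010e504c, 0xc60050e544c,
  0xe040a0e4006, 0x85c090e5c08, 0xe0c050e344c, 0xe4c050e644c, 0x100500080a0a5c4c000406,
  0xe5c020e4406, 0x4440018000a4c0a0c7c06, 0x280a0020060004050a684c, 0xe58040e3c09,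
  0xa280409f409000406076002, 0x4030a748b, 0xe48090e5808, 0x688020a7c080004060a0009, 0xa808b000405,
  0xe64080e6800, 0xe94080e8400, 0x806002c000a8c08000402, 0xe60100e9008, 0x348b0e9406,
  0xa0410000c8b000408000806, 0x4090c9402, 0x6ac050aa08b, 0x4100c9c01,
  0x402002810000c0107a40602c0060a5805, 0x30030aac8b, 0x3c1000041000484b0a6003, 0xe08000e1844,
  0x4050e7088, 0x4090ea0cc, 0x40d0ea0d4, 0xe840a0e280e, 0xe380e0e1c12, 0x181200084400040004700e,
  0x474050ec488, 0x1c1200080500040e008888, 0x8090ed4cc, 0x80900201200040e007ccc,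
  0x40d002012009c8e0ae0d4, 0xeec090ec408, 0xecc440ea001, 0x4050ecc4c, 0xeec440ee401,
  0xa801009444000c0a000406, 0xb406000405000c0a0af84c, 0x4f8180ecc10, 0xedc090f0c08,
  0xa84090b0408000402002006, 0x10d3000403, 0xf14090ef804, 0x7ec020a90090004060ac804, 0x1cd3000403,
  0x100c00040c0038530ac803, 0xe68000e6c04, 0xe68050e6c02, 0xe68040e6400, 0x2c0901a818007c980c8410,
  0x40d0f0c08, 0xacc0d0f1511, 0x4100f1518, 0xad40d0f3511, 0x4100f4918, 0xadc0d00e111,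
  0x8120010160004100b4518, 0x4130f5408, 0xac80d0f3111, 0x4100f3118, 0xad00d0f5111, 0x4100f6518,
  0xad80d00fd11, 0x8120004100010160b6118, 0x1c020038060004130b6408, 0xb4050f4ccc, 0x40d0f4cd4,
  0x4840d0f7cd4, 0x4880e000c1200a8050114cc, 0x80e00040d000c120b78d4, 0xb64050f4c4d, 0xd98050f304d,
  0x1200500080a0004060b084d, 0x4070b88cf, 0x41400e05400140f012407, 0xf84050f4049, 0x4060f644a,
  0x4070b98cf, 0xf4c100fa808, 0x4490f9405, 0x40600101401480901144a, 0xf9c050fb449, 0x4060fac4a,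
  0x4070150cf, 0x40c001c140010070128cf, 0x4510b7003, 0x40400580300304d0b6c03,
  0xae40a0db00302d0010a9c09, 0x4060b3098, 0x80601388e, 0xc06013890, 0xc0b00040b00080b014513,
  0xfd0010fe008, 0xfa80d0fe00c, 0xf8c0d0fb80c, 0x8060b600c0b640d000402, 0x8090fe804, 0xfc8080fcc01,
  0xbec08018c01000406001802, 0x14090ffc08, 0xdec01100005, 0xe20090fcc0d, 0x40600088b08740908ac0d,
  0x10050df801, 0x4020d200600080a0bb405, 0x403001d13, 0xe0c050fdc09, 0xffc050fe009, 0xff8050fe409,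
  0xe10010a2009, 0xfac0e0f740d, 0xff08b0fb006, 0xfd48b0f7c06, 0x40d00080e000c060a308b,
  0x10110e5409, 0x188b00040600081108a809, 0x10048b0f6c0a, 0x40e0f740d, 0x41110180c, 0x409104c08,
  0x4050e3c01, 0xe3c0102700d, 0x802000406001c0a0bfc05, 0x403103113, 0x41609384b0c5513,
  0x10648b102c03, 0xe6c0110684c, 0xdac05103410, 0x10544b105003, 0x4040e784b0db4030c9408,
  0x104b000405000c03001410, 0xca8890c7003, 0xc2c0304fc4d, 0xc2803057c4d000808000404, 0x405108918,
  0xea80910140a, 0x10600c0fb80a, 0x409109408, 0x4050e8401, 0xe840110240a, 0x8020c0401000406001406,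
  0x40310a513, 0xdf40d103018, 0x10340a101c0d, 0x41810a408, 0x409000c0a0ed009, 0xfdc0d0fe00a,
  0x418108c0c, 0x40910c008, 0x4050eb001, 0x4020858010014060c6c05, 0xc7803101c49,
  0x4040054080c740305d049, 0x40510c0d0, 0x1cc050ec401, 0xc80050004020e3006, 0x40310c4d3,
  0xed001028805, 0x4020e2c060c8c05, 0x403001813000c0c0ef0d3, 0x40d006813002803004c180088d3,
  0x1008d076c06, 0xca4030cd849, 0x4040008080cd4490ca003, 0x40510c898, 0x10b40b10dc03,
  0x10580f10b407, 0xce807060c0f000844000400, 0x2c40700040506080f0d304c, 0x10d00b110403,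
  0x4020014050f08030d440b, 0x4890d1003, 0x11040710b40f, 0x44a110403, 0x11100710c00f,
  0x10c406107c09, 0x8060d100700040f002809, 0x4490ce003, 0x1c0800040400284d0cdc03,
  0xb413000405003c0b00d898, 0xa00311088b, 0x11004510e001, 0x348a113c03, 0x11040b112803,
  0xd880b0f3c03000404003c00, 0x107413110c0b, 0x10ec45107802, 0xd900b000413003c45000802,
  0x11100b107c13, 0x10f844108000, 0x4130d980b004844000800, 0x10841311280b, 0x108802108c05,
  0x4130008020da00b001405, 0x109000109804, 0x10000028040004130db40b, 0x1c05002804000802001000,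
  0x802001c050dac0b002804000413001000, 0x8010dc089, 0x413003c890ca40b000801, 0x448a118c03,
  0x448a00040c004c080fb003, 0x440a117403, 0x780500400a0004020f9403, 0x400a117803,
  0x400003c0a0080040f9803, 0x3c0a119803, 0x380a000402000c050f9c03, 0x80000340a0018040f9c03,
  0x80000100500040200180400300a0f9c03, 0x2409002c0a0004010f9c03, 0x406011818007c18015898,
  0xe40311a08b, 0xdc0300040c0310030f048b, 0xd812008c12000c1200040d015092, 0xdc00311a489,
  0xd7c03117c49, 0xd78030004040008080db049, 0x40511b88c, 0x40d034091, 0xfd0890dd403,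
  0xec040004080d88030dbc49, 0x34c91000405, 0x100e00040e0220060d908d, 0x3984b11d006, 0x3240b11cc06,
  0x3240f11a40a, 0x40003240f0008440dd80a, 0xddc0511e048, 0x80503240f00144800040a, 0x80911fc4c,
  0x3240f00080900040a036c4c, 0x22c0911f004, 0x11f405120808, 0x3780803184b002805000406, 0x491030c03,
  0x234090230020010060dcc04, 0x38491000403, 0x410000c0c001c510dcc03, 0x38c09122c05, 0x44c103001,
  0x44a000c050268060dd88d, 0x25c1101d81800700e02700500040b022410031405004c0b037c8d, 0xfe91411540e,
  0x11581311d40f, 0xfe8d411d80e, 0x40f0becd4000c1300080e, 0x41212080b, 0x40a123407, 0x406124403,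
  0x116c0311d847, 0x40a121c8b, 0x40e122ccf, 0x412125913, 0x41610495a, 0x125c00126c05,
  0x447105004035803109409, 0x11f815123410, 0x4030f1010047847093815, 0x9181500040a0f10100c108b,
  0x91c0e10a4d2, 0x80e0f14100004150014d2, 0x20190ac8950004110c2d16, 0x103958119c12, 0x11b01311a017,
  0x10391811b412, 0xc170c3d18000413000812, 0x41612380f, 0x40e12580b, 0x40a129007, 0x11b80211c045,
  0x412105958, 0x15813007045000817002002, 0x105918015c12, 0x413000c170008120c5d18,
  0x70450020020004160df00f, 0x40e0070450020020ef40b, 0x704500200200040a10d407, 0x10755811d412,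
  0x11d81711e813, 0x10751811ec12, 0xc170c7918000413000812, 0x41612700f, 0x40e128c0b, 0x40a12c807,
  0x11fc4411f000, 0x412109558, 0x81701881300ac44002000, 0x18c12109518, 0x413000c170008120c9918,
  0xac440004160020000e280f, 0xac4400200000040e0f2c0b, 0x40a00200000ac44110c07, 0x10b158120c12,
  0x121017122013, 0x10b118122412, 0xc170cb518000413000812, 0x41612a80f, 0x40e12d40b, 0x40a130007,
  0x122802122c05, 0x10d158000412, 0x1b813005c05000817002002, 0x1bc1210d118,
  0x413000c170008120cd518, 0x416005c050020020e600f, 0x200200040e005c050f640b,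
  0x40a005c05002002114407, 0x124800125004, 0x10f158000412, 0xb80400081700400001d013, 0x1d41210f118,
  0x413000c170cf518000812, 0xb8040040000004160e7c0f, 0xb80400400000040e0f900b,
  0xb80400400000040a116007, 0x132c47132006, 0x40a13588b, 0x40e1148d2, 0x11904a133006,
  0x40d01004a0cc8080d0406, 0xc110bb40d0004090d188e, 0x4980fa00a,
  0xb80400200200040b004000007c05117c07, 0xc98068401, 0x80100040b00fc18114401, 0x5800d117001,
  0xb480a00040305780d114c01, 0xbe4d5000406, 0xb1ccf10bc06, 0xb14cf10bc06, 0x40c0008100b2ccf10bc06,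
  0x7588a11c406, 0x7408a11bc06, 0x80c00040807408a11bc06, 0x9dc11137c0c, 0x40913a804,
  0x12e01112dc12, 0x12bc1412e018, 0x41200081809ec11, 0x13480612e809, 0x12c809134406,
  0xaa806000818000414001009, 0x12f809135006, 0xa00090d2006000418, 0xab806001412000811002009,
  0x12dc12135411, 0x135809136806, 0x1c120008090ab806000411, 0x1c120010180028090014110004140ab806,
  0x41513e004, 0x13b80d13e809, 0xac41500040c, 0x13980913bc06, 0x13c80913c406,
  0x1148060008100dfc0900040c, 0x40d13f804, 0xad406001c05000405001406005405, 0x131c16139015,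
  0x130815130c16, 0x13241813101c, 0x139c1813101c, 0x816001018000415000c1c, 0x4190d6c11,
  0xa201513e410, 0x40d141808, 0x132016131c15, 0x13241c131c18, 0x4160a301500081c, 0x13340a132c0d,
  0x13280d134c0a, 0x2c0a00081c00041800100d, 0x13340d133c0a, 0x300a0a440d00041c,
  0x200d001416003c0a000815, 0x13bc15133c16, 0x40d00480a03a415001816,
  0xc1c003c0a00181600101500240d000418, 0x419144c08, 0x141c1114240d, 0x4819000410, 0x14040d13f00a,
  0x14280a142c0d, 0x8140004100e5c0d0dbc0a, 0x411146408, 0x140a001c0900040900580a005009,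
  0xcc470a3c1500580311a810, 0x580300cc4700040d129408, 0x138003140847, 0x41c022c180074030b6447,
  0x138403140c47, 0x41c0b68470078030b5818, 0x10160b7447000815008403, 0xb60150b6c47008c03023c16,
  0x1416000c1500081c0004180b6c47008003, 0xb6c470004190080030de411, 0x13c847139803, 0x13980313d047,
  0xf447008003000415000816, 0x139c0313b047, 0xf84700101c000418008403,
  0x8403000c1c00f8470a7815000416, 0x380a00f84700840300180d, 0x2640a00f84700840300100d,
  0xf84700081c00840300041800100d003c0a, 0x200d003c0a00f847008403, 0xf8470084030b8c0a0a8c0d00041c,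
  0x3c0a00240d00840300141600f847000815, 0x24160084030a9c1500f847, 0x4280300f8470ba00a0aa00d,
  0x41500080d00440a001c1600880300f847, 0x418001c1600440a00880300280d00f84700141500101c,
  0x41900880300f84712f808, 0xf847008803121c0d117c11, 0x880300f847005019000410,
  0xe380a0088030ec80d00f847, 0x11880a12200d00f847008803, 0x88030e3c0a00f8470008140ecc0d000410,
  0x41100880300f847131008, 0x880300f84700140a008009001c0900600a000409, 0xb300914f804,
  0x1281414fc04, 0x14c806148009, 0x410150404, 0x1005000405000c050e6006, 0xb140d150808,
  0x14840d14980a, 0x414151008, 0x409047009000c090c000a, 0xae80d002447001003133c08,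
  0x2447005418047803134008, 0x24470af40d0bf40a001403, 0x1403002447000414134808,
  0x2447001403001009000409000c090bf80a, 0x15300414b409, 0x40514c806, 0x15340814b00d, 0x40914cc0a,
  0x10470008030b140d136008, 0x10470004090008030c180a, 0x40615188b, 0x14cc09154c04, 0x405151806,
  0x14c80d155008, 0x40914e00a, 0x137c080010470008030b2c0d, 0x4090008030010470c300a, 0x40615388b,
  0x2018000414003c0612bc8b, 0xc6011131808, 0x18410157004, 0x1840c157404, 0xe7c0500080500040512cc06,
  0x12014157808, 0x12010157c08, 0xf2c090008090004090edc0a, 0xf680d0e8c470f300313a808,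
  0x1c4700a81400100313ac08, 0xa810001003001c4713b008, 0x809000c09001c470010030004090ee40a,
  0xe8405156806, 0xf400915300a, 0xe8c470f440313c0080f840d, 0xc470004090008030ef80a, 0x40615ac8b,
  0xe8405158006, 0xf4c0915780a, 0xe0c0900040300084712540a, 0x40615b48b, 0x41000141400280613e08b,
  0xc744a00cc0600581500041100548b, 0x12f40615a08b, 0x800e15cccf, 0x680e15c8cf,
  0x81800041400680e13f4cf, 0x14000615b88a, 0x40915c08d, 0x40c132895, 0x130c0615c88b,
  0x40c002010130c06132c8b, 0x280e000c4f001815000451132ccf, 0xb600515cc88, 0x40915d88c, 0x40d141891,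
  0x12300513ec89, 0x40a11700310d409107c05, 0x12c851000c0e00040611ac8d, 0x7e409160404,
  0x7e00d160408, 0x40307dc0d000847142c08, 0x4060bbc06001093142c06, 0x143c49160804, 0x143c0915fc04,
  0x403143809000807140004, 0x144c0615d8cd, 0x144406157c8d, 0x40800080c1444060b308d, 0x409162114,
  0x412145959, 0x1460061624cd, 0x14580615f48d, 0x40814580600080c12808d, 0x409162514, 0x412146919,
  0x147406126ccd, 0xb248d146c06, 0x80c0004080b208d146c06, 0x409002817001413143914,
  0x1413002817000412147519, 0x1488061654cd, 0x14800616508d, 0x80c00040814800614788d, 0x4091670d4,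
  0x14980616548d, 0x14900616508d, 0x80c14900600040814708d, 0x409167c94, 0x14648d14a806,
  0x145c8d14a006, 0x80c000408145c8d14a006, 0x200f00040900100b14b494, 0xa808d14b806, 0xa7c8d14b006,
  0x80c0004080a708d14b006, 0x40900401600100e12f494, 0x158c0e159011, 0x158c1115880e, 0x161044159000,
  0x160044159000, 0x811000c000bb84400040e, 0x15941115900e, 0x15980015a804, 0x15a804159800,
  0x2004000c0000040e000811, 0x244a169c03, 0x15b806163045, 0x45516a403, 0x15bc06162445, 0x45216ac03,
  0x1406000c060004060be089, 0x284a16c003, 0x15c80515c006, 0x45516c803, 0x15c40615cc05, 0x45216d003,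
  0x406000c06001406004c49, 0x180400300800344a143803, 0x3004004006005005001800,
  0x1804000455003008144003, 0x3004004406005405001800, 0x3008000452001804144803,
  0xc06001406003008001804000406005849, 0x15fc4a16e403, 0x406167889, 0x15f44a16f803, 0x406160049,
  0x80400644a001008146003, 0x804001008000406007849, 0x40516dccc, 0x17000316144a, 0x406168089,
  0x160c4a171403, 0x406161849, 0x1008147c03000804007c4a, 0x406001008000804009049, 0x40516f4cc,
  0x3c050020150004121334cc, 0x240d173510, 0xc0d173510, 0xc0d000815000412155d10, 0x157959000411,
  0x16941116c40e, 0x16a81116c40e, 0x8a4110cfc0e0004000c4c44, 0x16c80e169c11,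
  0x10040d000e000400083c11, 0x144a174403, 0x16cc4516ac06, 0x455174c03, 0xc060004060d08120c6489,
  0x184a176003, 0x16b80616cc05, 0x455176803, 0xd1012000c06000406002c49, 0x200800244a00100414d003,
  0x8d405002004001000086406, 0x100400045500200814d803, 0xd1812001004000c06000406002008003849,
  0x16d84a177403, 0x40616fc89, 0x17880316dc4a, 0x40616f449, 0x8804a00080414f003001008,
  0x40600100800080408f449, 0x4051764cc, 0x20050d3412000415139ccc, 0x80d179910,
  0x4150d381200080d15b510, 0x41115e519, 0x17040f16b813, 0x16b81317380f, 0x40e00780f000811013013,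
  0x17200f16bc13, 0x17400f16bc13, 0x81100040e00800f013813, 0x13813000c000d204409240f,
  0x138130cb8440d800f000c00, 0xc0000880f00081100040e0cb844013813, 0x17240f16cc13, 0x16cc1317540f,
  0x900f00040e000811014013, 0x300408cc0f014013000c00, 0xd940f003004000c00014013,
  0x1401300081100040e00980f003004000c00, 0x344a17dc03, 0x140130040060d484500980f, 0x45517e403,
  0x17c845177c06, 0x40f0ce845004806014413, 0x45217f003, 0xa4130018060010060004060144170cec89,
  0x2c4a180403, 0x500500a40f014413003806, 0x455180c03, 0x179405179006, 0x40f004006014813005805,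
  0x452181803, 0x100601481700040600180600b013005c49, 0x3c4a003808001c04158003,
  0x14813001c0000480600600500b00f003804, 0x1c04003808000455158803, 0xde0060de405001c00003804,
  0x1c0000040f014c13005006006805003804, 0x3808001c04000452159403,
  0x14c17001c0400180600040600100600bc13003808006c49, 0x16001181088, 0xcc01180c88,
  0x81300040f002001143488, 0x15bc031438d5, 0xeac03143cd5, 0x15b005186c09, 0x4031444d5,
  0x15b80515cc0c, 0x80c00100c00340500185500040300140c, 0x17c01183088, 0x3801186c88,
  0x81300040f00380114a488, 0x14a8d215e003, 0xed00314acd2, 0x240314b0d2,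
  0x80c00440500105200040c000c0c002003, 0xe0130154170004060020060044051468cc, 0xd44a187403,
  0x4060100130190170de089, 0xb84a188803, 0x1001300040601901700d449, 0xb44a00100800080415f003,
  0x40601001300080400100801901700d049, 0x4050100130190171488cc, 0x1701700040d00fc13169110,
  0xf04a189403, 0xe50130004060194170d9489, 0xd44a18a803, 0x4060e501301941700f049,
  0x100800d04a000804161003, 0xe501300100800040600080401941700ec49, 0xe501301941700040514f4cc,
  0x40d018c170e501316a910, 0x11c1300440d000412002415018c1716a910, 0x18c1716f919011c13000411,
  0x189014181818, 0x18101817c014, 0x18140e18f113, 0x17c80e18ed13, 0x414171913000c0e000818,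
  0xc12182c11, 0xc1218a811, 0x414000c12000818001c11, 0x41518ac10, 0x40d18dc0c, 0x409191008,
  0x405190400, 0x401170401173805, 0x17ec1c189018, 0x17ec1c17e818, 0x19255717f012, 0x19215717f012,
  0xc1200081c174d57000418, 0xc16180015, 0xc1618a815, 0xc1600081c000418001c15, 0x41918dc14,
  0x411190410, 0x40d19400c, 0x409192804, 0x405168c05176809, 0x182003188047,
  0x41c006c470038030f2818, 0x182403187c47, 0x182403183047, 0x400300041800081c007447, 0xc12196557,
  0xc12196157, 0xc1200081c000418178d57, 0x4003007447000c16002015, 0x4003000c160074470f4815,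
  0x400300041800081c000c16007447002415, 0x7447004003000419135814, 0x41100400300744716b010,
  0x744700400300040d17a80c, 0x409007447004003176804, 0x40516a80517a009004003007447, 0x15cc05198088,
  0x40917b48d, 0x7980917b44d, 0xc0b156405079c07177c48, 0xc0b00080700040917b44d, 0x17c405199401,
  0x17bc09000447101003178805, 0x9c806179801, 0x197810194011, 0x13981100040309d04716ec10,
  0x80a16f805, 0x40300104716d80500080a, 0x406001916, 0x13580617b001, 0xbc80a170805,
  0x84700040316e8050bc00a, 0x406002916, 0x4140014140034d6101c06, 0x28c1119c954, 0x41517fd59,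
  0x2201119c114, 0x180119000415, 0x12c1100101700081317c914, 0x813180119001017000415, 0x3440519a488,
  0x40919e510, 0x3480519a888, 0xc1100040e03480515e888, 0x80919ecd0, 0x40e0010110008091814d0,
  0x40d182915, 0xb480919ecd0, 0x2ac050b340e0b4c1115f088, 0xb380919f0d0, 0xc1100080900040e1810d0,
  0x40d1838d5, 0x23c050030130b5c0f15f088, 0x40900180f0030131804d0, 0x240050030130b4c0f164488,
  0x1c0f00040e000c1100301302400515f888, 0x1c0f000809003013180cd0,
  0x809001c0f00040e003013001011180cd0, 0x1c0f00301300040d184cd5, 0xec4d60b2c03, 0xec8d60b2403,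
  0x80c00040c000c5615e803, 0x11a44a1a4803, 0x908041a3889, 0x40a17acd5, 0x1590041a3089, 0x40a179c95,
  0x156c0109180f15980b16e445, 0x404000c0b00140f183c89, 0xc0b00140f17849500040a, 0x1a58031a2406,
  0x1a080a1a5807, 0x845092c0a182807000401, 0x40417d0d5, 0x13d845139c0118300715b40a, 0x17c095000404,
  0x1708061a7003, 0x15940a1a7007, 0x2c0a000845000401184007, 0x180f00100b00040417ac95,
  0x1848041a9049, 0x80e00300e004c49000407, 0x4061690d2143c4a, 0xa380a1a88ce, 0x40d1a9111,
  0x410180119, 0x17ec0d185404, 0x14900d11a00313f80e17fc47, 0x17e80d18044711a00317480e,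
  0x11a00300081413fc0e00041014940d17f847, 0x54403001047000411145c08, 0x1898ce0a580a,
  0x14648e00201300040d18a0d1, 0x2013000c8e00041017e4d9, 0x18244d18d804, 0x12680300040717ec0d18a404,
  0x182c91130809, 0x181851130809, 0x40700080b17f851130809, 0x16d5161aa003, 0x1900d10fe409,
  0x1900910fcc09, 0x80f00040b0fb40918fc91, 0x4961ae003, 0x4080014100018920c5403, 0x1ad8881a4400,
  0x1ab0481a9000, 0x9d000000809173048000406, 0x40a1920d1, 0x132c0a18a890, 0x17184a1adc03,
  0x13380b16140000140f171c48, 0x40a1580000008080c8003, 0x100b00140f00040614b890,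
  0x496002c08003c100c7c03, 0x187891170800, 0x186451170000, 0x80b00040718445116f000, 0x19f4111a200e,
  0x19f4111a1c0e, 0x7040e00041800081c021011, 0xc031afccf, 0xc031b04cf, 0xc0300081c0004181888cf,
  0xc121b4157, 0xc121b3d57, 0xc1200081c000418196957, 0x1a401c1abc18, 0x1a440e1a2011,
  0x1ac8111ac40e, 0x81c000418023c11000c0e, 0xc031b2d13, 0xc031b6113, 0x418000c0300081c18cd13,
  0x15448e1a3803, 0x189c8e1ae003, 0x15488e00081c000418025403, 0x1812000c1118a4d2,
  0x116803000c11199cd2, 0x181200041800081c000c1118a8d2, 0x4016000c1519a516, 0x4016000c15199d16,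
  0x81c004016000418000c15199d16, 0x19608e1b8003, 0x819006c9200a408000408,
  0xd040319680013b807193408, 0x19388e1b5c03, 0x88e0010080004100d0003,
  0xb00900100900880900d4d2000409, 0x1330cf18f40d, 0x18f80d1988d1, 0x18fc0d1b9d11, 0x410190d19,
  0x101000041318d4d9000c10, 0x1b70061b9403, 0x4ce1b840a, 0x12b00a1ba915, 0x41100080d19cd11,
  0x41019e959, 0x197cce1b940a, 0x12c00a1ba915, 0x41100080d19c511, 0x19f519000410, 0x17ec061bb803,
  0x4ce1ba80a, 0x19b91512d40a, 0x41100141300241700080d19b111, 0x14130024170004101a0119,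
  0x4161bc405, 0x408004012199808, 0x188061954d5, 0x18406194095, 0x40b00080f017806192095,
  0xfa08a1bf803, 0x1964d51ba40a, 0x1950951bc40a, 0x19309500040b00080f17200a, 0x40e1c0007,
  0x44a1bec03, 0x405001c5200180919c003, 0x19c4081be80d, 0x1c148b1c1803, 0x19e04b18480519cc03000409,
  0xc03000408019c4b0bc80d, 0x18291600040a, 0x176c4a012c0516f80919d803, 0x1bf04a1c0c03,
  0x17200919e00317784a000405, 0x40819ecd0, 0x19fc4a19e80312bc05171809, 0x40819ec90,
  0x40b000c0f00180815f090, 0x1b85000b00d005c03002010003408018c1200040e, 0x13244a1a5401,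
  0x83c0a1a4001, 0x80700040307c00a1a1c01, 0x7e00a1bec8b, 0x7e00a00041c0a081815b48b, 0x7e00a1bf88b,
  0x41c07e00a13141816608b, 0x101607e00a00081513648b, 0xa181607e00a131c1513648b,
  0x81c07e00a000c1500141600041813648b, 0x158401136899, 0xf8401136c99, 0x40b00080b000c191a4401,
  0x1590011aa491, 0x15dc0a190c101aa88b144414, 0x1a7801000411, 0x403000c0b15d4111a5401,
  0x3c0600140600040613808b, 0x13440e1c98cf, 0x13440e1c94cf, 0x1c30061c6c47,
  0x9481015f80619f447000414, 0x1c70471c3c06, 0x40d000c0e13a4061a0047, 0x1c7c061cb047,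
  0x40d09580e13a8061a0c47, 0x10141a044700081016b006, 0x13ac0600101400081000180e00040d1a0447,
  0x640e1c8ccf, 0xa681800640e00041c1a14cf, 0x640e1c90cf, 0x41c00640e0034181a18cf,
  0x81500101600640e1a24cf, 0x3c150a781600640e1a2ccf, 0x81c00141600640e000c150004181a20cf,
  0x15f44a1cc003, 0x249915ec01, 0x1c840e1ca00b, 0x19200b18200e000402160045, 0x80a1ccc03,
  0x40200140500080a1aec03, 0x1ca80b1c900e, 0x192c0b182c0e000400161044, 0x80a1cd803,
  0x40000080a0024041af803, 0x1cc40b1c9c0e, 0x18380e00040219380b001405, 0x280418380e00080019480b,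
  0x18380e000402002804001805193c0b000800, 0x100a1d0803, 0x402001c0500100a1b0c03,
  0x80000100a0030041b0c03, 0x200500080000300400040200100a1b0c03, 0x4011a6cd9,
  0x40f00480b0050191aec01, 0x1d2c061d0447, 0x1d14471d2806, 0x4081a784700080c1b5406, 0x16800e1d10cf,
  0x19d40e1d20cf, 0x16840e0004100008141a84cf, 0x165001001091, 0x17540100040b0008111b0c01,
  0xb80e0024060004061a8ccf, 0x1ab0d51ce80a, 0x14000e1d5913, 0x14000e1d5513,
  0x41400081814000e1b8113, 0x8c80a144c8b00ec1916a411, 0x1080e1d6513, 0xb100e1d6113,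
  0x81c010c0e0004181b8d13, 0x10c0e1d4513, 0x41c010c0e0020181ae113, 0x10c0e0008150014161ae113,
  0x2815001416010c0e1ae113, 0x141600041800081c010c0e000c151ae113, 0x16cc0e1d6513, 0x1a200e1d7d13,
  0x81416d00e0004101b7d13, 0x300e0010190004111aed13, 0x18e09116a001, 0x18e49110a001,
  0x80b00040b000c121b6001, 0x184c061d5049, 0x4051d7c90, 0x11f04f1d8c03, 0x406184806000c0b198049,
  0x405000c0b0790d2, 0x1da8011d8805, 0x1b9c050004470da0031aec09, 0x4061b608e, 0x1b280c1db401,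
  0x1b18101da805, 0x8470004031af4101bac05, 0x1c0e11a0050010101a2450000406, 0x1bf5151cf40e,
  0x1bf4d51d740e, 0x1d780f1cfc13, 0x1bf4d5000c1300080f00040e, 0x4121d9c0b, 0x40a1dd407,
  0x44a1dc003, 0x4060020511b9006, 0x1d4c091da40a, 0x1a280a122c44136409000400, 0x4051dd090,
  0x1d1c121d980f, 0x1d680f1ce412, 0x1d6c091da00a, 0x1cec091d280a, 0x80f00100a000c09000412,
  0x200b135009000413191c0a, 0x1dcc0b1d680e, 0x1d6c051db006, 0x200019500f0118440cbc12,
  0x13bc0f002000000c44077412, 0x1c48d1000c00, 0x2400195c0a12704413c409,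
  0x40f000c0900100a000852002000, 0x19380a000413136c09002000003c0b125844, 0x405003c0b0814d2,
  0x1a94d20dd80a, 0xe28031be08e, 0x1c38051b9410, 0x340e1e2003, 0x180e1250040004001c4003,
  0x180e000405001010001410000c03, 0x1c60051e2449, 0x1c28050e40030004071b8809, 0x4061bfc8e,
  0x1c6c051bc450, 0x4070020031b8c101c3405, 0x1c89151d480e, 0x1c88d51dd00e,
  0x1c84d500081300040f06940e, 0x4121a440a, 0x30060004091c4c06, 0x7cc0e1c9d15, 0x1c9cd514180e,
  0x81300040f069c0e1c98d5, 0x1400126c440004121a500a, 0x1400004006125c040004091c5c06,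
  0x34100004050040061ae450002c06, 0x1cb5151dac0e, 0x1cb4d51e2c0e, 0x40f1cb0d50008130c5c0e,
  0x4121e5c0b, 0x40a1e8807, 0x1cc9150d300e, 0x1cc8d519d40e, 0xc700000d4040d381319d80f,
  0xc1300080f1cc8d500040e, 0xd4040004120018001af00b, 0xd40400040a0018001cc007, 0x1c4a1ea003,
  0xd80800040400084a1c0403, 0x1944061e2009, 0x4051ea090, 0xc80f1ea803, 0x194406000406000c0b141009,
  0x40508b4d2000c0b, 0x1eac491ec405, 0xec0031cb4051c1009000407, 0x4061c848e, 0x1c4c501ed005,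
  0x1c3c101ec405, 0x8070004031c18101cc405, 0x1010001c0e007c051b4850000406, 0x38060004511cd806,
  0x404003806010c08006c511c1806, 0x1eb4881de400, 0x4091ef510, 0x1eb8881de800,
  0x1af88800040e000c11086400, 0x8091efcd0, 0x101100080900040e1d24d0, 0x1d391500040d,
  0x1e64001ec888, 0x4091f00d0, 0x1f0c881e8800, 0xc1100040e1b088807c800, 0x8091f08d0,
  0x101100040e0008091d28d0, 0x1d50d500040d, 0x38130760001b0888001c0f, 0x1c0f0038130004091d1cd0,
  0x38131b5c88076400001c0f, 0x3813001c0f00040e1b1088076400000c11, 0x809003813001c0f1d24d0,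
  0x80900101100381300040e001c0f1d24d0, 0x1d64d5003813001c0f00040d, 0x13dcd61ac803, 0x1e3c091f4910,
  0x1f48d01e3c09, 0x1d70d000081100040e08b809, 0x1d851500040d, 0x1eb0091f48d0, 0x1f48d01ed009,
  0x1d68d000040e000811081009, 0x40d1d90d5, 0x1d58d000100f00201307a009, 0x201307a00900100f1d58d0,
  0x100f00040e0008111d58d000201307a009, 0x100f1d98d500201300040d, 0x4561b3403,
  0x380c000404003c56179803, 0xc121d6406, 0x1cc44a1b1003, 0x40d1f8512, 0x4111f8d55, 0x4141dc159,
  0x100d1f8112, 0x4111f8915, 0x1dc919000414, 0x1c0d1d8d12, 0xc130018170004111d9515,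
  0xc130018170004141dcd19, 0x1b68031d904a, 0x816003804003044000404, 0x1b38031d644a,
  0x4344a000c0400040c17d403, 0xc0500400514504c000405, 0x1d38051fc000, 0x1d1c091fb404,
  0x4031d04090008471db804, 0x1ea01c1f6018, 0x4151fa010, 0x1f30471ea803, 0x13744716a818000c0300041c,
  0x123047000c030004151c8410, 0xc0a1f908b, 0x169018000c0a00041c19e48b, 0x415000c0a19988b1c8c10,
  0xc0e1d2cd2, 0x41c0d8018000c0e1d2cd2, 0x4151c9410000c0e002cd2, 0x1fd8051ff800,
  0x1d3c091dec04119403000447, 0x1ed4151fd010, 0x30151238471cac10000403, 0x28151cac1000040a19b48b,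
  0x1cac100010d200201500040e, 0x34c120004111e4516, 0x34c120da0111e3d16,
  0x34c1200041800081c0024111e3d16, 0x1d5c4a1fcc06, 0x1d5c4a0004140cc4101a2006,
  0x5c4a00040d198c0819d406, 0x199008000c0d002c4a19d406, 0x38c0a0004091e608e, 0xcd00903880a1e588e,
  0x41000100900081403840a1e588e, 0x4991c700a, 0xd10000d4c050d88040cf00200040b1e4c07, 0xc99135401,
  0x40b000801002c191e1401, 0x2034d01fc009, 0x2030901fb809, 0x15a0091e009000080f00040b, 0xc0d20000a,
  0xc0d20200a, 0x40b00080f000c0d1b7c0a, 0x40e205c07, 0x406205003, 0x48a207403, 0x4061e1c4a1ea006,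
  0x205d141f400d, 0x2058d411580d, 0x1f4813115c0f, 0x40d1e2cd400080f000c13, 0x10110f200e,
  0x101120280e, 0x40f000c110008130e580e, 0x412204c0b, 0x40a208407, 0x44a208403, 0x4061e7c4a1e8806,
  0x14b4060004491e4c06, 0x208d581f6c11, 0x2089181f6c11, 0x1f74171f7013, 0x4110008131e5d18000c17,
  0x10151fcc12, 0x10151fe012, 0xc150008170004130dfc12, 0x416201c0f, 0x40e20800b, 0x40a20ac03,
  0x4061ca80a1eac06, 0x1f9c441f9800, 0x41120bd58, 0x1f9c00202044, 0x41120bd18,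
  0x6444001017000813003400, 0x8130010170004111e9118, 0x14150034000064440e1012,
  0x10150064440034000f9412, 0x817000413006444000c150034000e1012, 0x34000064440004161c300f,
  0x644400340000040e1d340b, 0x340000640400040a1efc03, 0x34000004061cd40a1edc06006404,
  0x3600e0038491ef006, 0x68080004041514060008491e3006, 0x151010000405151406009c50150806,
  0x1ee48e1e7c03, 0x1ee8d21e7403, 0x1eecd21eb00a, 0x40d00080d000c4d1f4c09, 0x1ef48e212006,
  0x409213005, 0x1f20031d6c0606cc00057c04, 0x890000401, 0x1f04d221080a, 0x40d213c09, 0x450184001,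
  0x6c800056c041d50061f3403, 0x80700140b002450000401, 0x2008214000, 0x140c213404,
  0x40300084700300c1f3804, 0xef002215006, 0x1f288e000403, 0x1d58cf1b480a, 0x1ef40a2158ce,
  0x40d500040c, 0xc1100040f0010d513640a, 0x1f14081180031614071f4801, 0x161849213006,
  0x118849216806, 0xc4900080b0004071d9006, 0x4d61eb406, 0x1f508e217c03, 0x1ebc0621608b,
  0x40d000891000c0d, 0x18240e1f5d5a, 0x4f8121f615a, 0x815000415000c5215181100748e003811,
  0x1304031ed0101fb80819b047, 0x244e217803, 0x3a0002184d0, 0x3b800218090,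
  0x3bc0b03a80f16ec091cb80a, 0x400000c0f00080b1f5490, 0x211000219088, 0x409219090,
  0x80b029c0f1f948816fc00, 0x40900080b02980f1f6490, 0x29c0d00200d00504806d00a,
  0x100d00200d00504819f80a, 0x40b001c0d00080f000c0d00504806c40a, 0x212c0921a890,
  0x1714091f789000040b026c0f, 0x2700d21740a, 0xc0d21900a, 0x80f00040b000c0d1cec0a, 0x40e21c003,
  0x400001c0e004808135c03, 0x4c8e1f2006, 0xc8e200c06, 0x810000408000c8e005806, 0x1fc51621bc0e,
  0x41121c80d, 0x41021f808, 0x1fd15a218812, 0x415190011, 0x41421dc0c, 0x1fdd5a18dc12,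
  0xc03001847000415076c11, 0xc030004140018471fa80c, 0x1fe95a18c412, 0x415000c0a00e48b1b6811,
  0xc0a00041400d48b18ac0c, 0x40e00bc1400901400345100d48e15740c, 0x1e684a1f70031ce80405f808,
  0x104d4000405, 0xf89418ac05, 0x1cd4041e444a0734081f7c03, 0xc0f00080b011894000405,
  0x40e00f84e00180d1f6005, 0x21781820f81c, 0x20f81821001c, 0x225157210412, 0x224d57210012,
  0xc1220795700081c000418, 0xc16210c15, 0xc16219015, 0x41800081c000c16001c15, 0x419221014,
  0x411221010, 0x40d22400c, 0x409226400, 0x401227808, 0x212c02214c06, 0x21f40621b002,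
  0x41809680600081c003c02, 0x215406213c02, 0x215406213802, 0x81c004402000418097006, 0xc12229557,
  0xc12229157, 0x418000c1200081c20bd57, 0x97006004402000c16002415, 0x97006004402000c16002415,
  0xc1600081c000418004402097006002415, 0x4190044020970061e2814, 0x44020970060004111e2810,
  0x40d0970060044021e280c, 0x1ffc0d229000, 0x809004802000406145000, 0x1e5c060004010048021eb408,
  0x9840d22b808, 0x40920e40920140d, 0x22748b219c06, 0x12a01809b40600041c1b8c8b, 0x21a00622508b,
  0x21a00622508b, 0x9bc0600041800081c190c8b, 0xc1222e157, 0xc1222dd57, 0x81c000418000c12210957,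
  0x190c8b09bc06000c16002015, 0xc1609bc06190c8b12c015, 0xc1609bc0600041800081c190c8b002415,
  0x419190c8b09bc061b8014, 0x411190c8b09bc061ba010, 0x190c8b003c0600040d1b7008,
  0x3c06000409190c8b1ba00d1b7009, 0x40a20f401, 0x9405212c0520f801,
  0x402202006000802204c060050051eb405, 0x21bc03222847, 0x40a22988b, 0x40e22dccf, 0x41222ed13,
  0x416231957, 0x41a21099e, 0x22ac14222819, 0xea81919f81400040310bc47, 0x6cc1900040a19d81415348b,
  0x66c1906981400040e1ccccf, 0x67012216116, 0x21211606a012, 0xc1200041400081910d516,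
  0x1b88d900201d0004151ced5a, 0x1c6006233c03, 0x6680a233c07, 0x40200084506680a216407,
  0x6600a234007, 0x6600a000400001044216807, 0x6580a234407, 0x6580a000c05000402216c07,
  0x80000180406580a216c07, 0x180406580a000402000800001005216c07, 0xffcdc000401, 0x1000dc065001,
  0x40f00080f00301c213801, 0x20c09523380a, 0x20a095062c0f00040b1e800a, 0x40e236807, 0x20e4d51eb00a,
  0x20d0951fc40a, 0x40b00080f20b0951e880a, 0x100007800400040e219807, 0x20f4d51ecc0a,
  0x20e0951fd00a, 0x40b00080f20c0951eac0a, 0x17404500040e07900221b407, 0x2104d523400a,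
  0x20f095235c0a, 0x20d09500080f00040b1eb80a, 0x40e239c07, 0x2114d51ee80a, 0x2100951fec0a,
  0x40b00080f20e0951ec40a, 0x40e17604400100021d007, 0x2124d51ef40a, 0x2110951ff80a,
  0x40b00080f20f0951ecc0a, 0x40e00200500500221dc07, 0x1efc0a2134d5, 0x20040a212095,
  0x40b00080f1ed40a210095, 0x200500500200040e00400400100021e407, 0x220c0600448e, 0x188e220406,
  0x40800080c000c8e220406, 0x17204a219c04, 0xfe01923b811, 0xf6419000403172447209411,
  0x7881900040a172c8b209411, 0x17308e07c008, 0x40b00144b00080e1dac08, 0x74c5521b404,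
  0x1d708a240403, 0x1d384a23e803, 0x9a04a00080900040521bc03, 0x4082160d9, 0x144b00040f0744191dc408,
  0x21d00423f006, 0x21cc0823e80a, 0x4030008471dd00820c40a, 0x40624248b, 0x40e2414cf,
  0x30060018060004111bc4cf, 0x22608e1e1006, 0x21640622208e, 0x16300600040c00081111d48e,
  0x105610b45100040d1decd2, 0x2238011c4c05, 0x1c4c09219005, 0x8470004032170051c4c09, 0x4061be113,
  0x1e4c0d24580c, 0x40921a005, 0x1e3c0d16084700080322880c, 0x138447000803000409218405,
  0x14880921ac05, 0x22940c21a00d156447148c03, 0x803139c47000409219005, 0x1bf513000406,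
  0x4100024140014061c0d13, 0x232416232015, 0x23281c232018, 0x23281c23b018, 0x23281623b415,
  0x815000c1600101c000418, 0x4191ac411, 0x409249004, 0x239c06234009, 0x233c0923b406,
  0x200910940600081c000418, 0x23480923a406, 0x41c10ec18109806002409, 0x300900141600081510a406,
  0x280910ac0600141610f415, 0x280910a00600081c001416000418000c15, 0x41924b404,
  0x4050028050fb01110a406, 0x236c1a23c419, 0x235c1923601a, 0x23642023741c, 0x23642023d01c,
  0x81a00041900101c000c20, 0x41d1bb815, 0x236819236c1a, 0x23702023681c, 0x23702023dc1c,
  0x23e01923701a, 0xc1a00081900102000041c, 0x41d1af015, 0x40d24e808, 0x23880d23900a,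
  0x23a40a23840d, 0x200d00340a00082000041c, 0x23900d23980a, 0x380a00240d00042010d41c,
  0x81900440a00300d00141a, 0x280d004c0a00141a10dc19, 0x280d000c1900400a00041c00141a000820,
  0x41d250c08, 0x28090004090ffc1500440a, 0x24204723b803, 0x2101c005803000420111447, 0x24244723bc03,
  0x5c0300042011184710ac1c, 0x680300081911244700101a, 0x2201a00700310b419112c47,
  0x6403112047000c1900141a00082000041c, 0x11204700640300041d1c0015, 0x23d00323e447, 0x23e04723cc03,
  0x41c00c447000820006803, 0x23d80323ec47, 0x6c0300042000c84710b01c, 0x81900d44700780300141a,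
  0xcc4700141a00700310b819, 0xc1900141a00700300041c00cc47000820, 0x700300cc4700041d1b2415,
  0x40d00700300cc47237c08, 0xcc4700280d00480a007003, 0x700300cc4702580a00280d,
  0xcc4700041c00082000280d004c0a007003, 0xcc4700280d004c0a007003,
  0x280d004c0a00042000700300cc4710c01c, 0x819004c0a00141a00cc4700280d007003,
  0x10c819004c0a00cc4700700300280d00141a, 0x41c00082000141a00cc47000c19007003004c0a00280d,
  0xcc4700041d00700323a008, 0xcc4700280900040900700310581500500a, 0x25880424b809, 0x405251c06,
  0x258c0824900d, 0x409249c0a, 0x104711000d23b808000803, 0x80300040900104711240a, 0x40625348b,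
  0x1c8015239c00, 0x480625388b, 0x480625348b, 0x480600041c0008201c988b, 0x480625408b,
  0x110806254c8b, 0x82000041c004c061ca08b, 0xc1900181a004c061cac8b, 0x4c0600181a000c191ca48b,
  0x181a004c0600082000041c000c191ca48b, 0xf5c081ca89d, 0x23f00625c88a, 0x4081cb09d, 0x23f80623d08b,
  0x80b00141d00100b005c0600388b000408, 0x5c060004091078151cb88b, 0x440e25b4cf, 0x1600925e804,
  0x1501625ec04, 0x14c1525f004, 0x14c1c25f404, 0x14c1825f804, 0xc0500100500040500080500140511ec06,
  0x11c0d25fc08, 0x10c1a260008, 0x10819260408, 0x10820260808, 0x1081c260c08,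
  0x409000809001409000c0900100901480a, 0xc40d003047001803243808, 0xb41a001803003047243c08,
  0x180300b019003047244008, 0x180300b020003047244408, 0x304700180300b01c244808,
  0x3047001409001009001803000809000c0900040900fc0a, 0x1b409263004, 0x1a01c263404, 0x1a018263804,
  0x805000405000c05123406, 0x1680d263c08, 0x15420264008, 0x1541c264408, 0x409000809000c0901880a,
  0x204700100301100d247008, 0xf420002047001003247408, 0x100300204700f41c247808,
  0x1003000809002047000c0900040901400a, 0x250c09266004, 0x405256c06, 0x26640825000d, 0x409250c0a,
  0x24900800080301380d001047, 0x409001047000803015c0a, 0x40626088b, 0x267c04252009, 0x405259c06,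
  0x25140d268008, 0x40925380a, 0x24ac0801500d001047000803, 0x40900080300104703840a, 0x406261c8b,
  0x3c0600041c0020201d808b, 0x21c09269c04, 0x2001c26a004, 0x405000805011818129806, 0x1cc0d26a408,
  0x1b02026a808, 0x11c1c00080900040901e80a, 0x1847016c0d000c0324d408, 0x1847000c03014c2024d808,
  0x1201c000c0300080900184700040901980a, 0x25680926c004, 0x40525c806, 0x26c408255c0d, 0x40925680a,
  0x24f008018c0d000803001047, 0x40900104700080301b40a, 0x40626648b, 0x13c1c0020060004201dc08b,
  0x2680926e004, 0x801600040500201512e006, 0x2140d26e408, 0x801a002019000409022c0a,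
  0x80300104701a40d251008, 0x201900080300801a00040900104701cc0a, 0x40600801a0020191de48b,
  0x2780926fc04, 0x405017415008016130006, 0x2240d270008, 0x801a000409017419024c0a,
  0x1bc0d001047000803252c08, 0x40900104701741900801a00080301e40a, 0x1741900040600801a1df48b,
  0x801a00ec0600041c003c190020201df48b, 0xa40e26b0cf, 0x8c0e26e8cf, 0x8c0e00041c000820207ccf,
  0x500e26c0cf, 0x42000500e01481c2128cf, 0x141a00380e0008191e2ccf, 0x200e00141a0150191e2ccf,
  0x41c00141a00082000200e000c191e2ccf, 0x15c0e00041d116c151e2ccf, 0x15c12274513, 0x2812271513,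
  0x2812271d13, 0x82000041c00281224a113, 0x2812271d13, 0x141c00281200042024a513,
  0x81900281200141a24b113, 0x1c1900281200141a24b913, 0x141a00281200041c000820000c1924ad13,
  0x119c12274113, 0x119c12275113, 0x119c1200081800041424b513, 0x341200101d00041524b513,
  0x256801274406, 0x24c005270c0a, 0x24a00500040300084720d00a, 0x4062788cf, 0x23855a00040e,
  0x257c01275c06, 0x24d40527540a, 0x84700040324b40524300a, 0x4062794cf, 0x23511a00040e,
  0x24f006259001, 0x20f80a24e805, 0x40300084724c80520f40a, 0x40600141000281425d0cf,
  0x281400141023751a00040e, 0x4044a259806, 0x1bc406000449255c06, 0x251d1926440e, 0x2508d927140e,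
  0x264c1327180f, 0xc1324ecd900080f00040e, 0x41227840b, 0x40a25a806, 0x265c00277044,
  0x25391900040e, 0x2524d91ce00e, 0x1ce40f22ec44000c13001c00, 0x80f000c132508d900040e,
  0x412043844001c0024280b, 0x380400040a001c0025c006, 0x1bf80600204925d406,
  0x1bf806000404003c08000849251406, 0x4051bf8061bf410145c501bec06, 0x26801c272c18, 0x40927fc04,
  0x26cc06268809, 0x41c280404, 0x144418280804, 0x1005000405000805083806, 0x27141c269420,
  0x26942027101c, 0x40d281408, 0x269c0d26a00a, 0x420281c08, 0x13ec1c282008,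
  0x100900040900080900180a, 0x26b00326f847, 0x200313b01c000420085c47, 0x26bc4726b403,
  0x2403139c1c004047000420, 0x240300040d004047265c08, 0x140a004047000c0d002403,
  0x2403004047000420266408, 0x138c1c004047002403266808, 0x1009002403004047000809000409001c0a,
  0x26d809285004, 0x405272006, 0x26d80d285408, 0x40926e00a, 0x268008000803002c0d001047,
  0x40900080300104700380a, 0x40627bc8b, 0x286c0427a009, 0x40527fc06, 0x27700d287008, 0x409277c0a,
  0x1047000803269c0813e00d, 0x40900104700080314000a, 0x406281c8b, 0x2020003c0600041c1c1c8b,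
  0x240e2834cf, 0xc0e285ccf, 0xc0e00082000041c228ccf, 0x25d116000c12, 0xc1226c916,
  0x82000041c000c1225d516, 0x14c16000c1926d15a, 0x14c16000c1926c95a, 0xc1900041c000820014c1626c95a,
  0x13cc0628b8cf, 0x13cc0628b4cf, 0x81400041013cc0626e0cf, 0x125c0826e4d1, 0x26e00628ac8a,
  0x40826ecd1, 0x26d88f26e806, 0x80f00141100100f13dc060004081c688f, 0x26b916130412,
  0x281d0008da1c3cd41c6d5a000414, 0x27048e26104a01580e, 0x26c48e1f2006, 0x16788e00040c0008110f1c06,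
  0x40d205916, 0x276000283844, 0x276000276804, 0x276c4a28cc03, 0x406284489, 0x276c4a28e003,
  0x406277449, 0x144a000804001008264803, 0x804000406001008001c49, 0x4052868cc, 0x40d28c110,
  0x41128f154, 0x41528fd58, 0x419273d5d, 0x27115511d411, 0x28d40728780e, 0x28840b280c12,
  0x4001280121e9c0b000844, 0x281c1228900b, 0x44a290c03, 0x4061e9c0f120c16001489, 0x28181228940b,
  0x44a292403, 0x1ea00f121016000406001c49, 0x1eb40b000c00001804128c12, 0xc0400180800044a269003,
  0x121416000c041ea40f000406001808002449, 0x1214161ea40f00040523d4cc, 0x1ea40f120c1600040d2404d0,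
  0x1ea40f003c162430d5000411, 0x26791600441a000412250959, 0x27ec4427cc00, 0x27d40427cc00,
  0x29440327d84a, 0x40627f889, 0x27d84a295803, 0x40627e049, 0x80400144a26c003001008,
  0x1008000804000406001c49, 0x4052920cc, 0x40d294910, 0x411279555, 0x28180e294007, 0x28f00b27fc12,
  0x34120004000008441f080b, 0x28fc0b280812, 0x44a297803, 0x4060034161f080f001489, 0x29000b280c12,
  0x44a299003, 0x1f0c0f003816000406001c49, 0x18041f200b004c12000c00, 0x180800044a000c0426fc03,
  0x1f100f003c16001808000c04000406002449, 0x3c160004051f100f244ccc, 0x1f100f003c1600040d2480d0,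
  0x24acd5003c161f100f000411, 0x41227f19d, 0x741227f15d, 0x28401728c013, 0x28bc13284017,
  0x21844007817000400133013, 0x28441728bc13, 0x400001004007c17132813, 0x144a29c003,
  0x7c1b12c017000406022889, 0x104a29d403, 0x406007c1b12c017001c49, 0x80400100800144a273c03,
  0x12c017007c1b000406001008000804002049, 0x40512c017007c1b250ccc, 0x12b81700040d007c1b269110,
  0x27d15500e817007c1b000411, 0x2480e29bc07, 0x3812296c0b, 0x8440004000038121f840b, 0x441229780b,
  0x44a29f403, 0x4060034160014891f840f, 0x4412297c0b, 0x44a2a0c03, 0x38160004061f880f001c49,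
  0xc00001804004c121f9c0b, 0x1808000c0400044a277803, 0x406003c16001808000c040024491f8c0f,
  0x3c160004051f8c0f24b0cc, 0x40d003c161f8c0f24dcd0, 0x3c162508d50004111f8c0f,
  0x7c1b00781700041228615d, 0x26e80a2a48cf, 0x278c0a2a30cf, 0x21180a2a28cf, 0x4112a4956,
  0x4152a5199, 0x41828859d, 0x23b40a2a68cf, 0x414001c1023b40a288ccf, 0xc1b286d5b000411,
  0x28d02029381c, 0x28d02028cc1c, 0x2a7d9b28d416, 0x2a799b28d416, 0x82028a59b000c1600041c,
  0xc1a28e419, 0xc1a295019, 0xc1a00041c000820001c19, 0x41d2a1818, 0x415218c14, 0x4112a680c,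
  0x40d23f01127ec0d, 0x290003297447, 0x34030004200ac41c118c47, 0x290403297847, 0x297847290403,
  0x119447003c0300082000041c, 0xc162ab99b, 0xc162ab59b, 0x41c000820000c1628e19b,
  0x119447003c03000c1a002019, 0x3c03000c1a1194470ae419, 0x41c000c1a000820119447003c03002419,
  0x41d119447003c03219018, 0x3c03119447000415102814, 0x81447000411003c0328640c,
  0x40d242411003c0328100d081447, 0x3c0a2a88cf, 0xb000a2a88cf, 0x82000400a00041c23a4cf,
  0x400a2a68cf, 0x400a2a68cf, 0x82000400a00041c2124cf, 0xc162af99b, 0xc162af59b,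
  0xc1600082000041c29219b, 0x400a000c1a2124cf002419, 0xc1a00400a0024192124cf,
  0xc1a00082000041c00400a0024192124cf, 0x41d00400a2124cf00b818, 0x400a0004152124cf00ac14,
  0x28a40a2b08cf, 0x81100440a2128cf00040c, 0x80c00cc1028540a290ccf, 0x40d00b41a00480a00080d212ccf,
  0x2ae80a2b20cf, 0x2b08cf2af40a, 0x8102140cf24800a, 0x2b04cf2ab80a, 0x2ae0cf29940a,
  0x2ae0cf2a000a, 0x82000041c00cc0a23fccf, 0x2ac0cf299c0a, 0x299c0a2ac0cf, 0x41c00082000d40a217ccf,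
  0xc162b519b, 0xc162b4d9b, 0x41c000c1600082029799b, 0xc1a00d40a217ccf002419,
  0xd40a217ccf000c1a002419, 0xc1a00d40a217ccf00041c000820002419, 0x41d00d40a217ccf003418,
  0x2af80a2b6ccf, 0x8152180cf00d80a000414, 0x2b400a2b64cf, 0x2184cf00081100dc0a00040c,
  0x2968cf28c80a00501000080c, 0x2188cf00e00a00080d00501100040d, 0x40e28c405,
  0x40308804700640e28a405, 0x2b691429dc0d, 0x2b64d42ad40d, 0x29e4132ad80f, 0x80f000c132938d400040d,
  0x10112abc0e, 0x10112b3c0e, 0x81300040f000c110dc80e, 0x4122b600b, 0x40a2b9807, 0x2b8d1429fc0d,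
  0x2b88d42af40d, 0x2a04132af80f, 0x295cd4000c1300040d00080f, 0x10112ad80e, 0x10112b580e,
  0x81300040f000c1119880e, 0x4122b880b, 0x40a2bb407, 0x2a24042a2000, 0x40d2bb514, 0x1cb40d2bb0d4,
  0x1cb80f000c13002800004c04, 0xc1300080f00040d2984d4, 0x4c040010110028001a700e,
  0x2800001011004c0427140e, 0x40f002800004c04000813000c110d400e, 0x2800004c04000412282c0b,
  0x4c0400040a00280029fc07, 0x504a2bd003, 0x304a2be003, 0x404000c4a000808294403, 0xc4a2bd805,
  0xc4a2c0c05, 0xc4a00040800080c297805, 0x4092c0400, 0x4012a38052a0401, 0x208e2be009, 0x208e2c1c09,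
  0x40c00081000208e296c09, 0x40d2c0804, 0x296c050004052a4809, 0x348e296009, 0x348e2a5809,
  0x40c00081000348e296409, 0x140300040d0028472a1c04, 0x295c050004052a5409001403002847,
  0x4100a2b908b, 0x4100a0004200fe01c1fd48b, 0x80e2beccf, 0x4200f841c00080e2640cf, 0x298516000812,
  0x91c1c000420000812298516, 0x3a4da0008192a815a, 0x3a4da0924192a795a,
  0x41c00082003a4da000c192a795a, 0x41d1fc8d40394da0928141ff95a, 0xc28dd090001, 0xc2cdd0f4c01,
  0x80f00040f000c152a3401, 0xcc062c5403, 0x48a2c7803, 0x40600844a2aa406, 0x2acc112c6158,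
  0x2c5d182acc11, 0x2ad4172ad013, 0x813000411000c172a3118, 0x1015197412, 0x10152bb412,
  0xc1500081700041319d012, 0x4162c340f, 0x40e2c600b, 0x40a2c8c07, 0x44a2c8c03, 0x4062a90062a844a,
  0x20bc060004492a5406, 0x2af81b2bc417, 0x2c999c2af815, 0x2c955c2af815, 0x2b001b2afc17,
  0x415000c1b0008172a695c, 0x10192b0c16, 0x10192bdc16, 0x81b000417000c19001c16, 0x41a2bf413,
  0x4122c2c0f, 0x40e28cc0b, 0x40a2cbc03, 0x28b80a2abc06000406, 0x2b2c002bf844,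
  0x1a0c1700041b19c844003800, 0x2b30002b3c44, 0x4152cd59c, 0x2b34002b4044, 0x4152cd55c,
  0x101b007844004000000817, 0x81700041500101b2aa95c, 0x7844001419004000002016,
  0x40000078440010191a2c16, 0x417004000000c1900081b007844002416, 0x784400041a004000054013,
  0x4000007844000412284c0f, 0x40e00784400400029500b, 0x40a0078040040002b1803,
  0x40000004060078042af80628f00a, 0x2130060044492b0c06, 0x7c082130060004040008492a4c06,
  0x405212c1021300600b450212406, 0x2a95192c580e, 0x2a80d92cd80e, 0x40f0008132a60d90f640e,
  0x4122cfc0b, 0x40a2d3407, 0x4062d2803, 0x2d08482ce801, 0x2ab0d500040a, 0x2a9c9522080a,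
  0x286401296c48000c0f220c0b, 0x80b000c0f2a809500040a, 0x40e211c4809b001220407, 0x2d48052d640c,
  0x4031d8c472b4c052b900c, 0x5b80519d00c000c4a000406, 0x288a2b9806, 0x4090c5006000891271c4a,
  0x238c8d2d3406, 0x23604d2d6c06, 0x23284d00040700080b299406, 0x40a2d6403, 0x239c8d29c406,
  0x23704d2b9406, 0x80b00040723384d299c06, 0x23a88d2d5406, 0x237c4d2d8006,
  0x23444d00080b0004072a2806, 0x40a2d9403, 0x140a0020040004002b9403, 0x248a2da803, 0xc8a2da403,
  0x80c000c8a0004082bd003, 0x2bdc0600308a, 0x188a2bd406, 0x40800080c000c062adc4a2bd406,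
  0x1434092b2091, 0x1bc8092b0c51, 0x80b0004072aec51143009, 0x253cd21dec06, 0x2540d2276806,
  0x810000c920004102bf406, 0x27200e2dc555, 0x2a740e2d9515, 0x81427240e0004102a2115, 0x4112dd998,
  0x4192b49a1, 0x27340e2dc955, 0x2a880e2da115, 0x81427380e00041029d515, 0x4112ddd58, 0x4192b4561,
  0x27480e2bd955, 0x2a9c0e29d915, 0x410000814274c0e29d515, 0x41100281b0014172bf158,
  0x141700281b0004192b3561, 0x4091272001, 0x4491212001, 0x40b00080b000c1a2be001,
  0x2024062ac80c27b847117811, 0x117c0a2c4c8e, 0x1bbc8e2acc0c00041100080a, 0x4512c3001,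
  0x1ac491213801, 0x80700040b1bb4112bf801, 0x4062a359e, 0x2a35132d7011, 0x29f1132dec11,
  0x41400081829ed13156011, 0x4152df010, 0x40d2e200c, 0x4092e4c04, 0x2a4d572d2815, 0x2a09572dd015,
  0x81c0004182a0557154415, 0x4192e0414, 0x4112e2c10, 0x40d2e6008, 0x1520152a6557, 0x2a2157244815,
  0x81c0004182a1d57152415, 0x419003047001803285814, 0x18030004110030472bb010,
  0x180300040d0030472c9c08, 0x248c112e4c10, 0x40d2e880c, 0x4092e7004, 0x27500d2e640c, 0x4092e9808,
  0x4052e8c00, 0xc472470110018032bd010, 0xc4700180300040d2cc80c, 0x409000c470018032c8804,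
  0x1590152e4c14, 0x4112e7410, 0x40d2ea808, 0x2ce81c2cec20, 0x4192e0818, 0x4152e5014, 0x4112e900c,
  0x2d24202cf424, 0x41d2d901c, 0x4192e5418, 0x4152e9410, 0x2d04032d0c47, 0x2d0c472d3803,
  0x824002847001803000420, 0x284700041d0018030f001c, 0x41900180300284725a818,
  0x18030004150028472b8410, 0x180a2dc08b, 0x180a2e688b, 0x42000082400180a15dc8b,
  0x41d00180a0f0c1c00508b, 0x180a00041900508b259c18, 0x180a00041500508b2b9810, 0x180e24dcd2,
  0x180e28e8d2, 0x82400042024e0d200180e, 0x41d0f181c00180e0074d2, 0x4190074d200180e1c9818,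
  0x41500180e0074d22bac10, 0x202c052f0048, 0x2028052f244c, 0x20280500040620300a2b1c4c,
  0x1ca81100059f, 0x2034052f2848, 0x20340500040600140a2ae048, 0x1cb41100059f,
  0x10180004180020112ae1df, 0x2a740a2d500714d40214d845, 0x2f2c072edc0a, 0x14e0442a780a0004002d5407,
  0x2f30072ee00a, 0xc052d58072a7c0a000402, 0x2d580714e8040008002a7c0a,
  0x18040008002a7c0a0004020010052d5807, 0x108d1000401, 0xf491286801, 0x14e44514e0022a700a2d7407,
  0x2a700a2f5007, 0x2a700a14ec440004002d7807, 0x2a700a2f5407, 0x402000c052a700a2d7c07,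
  0x14f4040008002a700a2d7c07, 0x10050004020018042a700a0008002d7c07, 0x240f00200b00fc91000401,
  0x2158052f7400, 0x2154092f6804, 0x214c090004030008472d6c04, 0x25644a2e6006, 0x29704a2f0806,
  0x81c00041825684a167c06, 0x41500fc4a00f0060f7014, 0x41100fc4a00f0061c3410, 0x7d171c380d,
  0x2f80012f8804, 0x2fa4042f9c01, 0x8062144010004022b5c04, 0x1c48100b444a0f88112b3406, 0x40d000957,
  0x414001810001c0d2b6157, 0x344a000419015406291808, 0x49122c801, 0x40b00480e008c212d8801,
  0x21a0052db801, 0x28d801286c95, 0x22d801287095, 0x80b00040b1278152d9801, 0x128092df8092d280d,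
  0x2e10152f7014, 0x4112fac10, 0x40d2e0409, 0x4032be157, 0x16400d2e0c09, 0x403004557,
  0xc1c000414001c032b9d57, 0x2d480d294c1101380d, 0x12c1126e015295011,
  0x403000847011811294c1126c815, 0xc4a2e0801, 0xc0a2df401, 0x807000403000c0a2dd001, 0x2d600d2fa011,
  0x2968112fa015, 0x40329641100084726e815, 0xc4a2e2001, 0xc0a2e0c01, 0x807000403000c0a2de801,
  0x40601059f, 0x2fbc142fb415, 0x4112d800d, 0x2fc0182f3419, 0x415298c11,
  0x270c181bb819000803001047, 0x1047000803000415298c11, 0x144a2e4801, 0x100a2e3401,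
  0x807000403000c0a2e1001, 0x40600a5df, 0x41c002c180048062bfddf, 0x2fa8182e8c1c, 0x4152ff014,
  0x411302c10, 0x84032c5d57, 0xbd5716bc03, 0x81c000414000c032c1557, 0x600192ff818, 0x415300414,
  0x2ef8202ea424, 0x41d2f7c1c, 0x419300c18, 0x2eb0032ee447, 0x85820001003061847000424,
  0x1003001c4700041d1c081c, 0x1c47001003000419276018, 0x204a2e9801, 0x180a2e8401,
  0x807000403000c0a2e6001, 0x2ea40100744a, 0x2e900100700a, 0x8070004032e6c01006c0a, 0x40620b9df,
  0x8060105df, 0x41c00081c0018062c5ddf, 0xdc032cb157, 0x305014300c15, 0x4032c7157,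
  0x418000c1c0068032c6d57, 0x2ecc0100584a, 0x2eb80100500a, 0x8070004032e940100440a, 0x2ed801305c4a,
  0x2ec4012fd80a, 0x4032ea0010008071c580a, 0x40620eddf, 0x2fac19306c18, 0x2f681d2fe81c,
  0x40308bc1d0008471c681c, 0x2ef401000c4a, 0x2ee001000c0a, 0x8070004032ebc01000c0a, 0x4062caddf,
  0x201c0004200030062ca9df, 0x2cfd572f3815, 0x2cb957305815, 0x2cb55700081c00041800b415,
  0x8c0a2f448b, 0x4d420008c0a00042400bc8b, 0x81d2d11df, 0x4dc1d2ccddf, 0x420000824000c1d2cc9df,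
  0x18a12a3001, 0x2f540a2f5c8b, 0x2fac0a307c8b, 0x82400042000d88b00b80a, 0xc1d2d2ddf,
  0x2ce9df000c1d, 0x8240004202ce5df000c1d, 0x4212f2c01, 0x40300200b0024212f0801, 0x6c0630dc8b,
  0x806004c2100041c0088a1, 0x2f540130e04a, 0x4072f180120bc0328240a, 0x40631248b,
  0xa82100101900f0a1000418, 0x415010c2114d006016ca1, 0x21c06315803, 0xdc0a00541d15041c010c8b,
  0x41900dc0a010c8b281818, 0x600e311d13, 0x5340e311d13, 0x640e0004200008242a3913,
  0x41d00140e140c1c02ed13, 0x41900140e142c1802ed13, 0x14301502619f, 0x14341502599f,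
  0x418000818000c152d35df, 0x2484a317403, 0x30b80e31500b, 0x40a318807, 0x20480e0254450008022dd40b,
  0x3c4500080200040a2fb407, 0x31580b30c40e, 0x40a319407, 0x26444204c0e0008002de00b,
  0x4c4400080000040a2fc007, 0x31740b30d00e, 0x40a31a007, 0x20500e0018052dec0b000802,
  0x180500080200040a2fcc07, 0x100020500e0030042e000b, 0x100000040a0030042fd007,
  0x2df80b00300420500e002005000802001000, 0x80200100000200500040a0030042fd407, 0x23ad15000401,
  0x440a31b803, 0x40200400a004c052fd803, 0x3c0a31bc03, 0x380a0054040004002fdc03, 0x340a31dc03,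
  0x300a000c050004022fe003, 0x800002c0a0018042fe003, 0x280a0010050008000004020018042fe003,
  0x23d115000401, 0x4130028130070212fc001, 0x2b0c012a7091, 0x29c00e31e513, 0x2e8c0e31fd13,
  0x41015840e0008142ffd13, 0x4112ffc01, 0x40300140b1488112fd801, 0x4062dc1df,
  0xbc0e002006000421025513024806]

set_option maxRecDepth 20000 in
/-- Sets of cells that Black has to occupy. -/
def templates : List ℕ := [
  0x13ff, 0xfeff, 0x137f8, 0x136ff, 0x1fbf8, 0x1faff, 0x1fef7, 0xfeeff, 0x13dfc8, 0x13ef7c,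
  0x137f7f, 0x13df7f, 0x13eeff, 0x17e3ff, 0x1fccff, 0x1fe7f7, 0x1fbf7f, 0xefebff, 0xfe7eff,
  0x1367fc8, 0x136fec8, 0x13cf7c8, 0x136f7f8, 0x1377df8, 0x137f5f8, 0x13f73f8, 0x13fb778,
  0x13fe3f8, 0x13deff8, 0x13efdf8, 0x1367eff, 0x136fe7f, 0x13ef2ff, 0x17e36ff, 0x17f32ff,
  0x16f7f7f, 0xfefccff, 0xefebeff, 0x1367f6c8, 0x136cdfc8, 0x1377efc8, 0x137f7bc8, 0x13defbc8,
  0x13ef3778, 0x13f733f8, 0x13fb35f8, 0x13fb3778, 0x13fe337c, 0x13efef68, 0x1377ccff, 0x137f4cff,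
  0x13deeff8, 0x13fe3efc, 0x13efccff, 0x1eedeff8, 0x1ef6fdf8, 0x13f73f7f, 0xfefcccff, 0x136ccf7c8,
  0x1367efec8, 0x1367f33f8, 0x1377cefc8, 0x13ef3c5f8, 0x136cdeff8, 0x13efcefc8, 0x136fafdf8,
  0x137f7b778, 0x13df7b778, 0x13f73f5f8, 0x1eecd7bf8, 0x13efcccff, 0x1eecdeff8, 0x136cdefec8,
  0x13f72cdfc8, 0x136fb34cff, 0x13ef2fccff, 0x17f32fccff, 0x17f33f4cff]

set_option maxRecDepth 20000 in
/-- The winning attack of White for each template. -/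
def templateAttacks : List ℕ := [
  0x2fe006, 0x2f900c, 0x2f3c06, 0x2f3006, 0x2f0006, 0x2ef406, 0x2ecc0d, 0x2e9406, 0x2e6409,
  0x2dc405, 0x2d6403, 0x2c2806, 0x2bd806, 0x2b8806, 0x2b2406, 0x2ae411, 0x2a8403, 0x2a6810,
  0x29c411, 0x299809, 0x29780c, 0x295009, 0x292406, 0x289006, 0x28580d, 0x27c006, 0x273012,
  0x267005, 0x25ec0d, 0x255806, 0x25140c, 0x24f00e, 0x24ec0c, 0x240006, 0x23dc06, 0x1fec15,
  0x1ea006, 0x1e9414, 0x1e880d, 0x1e7c09, 0x1c3412, 0x1c0c09, 0x1b8411, 0x194016, 0x189806,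
  0x18500d, 0x183816, 0x17e005, 0x15d406, 0x14d412, 0x148406, 0x132805, 0x125809, 0x11d006,
  0x110c0d, 0xfe006, 0xf1403, 0xeac06, 0xe3409, 0xddc14, 0xda811, 0xaac16, 0xa7011, 0xa280d,
  0x94815, 0x93814, 0x8c017, 0x7d81a, 0x69c06, 0x5e406, 0x5b006, 0x4f00d, 0x4ac0c, 0x46409,
  0x40406, 0x3e818, 0x25c06, 0x412]

set_option maxRecDepth 20000 in
/-- The states of the automaton. -/
def stateCodes : List ℕ := [
  116, 1794, 2245, 2693, 28672, 30467, 132238851, 35843, 43011, 29123, 29571, 1996606977,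
  2121756676, 602116, 2936131076, 2364436484, 723437367299, 1893846529, 2833370628, 2056155140,
  459201, 688580, 2352623620, 689028, 32061378050, 33940426242, 37698522626, 45214715394, 11956229,
  52730908165, 30307479554, 46991372293, 7483394, 11153413, 31121853954, 46154239493, 30550159362,
  11128325, 31958617602, 31019093506, 46051479045, 30241878018, 45274263557, 8257986, 9175490,
  11010498, 11928005, 12845509, 7569858, 11239877, 30538346498, 45570732037, 7570306, 11240325,
  513009575802, 132608003, 147288067, 176648195, 484911992320, 133066755, 147746819, 177106947,
  126644227, 128479235, 122056707, 601538129923, 721797214211, 497962938371, 124923907, 121253891,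
  125038595, 481521725440, 124898819, 146918915, 176279043, 121228803, 132582915, 147262979,
  176623107, 512045248515, 132353539, 602249743875, 722508828163, 497023045123, 481213444096,
  511278215171, 601472528387, 721731612675, 496245829635, 118358464, 543048740867, 147718595,
  177078723, 126616003, 128451011, 122028483, 481509912576, 124896131, 601768996867, 722028081155,
  496542298115, 483034664568, 2826399748, 1894215681, 2833739780, 511343336673, 2467196932,
  2936958980, 1894674433, 2834198532, 1888251905, 2827776004, 2359848964, 2829611012, 2353426436,
  2823188484, 488567699201, 2352942596, 729085867780, 496083891969, 556213434116, 736602060548,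
  2822704644, 1886531585, 2826055684, 1882861569, 2822385668, 1886646273, 723462973306, 1882836481,
  2822360580, 1894190593, 2833714692, 482974394113, 723492562692, 1893961217, 2833485316,
  2055441924, 482926454529, 723444623108, 722505099012, 1997406657, 2467168708, 2936930756,
  484912112385, 725430280964, 1888223681, 2827747780, 1890058689, 2359820740, 2829582788,
  2353398212, 2823160260, 1886503809, 2826027908, 482005459713, 722523628292, 31951302658,
  31012122626, 46044508165, 31958986754, 32062205954, 30652919810, 45685305349, 31122681858,
  46155067397, 31019921410, 46052306949, 30539149314, 45571534853, 31008911362, 46041296901,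
  511571818354, 30538665474, 45571051013, 496539432818, 737057601397, 752559748981, 485734905714,
  726253074293, 31008427522, 46040813061, 31947632642, 31951417346, 31008083458, 46040468997,
  31958961666, 31019437570, 46051823109, 31958732290, 45273550341, 496128134770, 736646303349,
  32062177730, 30652891586, 45685277125, 31122653634, 46155039173, 511343344178, 496310958642,
  736829127221, 30539121090, 45571506629, 31008883138, 46041268677, 496129292850, 736647461429,
  603181953027, 723441037315, 602242772995, 722501857283, 497016074243, 603189637123, 723448721411,
  511689256963, 496656871427, 512159019011, 481510715392, 511575486467, 601769799683, 722028883971,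
  496543100931, 543074346874, 603203889018, 481510231552, 511575002627, 601769315843, 722028400131,
  496542617091, 512070051706, 542134822778, 602264364922, 722523449210, 497037666170, 498006550394,
  511394768762, 496362383226, 603178283011, 603182067715, 723441152003, 603189612035, 723448696323,
  602250087939, 722509172227, 497023389187, 511689228739, 496656843203, 512158990787, 603189609382,
  723448693670, 602250085286, 722509169574, 497023386534, 481510687168, 511575458243, 601769771459,
  722028855747, 496543072707, 602294155012, 722553239300, 482952144641, 723499673348, 722530789124,
  482981504769, 482945033985, 723463202564, 722523678468, 484913712760, 725431881339, 482945003745,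
  723494112891, 482005479649, 722523648228, 482975944312, 484854992504, 725373161083, 526194052731,
  482036420216, 602295504507, 722554588795, 482952142877, 723470311456, 482012618781, 722530787360,
  482945032221, 723463200800, 482005508125, 722523676704, 511343444201, 496129294096, 736647462675,
  511339774185, 483858694377, 724376862956, 511277505553, 482926410177, 723444578756]

set_option maxRecDepth 20000 in
/-- For each state, the places of the states that dominate its successors. -/
def stateHints : List ℕ := [
  0x1, 0x400000000030000300c02, 0x900000000080000701805, 0xa, 0xb, 0x3c0000000038000340003000,
  0x1100000000100000d03400, 0x1300000000100000d03412, 0x3400, 0x5000, 0x1600000000100000703415,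
  0x1800000000170000d03400, 0x1e0001d0741c0000300c1b00c1a06400, 0x2000000000030000300c1f,
  0x2200000000030000300c21, 0x2400000000030000300c23, 0x2600000000030000300c25, 0x5000,
  0x80000000000c0000c0009c00, 0x2900000000030000300c28, 0x2b00000000030000300c2a,
  0x300002f03c2e0000300c2d00c2c03000, 0x3200000000030000300c31, 0x3400000000030000300c33,
  0x3600000000030000300c35, 0x3a0000000039000380dc00, 0x3e000000003d0003c0f03b, 0xfc00, 0x10000,
  0x41, 0x0, 0x430000000042000070dc00, 0x44, 0x11400, 0x46, 0x11c00, 0x0, 0x4b000000004a0000712448,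
  0x4c, 0x4f000000004e0004d0dc00, 0x5300000000520005114000, 0x54, 0x5800000000570000715855, 0x59,
  0x5d000000005c0005b16c5a, 0x17800, 0x17c00, 0x60, 0x0, 0x0, 0x0, 0x6400000000630000718861, 0x65,
  0x14000, 0x0, 0x6700000000100000d03466, 0x6900000000100000d03468, 0x3400, 0x5000,
  0x1b000000001ac00034001a800, 0x6e00000000100000d0346d, 0x3400, 0x5000, 0x7000000000100000d0346f,
  0x7200000000710000d03400, 0x7400000000730000d03400, 0x7700000000760000d03475,
  0x7a00000000170007905078, 0x7b00000000760000d03400, 0x7d00000000100000d0347c,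
  0x7f00000000170000d0347e, 0x7000000000100000d03480, 0x3c0000000038000340003000,
  0x8100000000100000d03400, 0x3400, 0x5000, 0x8300000000170000d03482, 0x8500000000100000d03484,
  0x3400, 0x5000, 0x8700000000100000d03486, 0x8900000000100000d03488, 0x3400, 0x22800, 0x3400,
  0x3c0000000038000340003000, 0x8c00000000100000d0348b, 0x3400, 0x5000, 0x8d00000000170000d03400,
  0x240000000023c000340023800, 0x9200000000100000d03491, 0x3400, 0x5000, 0x9400000000100000d03493,
  0x9700000000960000d03495, 0x9900000000980000d03400, 0x3c0000000038000340003000,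
  0x9b00000000100000d0349a, 0x3400, 0x5000, 0x9d00000000170000d0349c, 0x80000000000c0000c0027800,
  0xa000000000030000300c9f, 0x80000000000c0000c0028400, 0xc00, 0x80000000000c0000c0028800,
  0xa400000000030000300ca3, 0xa600000000030000300ca5, 0x80000000000c0000c0028400,
  0xa800000000030000300ca7, 0x80000000000c0000c0000000, 0xc00, 0xc00, 0xc00,
  0xaa00000000030000300ca9, 0xac00000000030000300cab, 0x80000000000c0000c002b400,
  0xaf00000000030000300cae, 0xb100000000030000300cb0, 0x2c8000000000c0000c0000000,
  0xb400000000030000300cb3, 0xc00, 0xb600000000030000300cb5, 0x80000000000c0000c0027800, 0xc00,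
  0x80000000000c0000c002dc00, 0xc00, 0x80000000000c0000c002e000, 0x5000,
  0x80000000000c0000c002dc00, 0xba00000000030000300cb9, 0x80000000000c0000c002ec00,
  0xbd00000000030000300cbc, 0x80000000000c0000c002e000, 0xc00, 0x80000000000c0000c002f800, 0xc00,
  0xbf00000000030000300c00, 0x80000000000c0000c0027800, 0xc00, 0xc100000000030000300cc0,
  0x80000000000c0000c0030800, 0xc400000000030000300cc3, 0xc600000000030000300cc5,
  0x80000000000c0000c0031c00, 0xc900000000030000300cc8, 0x80000000000c0000c0000000, 0xc00,
  0x80000000000c0000c0000000, 0xc00, 0xc00, 0xcb00000000030000300cca, 0xcd00000000030000300ccc,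
  0x80000000000c0000c0027800, 0xc00, 0x80000000000c0000c002dc00, 0xcf00000000030000300cce,
  0xd100000000d00004d13400, 0xd300000000d20005114000, 0xd4, 0xd600000000d50004d13400, 0xdc00,
  0x35c00, 0xd8, 0x36400, 0x0, 0x14000, 0x0, 0xdd00000000dc0000736cda, 0xde, 0x14000, 0x0,
  0x8100000000e0000df0dc00, 0xe400000000e300007388e1, 0xe5, 0xe900000000e8000e739800, 0xea, 0xeb,
  0x3b000, 0xed, 0x14000, 0x0, 0x1100000000ee0005b16c00, 0xf000000000ef0004d13400, 0x14000, 0x0,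
  0xf200000000f10004d13400, 0xf400000000f30005114000, 0xf5, 0x13400, 0x0, 0x14000, 0x0, 0xdc00,
  0x3d800, 0xf7, 0x3e000, 0x0, 0xfa00000000f90004d13400, 0xfc00000000fb0005114000, 0xfd,
  0x1010000000100000073fcfe, 0x102, 0x14000, 0x0, 0x14000, 0x0, 0x3400, 0x5000, 0x3400, 0x22800,
  0x10400000001030000d03400, 0x3400, 0x5000, 0x10600000000100000d03505, 0x10700000000170000d03400,
  0x10600000000100000d03508, 0x3c0000000038000340003000, 0x10a00000000100000d03509, 0x3400, 0x5000,
  0x10b00000000170000d03400, 0x10d00000000100000d0350c, 0x3400, 0x3c0000000038000340003000,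
  0x10f00000000100000d0350e, 0x3400, 0x5000, 0x11100000000170000d03510, 0x10f00000000100000d03512,
  0x11400000000100000d03513, 0x3400, 0x45400, 0x11800000001170000d03516, 0x3400, 0xd03400,
  0xd03400, 0xfc00, 0x3400, 0x5000, 0x3400, 0x5000, 0x3400, 0x22800, 0x3400,
  0x11a00000000100000d03519, 0x11c00000000170000d0351b, 0x3400, 0x3400, 0x5000, 0x3400, 0x22800,
  0x3400, 0x3c0000000038000340003000, 0x11e00000000100000d0351d, 0x3400, 0x5000,
  0x12000000000170000d0351f, 0xc00, 0xc00, 0x80000000000c0000c0027800, 0xc00, 0xc00,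
  0x80000000000c0000c002e000, 0x80000000000c0000c0027800, 0xc00, 0xc00, 0x80000000000c0000c0048400,
  0xc00, 0x80000000000c0000c0027800, 0xc00, 0x80000000000c0000c002dc00, 0x12300000000030000300d22,
  0x80000000000c0000c002e000, 0x80000000000c0000c0049000, 0xc00, 0x12600000000030000300d25,
  0x80000000000c0000c002dc00, 0xc00, 0xc00, 0x80000000000c0000c0027800, 0xc00,
  0x80000000000c0000c002dc00, 0xc00, 0x80000000000c0000c0027800, 0xc00, 0x80000000000c0000c002dc00,
  0xc00, 0x13400, 0x14000, 0x0, 0x13400, 0x49c00, 0x0, 0x12900000000100000d03528,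
  0x80000000000c0000c0027800, 0xc00]

/-- The templates and their half turns. -/
def allTemplates : List ℕ := templates ++ templates.map revMask

/-- Each template is won by its attack, has a cell in its first column, and fits in ten columns,
as does its half turn. -/
def checkTemplates (T : ℕ) : List ℕ → List ℕ → Bool
  | [], _ => true
  | M :: l, rs => isAttack T M (rs.headD 0) && !Nat.beq (M % 16) 0 && Nat.blt M (2 ^ 40) &&
      Nat.blt (revMask M) (2 ^ 40) && checkTemplates T l rs.tail

theorem checkTemplates_spec {T : ℕ} (hT : TableValid T) {l rs : List ℕ}
    (h : checkTemplates T l rs = true) {M : ℕ} (hM : M ∈ l) :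
    Template M ∧ M % 16 ≠ 0 ∧ M < 2 ^ 40 ∧ revMask M < 2 ^ 40 := by
  induction l generalizing rs with
  | nil => cases hM
  | cons x l ih =>
    simp only [checkTemplates, Bool.and_eq_true, Nat.blt_eq, Bool.not_eq_true'] at h
    obtain ⟨⟨⟨⟨h1, h2⟩, h3⟩, h4⟩, h5⟩ := h
    rcases List.mem_cons.1 hM with rfl | hM
    · refine ⟨template_of_isAttack hT h1, fun e => ?_, h3, h4⟩
      rw [e] at h2
      cases h2
    · exact ih h5 hM

theorem checkTemplates_templates :
    (force (extendTable attackLists (barrierTable barriers 0)) fun T =>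
      checkTemplates T templates templateAttacks) = true := by
  decide +kernel

theorem isClosedAutomaton_states :
    isClosedAutomaton (pack allTemplates) allTemplates.length stateCodes stateHints = true := by
  decide +kernel

theorem template_of_mem {M : ℕ} (hM : M ∈ allTemplates) : Template M ∧ M < 2 ^ 40 := by
  have h := checkTemplates_templates
  rw [force_eq] at h
  have hT := (tableValid_zero.barrierTable barriers).extendTable attackLists
  rw [allTemplates, List.mem_append, List.mem_map] at hM
  rcases hM with hM | ⟨M, hM, rfl⟩
  · obtain ⟨h1, -, h3, -⟩ := checkTemplates_spec hT h hM
    exact ⟨h1, h3⟩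
  · obtain ⟨h1, h2, -, h4⟩ := checkTemplates_spec hT h hM
    exact ⟨h1.revMask h2, h4⟩

/-- A virtual connection has at least `2 / 3 * n - 2` stones. -/
theorem IsVirtualConnection.two_mul_le {n : ℕ} {B : Finset (Cell 4 n)}
    (hB : IsVirtualConnection B) : 2 * n ≤ 3 * B.card + 6 :=
  two_mul_le_of_isClosedAutomaton isClosedAutomaton_states
    (fun _ ht => (template_of_mem
      (digit_pack (fun _ hM => (template_of_mem hM).2) ht)).1) hB

/-- Black, moving second, can extend the set `X` of black cells within the carrier `C` such that it
has the property `G`. -/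
inductive Achievable {α : Type} (G : Set α → Prop) : Set α → Set α → Prop where
  | now (X : Set α) (h : G X) : Achievable G X ∅
  | weaken (X C D : Set α) (hCD : C ⊆ D) (h : Achievable G X C) : Achievable G X D
  | reply (X C : Set α) (hne : C.Nonempty) (m : α → α) (C' : α → Set α)
      (hm : ∀ c ∈ C, m c ∈ C) (hmc : ∀ c ∈ C, m c ≠ c) (hC' : ∀ c ∈ C, C' c ⊆ C \ {c, m c})
      (h : ∀ c ∈ C, Achievable G (insert (m c) X) (C' c)) : Achievable G X C

section Achievable

variable {α : Type} {G H : Set α → Prop} {X Y C D : Set α}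

theorem Achievable.of_replies (hne : C.Nonempty)
    (h : ∀ c ∈ C, ∃ m ∈ C, m ≠ c ∧ ∃ C' ⊆ C \ {c, m}, Achievable G (insert m X) C') :
    Achievable G X C := by
  classical
  choose! m hm hmc C' hC' h using h
  exact .reply X C hne m C' hm hmc hC' h

theorem Achievable.mono (hG : Monotone G) (h : Achievable G X C) (hXY : X ⊆ Y) :
    Achievable G Y C := by
  induction h generalizing Y with
  | now X h => exact .now Y (hG hXY h)
  | weaken X C D hCD _ ih => exact .weaken Y C D hCD (ih hXY)
  | reply X C hne m C' hm hmc hC' _ ih =>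
    exact .reply Y C hne m C' hm hmc hC' fun c hc => ih c hc (Set.insert_subset_insert hXY)

theorem Achievable.imp (h : Achievable G X C) (hGH : ∀ Y, X ⊆ Y → G Y → H Y) :
    Achievable H X C := by
  induction h with
  | now X h => exact .now X (hGH X subset_rfl h)
  | weaken X C D hCD _ ih => exact .weaken X C D hCD (ih hGH)
  | reply X C hne m C' hm hmc hC' _ ih =>
    exact .reply X C hne m C' hm hmc hC' fun c hc =>
      ih c hc fun Y hY => hGH Y ((Set.subset_insert _ _).trans hY)

theorem Achievable.and_of_holds (hH : Monotone H) (h : Achievable G X C) (hX : H X) :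
    Achievable (fun Y => G Y ∧ H Y) X C := by
  induction h with
  | now X h => exact .now X ⟨h, hX⟩
  | weaken X C D hCD _ ih => exact .weaken X C D hCD (ih hX)
  | reply X C hne m C' hm hmc hC' _ ih =>
    exact .reply X C hne m C' hm hmc hC' fun c hc => ih c hc (hH (Set.subset_insert _ _) hX)

/-- Strategies with disjoint carriers can be combined. -/
theorem Achievable.and (hG : Monotone G) (hH : Monotone H) (h₁ : Achievable G X C)
    (h₂ : Achievable H X D) (hCD : Disjoint C D) :
    Achievable (fun Y => G Y ∧ H Y) X (C ∪ D) := by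
  classical
  suffices ∀ Y, X ⊆ Y → ∀ D, Achievable H Y D → Disjoint C D →
      Achievable (fun Y => G Y ∧ H Y) Y (C ∪ D) from this X subset_rfl D h₂ hCD
  clear h₂ hCD
  induction h₁ with
  | now X h =>
    intro Y hXY D h₂ _
    refine .weaken _ D _ Set.subset_union_right ?_
    exact (h₂.and_of_holds hG (hG hXY h)).imp fun Z _ hZ => hZ.symm
  | weaken X C C₀ hC _ ih =>
    intro Y hXY D h₂ hD
    exact .weaken _ _ _ (Set.union_subset_union_left D hC) (ih Y hXY D h₂ (hD.mono_left hC))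
  | reply X C hne m C' hm hmc hC' h ih =>
    intro Y hXY D h₂ hD
    have h₁ : Achievable G X C := .reply X C hne m C' hm hmc hC' h
    induction h₂ with
    | now Y hY =>
      exact .weaken _ C _ Set.subset_union_left ((h₁.mono hG hXY).and_of_holds hH hY)
    | weaken Y D D₀ hD₀ _ ih₂ =>
      exact .weaken _ _ _ (Set.union_subset_union_right C hD₀)
        (ih₂ hXY (hD.mono_right hD₀))
    | reply Y D hne₂ m₂ D' hm₂ hmc₂ hD' h₂ ih₂ =>
      refine .of_replies (hne.mono Set.subset_union_left) fun c hc => ?_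
      rw [Set.disjoint_left] at hD
      by_cases hcC : c ∈ C
      · refine ⟨m c, Or.inl (hm c hcC), hmc c hcC, C' c ∪ D, ?_, ?_⟩
        · rintro x (hx | hx)
          · exact ⟨Or.inl (hC' c hcC hx).1, (hC' c hcC hx).2⟩
          · refine ⟨Or.inr hx, ?_⟩
            rintro (rfl | rfl)
            · exact hD hcC hx
            · exact hD (hm c hcC) hx
        · refine ih c hcC _ (Set.insert_subset_insert hXY) D ?_ ?_
          · exact (Achievable.reply Y D hne₂ m₂ D' hm₂ hmc₂ hD' h₂).mono hH
              (Set.subset_insert _ _)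
          · exact Set.disjoint_left.2 fun x hx => hD (hC' c hcC hx).1
      · have hcD : c ∈ D := hc.resolve_left hcC
        refine ⟨m₂ c, Or.inr (hm₂ c hcD), hmc₂ c hcD, C ∪ D' c, ?_, ?_⟩
        · rintro x (hx | hx)
          · refine ⟨Or.inl hx, ?_⟩
            rintro (rfl | rfl)
            · exact hcC hx
            · exact hD hx (hm₂ c hcD)
          · exact ⟨Or.inr (hD' c hcD hx).1, (hD' c hcD hx).2⟩
        · exact ih₂ c hcD (hXY.trans (Set.subset_insert _ _))
            (Set.disjoint_left.2 fun x hx hx' => hD hx (hD' c hcD hx').1)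

theorem Achievable.holds_union (hG : Monotone G) (h : Achievable G X C) : G (X ∪ C) := by
  induction h with
  | now X h => exact hG Set.subset_union_left h
  | weaken X C D hCD _ ih => exact hG (Set.union_subset_union_right X hCD) ih
  | reply X C hne m C' hm _ hC' _ ih =>
    obtain ⟨c, hc⟩ := hne
    refine hG ?_ (ih c hc)
    rintro x ((rfl | hx) | hx)
    · exact Or.inr (hm c hc)
    · exact Or.inl hx
    · exact Or.inr (hC' c hc hx).1

theorem achievable_pair {u v : α} (huv : u ≠ v) (hu : G (insert u X)) (hv : G (insert v X)) :
    Achievable G X {u, v} := by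
  refine .of_replies ⟨u, by simp⟩ ?_
  rintro c (rfl | rfl)
  · exact ⟨v, by simp, huv.symm, ∅, by simp, .now _ hv⟩
  · exact ⟨u, by simp, huv, ∅, by simp, .now _ hu⟩

end Achievable

theorem Position.play_eq_black {k n : ℕ} {P : Position k n} {c d : Cell k n}
    (hd : P d = some Stone.black) (hc : P c = none) (s : Stone) :
    P.play c s d = some Stone.black := by
  rw [P.play_of_ne _ (by rintro rfl; rw [hc] at hd; cases hd), hd]

/-- A property of the black cells that joins Black's edges. -/
def Joins {k n : ℕ} (X : Set (Cell k n)) : Prop :=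
  ∃ p q : Cell k n, p.2.val = 0 ∧ q.2.val + 1 = n ∧
    ∃ w : (hexGraph k n).Walk p q, ∀ c ∈ w.support, c ∈ X

theorem joins_mono {k n : ℕ} : Monotone (Joins (k := k) (n := n)) := by
  rintro X Y hXY ⟨p, q, hp, hq, w, hw⟩
  exact ⟨p, q, hp, hq, w, fun c hc => hXY (hw c hc)⟩

theorem Joins.blackConnected {k n : ℕ} {X : Set (Cell k n)} (h : Joins X) {P : Position k n}
    (hP : ∀ c ∈ X, P c = some Stone.black) : P.BlackConnected := by
  obtain ⟨p, q, hp, hq, w, hw⟩ := h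
  exact ⟨p, q, hp, hq, w, fun c hc => hP c (hw c hc)⟩

/-- The number of empty cells. -/
def Position.emptyCount {k n : ℕ} (P : Position k n) : ℕ :=
  (Finset.univ.filter fun c => P c = none).card

theorem Position.emptyCount_play {k n : ℕ} {P : Position k n} {c : Cell k n} (hc : P c = none)
    (s : Stone) : (P.play c s).emptyCount < P.emptyCount := by
  refine Finset.card_lt_card (Finset.ssubset_iff_of_subset (fun d hd => ?_) |>.2
    ⟨c, by simp [hc], by simp [P.play_self]⟩)
  simp only [Finset.mem_filter, Finset.mem_univ, true_and] at hd ⊢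
  by_cases e : d = c
  · rw [e, hc]
  · rwa [P.play_of_ne _ e] at hd

theorem Achievable.blackWins {k n : ℕ} {X C : Set (Cell k n)} (h : Achievable Joins X C)
    {P : Position k n} (hX : ∀ c ∈ X, P c = some Stone.black)
    (hC : ∀ c ∈ C, P c ≠ some Stone.white) : BlackWins Stone.white P := by
  suffices ∀ N, ∀ P : Position k n, P.emptyCount = N → ∀ X C, Achievable Joins X C →
      (∀ c ∈ X, P c = some Stone.black) → (∀ c ∈ C, P c ≠ some Stone.white) →
      BlackWins Stone.white P from this _ P rfl X C h hX hC
  clear h hX hC P X C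
  intro N
  induction N using Nat.strong_induction_on with
  | _ N IH =>
  intro P hN X C h hX hC
  have full : ∀ (t : Stone) (Q : Position k n) (X C : Set (Cell k n)), Achievable Joins X C →
      (∀ c ∈ X, Q c = some Stone.black) → (∀ c ∈ C, Q c ≠ some Stone.white) → Q.IsFull →
      BlackWins t Q := by
    intro t Q X C h hX hC hfull
    refine .full _ _ hfull ((h.holds_union joins_mono).blackConnected ?_)
    rintro c (hc | hc)
    · exact hX c hc
    · match hq : Q c with
      | none => exact absurd hq (hfull c)
      | some Stone.white => exact absurd hq (hC c hc)
      | some Stone.black => rfl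
  have pass : ∀ (Q : Position k n) (X C : Set (Cell k n)), Q.emptyCount < N →
      Achievable Joins X C →
      (∀ c ∈ X, Q c = some Stone.black) → (∀ c ∈ C, Q c ≠ some Stone.white) →
      BlackWins Stone.black Q := by
    intro Q X C hlt h hX hC
    by_cases hfull : Q.IsFull
    · exact full _ Q X C h hX hC hfull
    · simp only [Position.IsFull, not_forall, not_not] at hfull
      obtain ⟨d, hd⟩ := hfull
      refine .black_to_move Q d hd (IH _ ((Q.emptyCount_play hd _).trans hlt) _ rfl X C h
        (fun c hc => Position.play_eq_black (hX c hc) hd _) fun c hc => ?_)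
      by_cases e : c = d
      · rw [e, Q.play_self]; simp
      · rw [Q.play_of_ne _ e]; exact hC c hc
  by_cases hfull : P.IsFull
  · exact full _ P X C h hX hC hfull
  induction h with
  | now X h =>
    refine .white_to_move P hfull fun c hc => ?_
    exact pass _ X ∅ (hN ▸ P.emptyCount_play hc _) (.now X h)
      (fun d hd => Position.play_eq_black (hX d hd) hc _) (by simp)
  | weaken X C D hCD _ ih => exact ih hX fun c hc => hC c (hCD hc)
  | reply X C hne m C' hm hmc hC' h _ =>
    refine .white_to_move P hfull fun c hc => ?_
    have hlt := P.emptyCount_play hc Stone.white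
    have hX' : ∀ d ∈ X, P.play c Stone.white d = some Stone.black := fun d hd =>
      Position.play_eq_black (hX d hd) hc _
    have hC1 : ∀ d ∈ C, d ≠ c → P.play c Stone.white d ≠ some Stone.white := by
      intro d hd hdc
      rw [P.play_of_ne _ hdc]
      exact hC d hd
    by_cases hcC : c ∈ C
    · have hC2 : ∀ d ∈ C' c, P.play c Stone.white d ≠ some Stone.white := by
        intro d hd
        have := hC' c hcC hd
        exact hC1 d this.1 fun e => this.2 (Or.inl e)
      match hmp : P.play c Stone.white (m c) with
      | none =>
        refine .black_to_move _ (m c) hmp (IH _ (((P.play c Stone.white).emptyCount_play hmp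
          _).trans (hN ▸ hlt)) _ rfl _ _ (h c hcC) ?_ fun d hd => ?_)
        · rintro d (rfl | hd)
          · exact Position.play_self _ _ _
          · exact Position.play_eq_black (hX' d hd) hmp _
        · rw [Position.play_of_ne _ _ fun e => (hC' c hcC hd).2 (Or.inr e)]
          exact hC2 d hd
      | some Stone.white => exact absurd hmp (hC1 _ (hm c hcC) (hmc c hcC))
      | some Stone.black =>
        refine pass _ _ _ (hN ▸ hlt) (h c hcC) ?_ hC2
        rintro d (rfl | hd)
        · exact hmp
        · exact hX' d hd
    · exact pass _ X C (hN ▸ hlt) (.reply X C hne m C' hm hmc hC' h) hX' fun d hd =>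
        hC1 d hd (by rintro rfl; exact hcC hd)

/-- A chain in `X` joins the cell `a` to a cell of `T`. -/
def Joined {k n : ℕ} (a : Cell k n) (T : Set (Cell k n)) (X : Set (Cell k n)) : Prop :=
  ∃ b ∈ T, ∃ w : (hexGraph k n).Walk a b, ∀ c ∈ w.support, c ∈ X

section Joined

variable {k n : ℕ} {a b : Cell k n} {T X : Set (Cell k n)}

theorem joined_mono : Monotone (Joined a T) := by
  rintro X Y hXY ⟨b, hb, w, hw⟩
  exact ⟨b, hb, w, fun c hc => hXY (hw c hc)⟩

theorem joined_self (hT : a ∈ T) (hX : a ∈ X) : Joined a T X :=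
  ⟨a, hT, .nil, by simpa using hX⟩

theorem Joined.cons (h : Joined b T X) (hX : a ∈ X) (hab : (hexGraph k n).Adj a b) :
    Joined a T X := by
  obtain ⟨c, hc, w, hw⟩ := h
  exact ⟨c, hc, .cons hab w, by simpa [hX] using hw⟩

theorem Joined.trans (h : Joined a {b} X) (h' : Joined b T X) : Joined a T X := by
  obtain ⟨_, rfl, w, hw⟩ := h
  obtain ⟨c, hc, w', hw'⟩ := h'
  refine ⟨c, hc, w.append w', fun d hd => ?_⟩
  rw [SimpleGraph.Walk.mem_support_append_iff] at hd
  exact hd.elim (hw d) (hw' d)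

theorem joins_of_joined (h : Joined a {c | c.2.val = 0} X)
    (h' : Joined a {c | c.2.val + 1 = n} X) : Joins X := by
  obtain ⟨p, hp, w, hw⟩ := h
  obtain ⟨q, hq, w', hw'⟩ := h'
  refine ⟨p, q, hp, hq, w.reverse.append w', fun d hd => ?_⟩
  rw [SimpleGraph.Walk.mem_support_append_iff, SimpleGraph.Walk.support_reverse,
    List.mem_reverse] at hd
  exact hd.elim (hw d) (hw' d)

theorem achievable_edge {u v : Cell k n} (ha : a ∈ X) (huv : u ≠ v)
    (hu : (hexGraph k n).Adj a u) (hv : (hexGraph k n).Adj a v) (huT : u ∈ T) (hvT : v ∈ T) :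
    Achievable (Joined a T) X {u, v} :=
  achievable_pair huv ((joined_self huT (by simp)).cons (by simp [ha]) hu)
    ((joined_self hvT (by simp)).cons (by simp [ha]) hv)

theorem achievable_bridge {u v : Cell k n} (ha : a ∈ X) (hb : b ∈ X) (huv : u ≠ v)
    (hu : (hexGraph k n).Adj a u) (hv : (hexGraph k n).Adj a v)
    (hu' : (hexGraph k n).Adj u b) (hv' : (hexGraph k n).Adj v b) :
    Achievable (Joined a {b}) X {u, v} :=
  achievable_pair huv
    (((joined_self (Set.mem_singleton b) (by simp [hb])).cons (by simp) hu').cons (by simp [ha]) hu)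
    (((joined_self (Set.mem_singleton b) (by simp [hb])).cons (by simp) hv').cons (by simp [ha]) hv)

/-- The edge template for a stone on the third line. -/
theorem achievable_ziggurat {x y z d e₀ e₁ e₂ e₃ : Cell k n} (ha : a ∈ X)
    (hne : [x, y, z, d, e₀, e₁, e₂, e₃].Nodup)
    (hax : (hexGraph k n).Adj a x) (hay : (hexGraph k n).Adj a y) (had : (hexGraph k n).Adj a d)
    (hxz : (hexGraph k n).Adj x z) (hdz : (hexGraph k n).Adj d z)
    (hxe₁ : (hexGraph k n).Adj x e₁) (hxe₂ : (hexGraph k n).Adj x e₂)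
    (hye₂ : (hexGraph k n).Adj y e₂) (hye₃ : (hexGraph k n).Adj y e₃)
    (hze₀ : (hexGraph k n).Adj z e₀) (hze₁ : (hexGraph k n).Adj z e₁)
    (he₀ : e₀ ∈ T) (he₁ : e₁ ∈ T) (he₂ : e₂ ∈ T) (he₃ : e₃ ∈ T) :
    Achievable (Joined a T) X {x, y, z, d, e₀, e₁, e₂, e₃} := by
  simp only [List.nodup_cons, List.mem_cons, not_or, List.not_mem_nil, not_false_eq_true,
    List.nodup_nil, and_true] at hne
  have viaX : Achievable (Joined a T) (insert x X) {e₁, e₂} :=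
    (achievable_edge (by simp) (by tauto) hxe₁ hxe₂ he₁ he₂).imp fun Y hY h =>
      h.cons (hY (by simp [ha])) hax
  have viaY : Achievable (Joined a T) (insert y X) {e₂, e₃} :=
    (achievable_edge (by simp) (by tauto) hye₂ hye₃ he₂ he₃).imp fun Y hY h =>
      h.cons (hY (by simp [ha])) hay
  have viaZ : Achievable (Joined a T) (insert z X) ({d, x} ∪ {e₀, e₁}) := by
    refine ((achievable_bridge (b := z) (X := insert z X) (by simp [ha]) (by simp) (by tauto) had
      hax hdz hxz).and joined_mono joined_mono
      (achievable_edge (by simp) (by tauto) hze₀ hze₁ he₀ he₁) ?_).imp fun Y _ h => h.1.trans h.2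
    rw [Set.disjoint_left]
    rintro c (rfl | rfl) (rfl | rfl) <;> tauto
  refine .of_replies ⟨x, by simp⟩ fun c hc => ?_
  by_cases h₂ : c = e₂
  · refine ⟨z, by simp, by subst h₂; tauto, _, ?_, viaZ⟩
    subst h₂
    rintro t ((rfl | rfl) | (rfl | rfl)) <;> simp <;> tauto
  by_cases h₁ : c = x ∨ c = e₁
  · refine ⟨y, by simp, by rintro rfl; tauto, _, ?_, viaY⟩
    rintro t (rfl | rfl) <;> simp <;> rcases h₁ with rfl | rfl <;> tauto
  · refine ⟨x, by simp, by rintro rfl; tauto, _, ?_, viaX⟩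
    rintro t (rfl | rfl) <;> simp <;> tauto

end Joined

theorem hexGraph_adj_of {n : ℕ} {c d : Cell 4 n}
    (h : (d.1.val = c.1.val ∧ d.2.val = c.2.val + 1) ∨ (c.1.val = d.1.val ∧ c.2.val = d.2.val + 1) ∨
      (d.1.val = c.1.val + 1 ∧ d.2.val = c.2.val) ∨ (c.1.val = d.1.val + 1 ∧ c.2.val = d.2.val) ∨
      (d.1.val = c.1.val + 1 ∧ d.2.val + 1 = c.2.val) ∨
      (c.1.val = d.1.val + 1 ∧ c.2.val + 1 = d.2.val)) : (hexGraph 4 n).Adj c d := by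
  rw [hexGraph, SimpleGraph.fromRel_adj]
  refine ⟨?_, by omega⟩
  rintro rfl
  omega

/-- The cell in row `i` and column `j`. -/
abbrev cellAt {n : ℕ} (i j : ℕ) (hi : i < 4 := by decide) (hj : j < n := by omega) : Cell 4 n :=
  (⟨i, hi⟩, ⟨j, hj⟩)

/-- A chain of bridges in the two middle rows. -/
def middleChain (n : ℕ) : Finset (Cell 4 n) :=
  Finset.univ.filter fun c => c.2.val + 2 ≤ n ∧
    ((c.1.val = 1 ∧ c.2.val % 3 = 2) ∨ (c.1.val = 2 ∧ c.2.val % 3 = 0 ∧ 3 ≤ c.2.val))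

theorem mem_middleChain {n : ℕ} {c : Cell 4 n} : c ∈ middleChain n ↔ c.2.val + 2 ≤ n ∧
    ((c.1.val = 1 ∧ c.2.val % 3 = 2) ∨ (c.1.val = 2 ∧ c.2.val % 3 = 0 ∧ 3 ≤ c.2.val)) := by
  simp [middleChain]

theorem card_middleChain_le (n : ℕ) : (middleChain n).card ≤ (2 * n - 4) / 3 := by
  rw [← Finset.card_range ((2 * n - 4) / 3)]
  refine Finset.card_le_card_of_injOn (fun c => (2 * c.2.val - 3) / 3) (fun c hc => ?_) ?_
  · rw [Finset.mem_coe, mem_middleChain] at hc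
    simp only [Finset.coe_range, Set.mem_Iio]
    omega
  · intro c hc d hd h
    rw [Finset.mem_coe, mem_middleChain] at hc hd
    simp only at h
    refine Prod.ext (Fin.ext ?_) (Fin.ext ?_) <;> omega

/-- Black can join the cell `a` to the left edge with the help of the chain, within `C`. -/
abbrev LeftLinked {n : ℕ} (a : Cell 4 n) (C : Set (Cell 4 n)) : Prop :=
  Achievable (Joined a {c | c.2.val = 0}) (middleChain n : Set (Cell 4 n)) C

theorem LeftLinked.bridge {n : ℕ} {a b u v : Cell 4 n} {C D : Set (Cell 4 n)}
    (h : LeftLinked b C) (ha : a ∈ middleChain n) (hb : b ∈ middleChain n) (huv : u ≠ v)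
    (hau : (hexGraph 4 n).Adj a u) (hav : (hexGraph 4 n).Adj a v)
    (hub : (hexGraph 4 n).Adj u b) (hvb : (hexGraph 4 n).Adj v b) (hu : u ∉ C) (hv : v ∉ C)
    (hD : insert u (insert v C) ⊆ D) : LeftLinked a D := by
  refine .weaken _ _ _ ?_ (((achievable_bridge ha hb huv hau hav hub hvb).and joined_mono
    joined_mono h ?_).imp fun Y _ h => h.1.trans h.2)
  · rintro c ((rfl | rfl) | hc)
    · exact hD (by simp)
    · exact hD (by simp)
    · exact hD (by simp [hc])
  · rw [Set.disjoint_left]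
    rintro c (rfl | rfl)
    · exact hu
    · exact hv

theorem leftLinked_first {n : ℕ} (h : 4 ≤ n) :
    LeftLinked (n := n) (cellAt 1 2) {c | c.2.val < 2 ∨ c.1.val = 0 ∧ c.2.val = 2} := by
  refine .weaken _ _ _ ?_ (achievable_ziggurat (x := cellAt 1 1) (y := cellAt 2 1)
    (z := cellAt 0 1) (d := cellAt 0 2) (e₀ := cellAt 0 0) (e₁ := cellAt 1 0)
    (e₂ := cellAt 2 0) (e₃ := cellAt 3 0) ?_ ?_ ?_ ?_ ?_ ?_ ?_ ?_ ?_ ?_ ?_ ?_ ?_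
    rfl rfl rfl rfl)
  · rintro c (rfl | rfl | rfl | rfl | rfl | rfl | rfl | rfl) <;> simp
  · rw [Finset.mem_coe, mem_middleChain]; dsimp only [cellAt]; omega
  · simp
  all_goals exact hexGraph_adj_of (by simp)

theorem LeftLinked.down {n a : ℕ} (h : 3 * a + 5 ≤ n)
    (hl : LeftLinked (n := n) (cellAt 1 (3 * a + 2))
      {c | c.2.val < 3 * a + 2 ∨ c.1.val = 0 ∧ c.2.val = 3 * a + 2}) :
    LeftLinked (n := n) (cellAt 2 (3 * a + 3))
      {c | c.2.val < 3 * a + 3 ∨ c.1.val = 1 ∧ c.2.val = 3 * a + 3} := by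
  refine hl.bridge (u := cellAt 1 (3 * a + 3)) (v := cellAt 2 (3 * a + 2)) ?_ ?_ ?_ ?_ ?_ ?_ ?_ ?_
    ?_ ?_
  · rw [mem_middleChain]; dsimp only [cellAt]; omega
  · rw [mem_middleChain]; dsimp only [cellAt]; omega
  · simp
  iterate 4 exact hexGraph_adj_of (by dsimp only [cellAt]; omega)
  · simp
  · simp
  · rintro c (rfl | rfl | hc)
    · simp
    · simp
    · rw [Set.mem_ofPred_eq] at hc ⊢
      omega

theorem LeftLinked.up {n a : ℕ} (h : 3 * a + 7 ≤ n)
    (hl : LeftLinked (n := n) (cellAt 2 (3 * a + 3))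
      {c | c.2.val < 3 * a + 3 ∨ c.1.val = 1 ∧ c.2.val = 3 * a + 3}) :
    LeftLinked (n := n) (cellAt 1 (3 * (a + 1) + 2))
      {c | c.2.val < 3 * (a + 1) + 2 ∨ c.1.val = 0 ∧ c.2.val = 3 * (a + 1) + 2} := by
  refine hl.bridge (u := cellAt 1 (3 * a + 4)) (v := cellAt 2 (3 * a + 4)) ?_ ?_ ?_ ?_ ?_ ?_ ?_ ?_
    ?_ ?_
  · rw [mem_middleChain]; dsimp only [cellAt]; omega
  · rw [mem_middleChain]; dsimp only [cellAt]; omega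
  · simp
  iterate 4 exact hexGraph_adj_of (by dsimp only [cellAt]; omega)
  · simp
  · simp
  · rintro c (rfl | rfl | hc)
    · simp; omega
    · simp; omega
    · rw [Set.mem_ofPred_eq] at hc ⊢
      omega

theorem leftLinked_upper {n a : ℕ} (h : 3 * a + 4 ≤ n) :
    LeftLinked (n := n) (cellAt 1 (3 * a + 2))
      {c | c.2.val < 3 * a + 2 ∨ c.1.val = 0 ∧ c.2.val = 3 * a + 2} := by
  induction a with
  | zero => exact leftLinked_first h
  | succ a ih => exact (LeftLinked.down (by omega) (ih (by omega))).up (by omega)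

theorem LeftLinked.isVirtualConnection {n : ℕ} {a : Cell 4 n} {C D : Set (Cell 4 n)}
    (h : LeftLinked a C)
    (h' : Achievable (Joined a {c | c.2.val + 1 = n}) (middleChain n : Set (Cell 4 n)) D)
    (hCD : Disjoint C D) : IsVirtualConnection (middleChain n) := by
  refine ((h.and joined_mono joined_mono h' hCD).imp fun Y _ h =>
    joins_of_joined h.1 h.2).blackWins (fun c hc => ?_) (fun c _ => ?_)
  · rw [Finset.mem_coe] at hc
    simp [blackStones, hc]
  · by_cases hc : c ∈ middleChain n <;> simp [blackStones, hc]

theorem isVirtualConnection_middleChain {n : ℕ} (hn : 4 ≤ n) :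
    IsVirtualConnection (middleChain n) := by
  obtain ⟨a, ha⟩ : ∃ a, n = 3 * a + 4 ∨ n = 3 * a + 5 ∨ n = 3 * a + 6 := ⟨(n - 4) / 3, by omega⟩
  have hup := leftLinked_upper (n := n) (a := a) (by omega)
  rcases ha with ha | ha
  · refine hup.isVirtualConnection (achievable_edge (u := cellAt 0 (3 * a + 3))
      (v := cellAt 1 (3 * a + 3)) ?_ ?_ ?_ ?_ ?_ ?_) ?_
    · rw [Finset.mem_coe, mem_middleChain]; dsimp only [cellAt]; omega
    · simp
    iterate 2 exact hexGraph_adj_of (by dsimp only [cellAt]; omega)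
    iterate 2 rw [Set.mem_ofPred_eq]; dsimp only [cellAt]; omega
    rw [Set.disjoint_right]
    rintro c (rfl | rfl) <;> simp
  have hdown := LeftLinked.down (by omega) hup
  rcases ha with ha | ha
  · refine hdown.isVirtualConnection (achievable_edge (u := cellAt 1 (3 * a + 4))
      (v := cellAt 2 (3 * a + 4)) ?_ ?_ ?_ ?_ ?_ ?_) ?_
    · rw [Finset.mem_coe, mem_middleChain]; dsimp only [cellAt]; omega
    · simp
    iterate 2 exact hexGraph_adj_of (by dsimp only [cellAt]; omega)
    iterate 2 rw [Set.mem_ofPred_eq]; dsimp only [cellAt]; omega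
    rw [Set.disjoint_right]
    rintro c (rfl | rfl) <;> simp
  · refine hdown.isVirtualConnection (achievable_ziggurat (x := cellAt 2 (3 * a + 4))
      (y := cellAt 1 (3 * a + 4)) (z := cellAt 3 (3 * a + 4)) (d := cellAt 3 (3 * a + 3))
      (e₀ := cellAt 3 (3 * a + 5)) (e₁ := cellAt 2 (3 * a + 5)) (e₂ := cellAt 1 (3 * a + 5))
      (e₃ := cellAt 0 (3 * a + 5)) ?_ ?_ ?_ ?_ ?_ ?_ ?_ ?_ ?_ ?_ ?_ ?_ ?_ ?_ ?_ ?_ ?_) ?_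
    · rw [Finset.mem_coe, mem_middleChain]; dsimp only [cellAt]; omega
    · simp
    iterate 11 exact hexGraph_adj_of (by dsimp only [cellAt]; omega)
    iterate 4 rw [Set.mem_ofPred_eq]; dsimp only [cellAt]; omega
    rw [Set.disjoint_right]
    rintro c (rfl | rfl | rfl | rfl | rfl | rfl | rfl | rfl) <;> simp

end HexBoard

theorem mainTheorem11 (n : ℕ) (hn : 4 ≤ n) :
    IsLeast {s : ℕ | ∃ B : Finset (HexBoard.Cell 4 n),
      B.card = s ∧ HexBoard.IsVirtualConnection B} ⌈(2 / 3 : ℚ) * n - 2⌉₊ := by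
  have lower : ∀ B : Finset (HexBoard.Cell 4 n), HexBoard.IsVirtualConnection B →
      ⌈(2 / 3 : ℚ) * n - 2⌉₊ ≤ B.card := by
    intro B hB
    rw [Nat.ceil_le]
    have : (2 * n : ℚ) ≤ 3 * B.card + 6 := by exact_mod_cast hB.two_mul_le
    linarith
  refine ⟨⟨HexBoard.middleChain n, ?_, HexBoard.isVirtualConnection_middleChain hn⟩, ?_⟩
  · refine le_antisymm ?_ (lower _ (HexBoard.isVirtualConnection_middleChain hn))
    have h := HexBoard.card_middleChain_le n
    rw [← Nat.lt_add_one_iff]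
    have : ((HexBoard.middleChain n).card : ℚ) < ⌈(2 / 3 : ℚ) * n - 2⌉₊ + 1 := by
      have h1 : (3 * (HexBoard.middleChain n).card + 4 : ℚ) ≤ 2 * n := by
        have : 3 * (HexBoard.middleChain n).card + 4 ≤ 2 * n := by omega
        exact_mod_cast this
      have := Nat.le_ceil ((2 / 3 : ℚ) * n - 2)
      linarith
    exact_mod_cast this
  · rintro _ ⟨B, rfl, hB⟩
    exact lower B hB
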